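/- Let $\beta\in L^1(\mathbb R)$ be real-valued with distributional derivative $\beta'=\mu$ a finite signed Borel measure on $\mathbb R$. Let $s>\frac12$, and let $f\in C^{[s]+1}(\mathbb R)$ be real-valued with $f(0)=0$, where $[s]$ is the largest integer not exceeding $s$. Let $\varphi\in H^s(\mathbb R)$, where $H^s=H^s(\mathbb R)$ is the usual $L^2$-based Sobolev space of real-valued functions. Then there is $T>0$ such that the Cauchy problem $$u_t+(\beta*f(u))_x=0,\qquad u(0)=\varphi,\qquad (\beta*v)(x)=\int_{\mathbb R}\beta(x-y)v(y)\,dy,$$ is locally well-posed on $[0,T]$ with solution $u\in C^1([0,T],H^s)$; that is, there is a neighbourhood $U$ of $\varphi$ in $H^s$ such that 1. (existence) for every $\psi\in U$ there is $u^\psi\in C^1([0,T],H^s)$ with $u^\psi(0)=\psi$ and $u^\psi_t(t)=-(\beta*f(u^\psi(t)))_x$ for all $t\in[0,T]$, where $u_t$ is the derivative of the $H^s$-valued curve (one-sided at the end points) and $(\cdot)_x$ is the derivative in the sense of distributions; 2. (uniqueness) for every $\psi\in U$ and $0<T'\le T$, every solution in $C^1([0,T'],H^s)$ with initial datum $\psi$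 coincides with $u^\psi$ on $[0,T']$; 3. (continuous dependence) the map $\psi\mapsto u^\psi$ is continuous from $U\subset H^s$ to $C^1([0,T],H^s)$ with the norm $\sup_{[0,T]}\|u\|_{H^s}+\sup_{[0,T]}\|u_t\|_{H^s}$. -/

import Mathlib

open MeasureTheory Set
open scoped ContDiff SchwartzMap Convolution

noncomputable section

/-- The tempered distribution on the line given by a real-valued square-integrable function. -/
def realL2ToTempered : Lp ℝ 2 (volume : Measure ℝ) →ₗ[ℝ] 𝓢'(ℝ, ℂ) :=
  ((Lp.toTemperedDistributionCLM ℂ (volume : Measure ℝ) 2 : _ →ₗ[ℂ] _).restrictScalars ℝ) ∘ₗ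
    (Complex.ofRealCLM.compLpL 2 (volume : Measure ℝ) :
      Lp ℝ 2 (volume : Measure ℝ) →ₗ[ℝ] Lp ℂ 2 (volume : Measure ℝ))

theorem tempered_injective :
    Function.Injective (Lp.toTemperedDistributionCLM ℂ (volume : Measure ℝ) 2) :=
  LinearMap.ker_eq_bot.mp Lp.ker_toTemperedDistributionCLM_eq_bot

theorem realL2ToTempered_injective : Function.Injective realL2ToTempered := by
  intro u v h
  have h1 := tempered_injective h
  apply Lp.ext
  have hu := Complex.ofRealCLM.coeFn_compLp u
  have hv := Complex.ofRealCLM.coeFn_compLp v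
  have h2 : Complex.ofRealCLM.compLp u = Complex.ofRealCLM.compLp v := h1
  rw [h2] at hu
  filter_upwards [hu, hv] with x hx hy
  rw [hx] at hy
  exact Complex.ofReal_injective hy

/-- The real-valued `L²` functions on the line lying in the Sobolev space of order `s`. -/
def sobolevSubmodule (s : ℝ) : Submodule ℝ (Lp ℝ 2 (volume : Measure ℝ)) where
  carrier := {u | TemperedDistribution.MemSobolev s 2 (realL2ToTempered u)}
  zero_mem' := by
    change TemperedDistribution.MemSobolev s 2 (realL2ToTempered 0)
    rw [map_zero]
    exact TemperedDistribution.memSobolev_fun_zero ℝ ℂ s 2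
  add_mem' {u v} hu hv := by
    change TemperedDistribution.MemSobolev s 2 (realL2ToTempered (u + v))
    rw [map_add]
    exact TemperedDistribution.MemSobolev.add hu hv
  smul_mem' c u hu := by
    change TemperedDistribution.MemSobolev s 2 (realL2ToTempered (c • u))
    rw [map_smul]
    exact TemperedDistribution.MemSobolev.smul (c : ℂ) hu

/-- For `s ≥ 0`, the usual space `H^s(ℝ)` of real-valued functions (modulo equality almost
everywhere), consisting of those `u ∈ L²(ℝ)` for which `(1 + |ξ|²)^(s/2) û(ξ)` is square-integrable.
It carries the `H^s` norm defined below, not the `L²` norm. -/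
def SobolevH (s : ℝ) : Type := sobolevSubmodule s

namespace SobolevH

variable {s : ℝ}

instance : AddCommGroup (SobolevH s) := inferInstanceAs (AddCommGroup (sobolevSubmodule s))

instance : Module ℝ (SobolevH s) := inferInstanceAs (Module ℝ (sobolevSubmodule s))

/-- The underlying square-integrable function. -/
def toL2 : SobolevH s →ₗ[ℝ] Lp ℝ 2 (volume : Measure ℝ) := (sobolevSubmodule s).subtype

/-- An element of `H^s` is used as a function through its `L²` representative. -/
instance : CoeFun (SobolevH s) fun _ => ℝ → ℝ := ⟨fun u => (toL2 u : ℝ → ℝ)⟩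

/-- The `L²` function which represents the Bessel potential of `u`, that is, the inverse Fourier
transform of `(1 + |ξ|²)^(s/2) û(ξ)`. -/
def bessel (u : SobolevH s) : Lp ℂ 2 (volume : Measure ℝ) :=
  Classical.choose (u.2 : TemperedDistribution.MemSobolev s 2 (realL2ToTempered u.1))

theorem bessel_spec (u : SobolevH s) :
    TemperedDistribution.besselPotential ℝ ℂ s (realL2ToTempered (toL2 u)) =
      Lp.toTemperedDistributionCLM ℂ (volume : Measure ℝ) 2 (bessel u) :=
  Classical.choose_spec (u.2 : TemperedDistribution.MemSobolev s 2 (realL2ToTempered u.1))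

/-- `bessel` as a linear map. -/
def besselₗ : SobolevH s →ₗ[ℝ] Lp ℂ 2 (volume : Measure ℝ) where
  toFun := bessel
  map_add' u v := tempered_injective (by
    rw [map_add, ← bessel_spec, ← bessel_spec, ← bessel_spec, map_add, map_add, map_add])
  map_smul' c u := tempered_injective (by
    have h1 := (Lp.toTemperedDistributionCLM ℂ (volume : Measure ℝ) 2).map_smul
      (c : ℂ) (bessel u)
    have h2 := (TemperedDistribution.besselPotential ℝ ℂ s).map_smul
      (c : ℂ) (realL2ToTempered (toL2 u))
    rw [← bessel_spec] at h1 ⊢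
    rw [map_smul, map_smul]
    exact h2.trans h1.symm)

theorem besselₗ_injective : Function.Injective (besselₗ : SobolevH s →ₗ[ℝ] _) := by
  intro u v h
  have h1 : TemperedDistribution.besselPotential ℝ ℂ s (realL2ToTempered (toL2 u)) =
      TemperedDistribution.besselPotential ℝ ℂ s (realL2ToTempered (toL2 v)) := by
    rw [bessel_spec, bessel_spec]
    exact congrArg _ h
  have h2 := congrArg (TemperedDistribution.besselPotential ℝ ℂ (-s)) h1
  simp only [TemperedDistribution.besselPotential_besselPotential_apply, add_neg_cancel,
    TemperedDistribution.besselPotential_zero, ContinuousLinearMap.id_apply] at h2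
  exact Subtype.ext (realL2ToTempered_injective h2)

/-- The `H^s` norm: by Plancherel, `‖u‖` is the `L²` norm of `(1 + |ξ|²)^(s/2) û(ξ)`. -/
instance : NormedAddCommGroup (SobolevH s) :=
  NormedAddCommGroup.induced _ _ (besselₗ : SobolevH s →ₗ[ℝ] Lp ℂ 2 (volume : Measure ℝ))
    besselₗ_injective

instance : NormedSpace ℝ (SobolevH s) :=
  NormedSpace.induced ℝ _ _ (besselₗ : SobolevH s →ₗ[ℝ] Lp ℂ 2 (volume : Measure ℝ))

end SobolevH

/-- `g` is the derivative of `v` on the line in the sense of distributions. -/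
def HasWeakDeriv (v g : ℝ → ℝ) : Prop :=
  LocallyIntegrable v ∧ LocallyIntegrable g ∧
    ∀ θ : ℝ → ℝ, ContDiff ℝ ∞ θ → HasCompactSupport θ →
      ∫ x, v x * deriv θ x = -∫ x, g x * θ x

/-- The distributional derivative of the function `b` is the finite signed Borel measure `μ`
(the integral against `μ` is written by means of its Jordan decomposition). -/
def HasMeasureDeriv (b : ℝ → ℝ) (μ : SignedMeasure ℝ) : Prop :=
  LocallyIntegrable b ∧
    ∀ θ : ℝ → ℝ, ContDiff ℝ ∞ θ → HasCompactSupport θ →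
      ∫ x, b x * deriv θ x =
        -((∫ x, θ x ∂μ.toJordanDecomposition.posPart) -
          ∫ x, θ x ∂μ.toJordanDecomposition.negPart)

/-- `u ∈ C¹([0,T], H^s)` solves `u_t + (β ∗ f(u))_x = 0` on `[0,T]` with `u(0) = φ`: the time
derivative is the derivative of the curve `u` in `H^s` (one-sided at the end points), the space
derivative is taken in the sense of distributions, for every `t ∈ [0,T]`. -/
structure IsSolution (β f : ℝ → ℝ) {s : ℝ} (T : ℝ) (φ : SobolevH s) (u : ℝ → SobolevH s) :
    Prop where
  contDiffOn : ContDiffOn ℝ 1 u (Icc 0 T)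
  initial : u 0 = φ
  equation : ∀ t ∈ Icc 0 T,
    HasWeakDeriv (β ⋆[ContinuousLinearMap.mul ℝ ℝ, volume] fun y => f (u t y))
      (fun x => -(derivWithin u (Icc 0 T) t) x)

/-- The initial-value problem `u_t + (β ∗ f(u))_x = 0`, `u(0) = φ`, is well-posed in
`C¹([0,T], H^s)`: for all initial data in a neighbourhood of `φ` there is a solution on `[0,T]`,
it is unique (on `[0,T]` and on every shorter interval), and it depends continuously on the initial
datum, as a map from `H^s` to `C¹([0,T], H^s)` with the norm
`sup ‖u(t)‖ + sup ‖u'(t)‖` over `t ∈ [0,T]`. -/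
def WellPosedOn (β f : ℝ → ℝ) {s : ℝ} (T : ℝ) (φ : SobolevH s) : Prop :=
  ∃ r > 0, ∃ S : SobolevH s → ℝ → SobolevH s,
    (∀ ψ ∈ Metric.ball φ r, IsSolution β f T ψ (S ψ)) ∧
    (∀ ψ ∈ Metric.ball φ r, ∀ T', 0 < T' → T' ≤ T → ∀ v : ℝ → SobolevH s,
      IsSolution β f T' ψ v → EqOn v (S ψ) (Icc 0 T')) ∧
    (∀ ψ ∈ Metric.ball φ r, ∀ ε > 0, ∃ δ > 0, ∀ χ ∈ Metric.ball φ r, ‖χ - ψ‖ < δ →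
      ∀ t ∈ Icc 0 T, ‖S χ t - S ψ t‖ < ε ∧
        ‖derivWithin (S χ) (Icc 0 T) t - derivWithin (S ψ) (Icc 0 T) t‖ < ε)

end

open MeasureTheory Set
open scoped ContDiff SchwartzMap Convolution

open FourierTransform Filter Topology
open scoped NNReal

noncomputable section

/-! Since `β' = μ` is a finite measure, `-(β ∗ v)_x = -μ ∗ v` is a signed superposition of
translates of `v`. Translations are isometries of both `H^s` and `L²`, so this operator is bounded
on both, with norm at most the total mass of `μ`. The equation is therefore an ordinary differential
equation `u_t = F(u)` in `H^s` with `F(u) = -μ ∗ f(u)`, and everything turns on the superposition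
operator `u ↦ f(u)`.

With `[s] + 1` continuous derivatives of `f`, the top derivative has only a modulus of continuity,
so a Lipschitz estimate on bounded sets of `H^s` is not directly available. The substitute is
`NemBound`: `‖f(u) - f(v)‖_s ≤ L ‖u - v‖_s + C_ε ‖u - v‖_{L²} + ε`, where `L` does not depend on
`ε`. For `1/2 < s < 1` it comes from the Gagliardo seminorm and a pointwise bound on second
differences of `f` (`nemBound_of_lt_one`). For `s ≥ 1` the chain rule and the multiplication `H^a ×
H^(s-1) → H^(s-1)` reduce it to the same bound for `f' - f'(0)` in a lower order `a`
(`nemBound_of_deriv`); `nemBound` is the resulting induction.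

This is enough for Picard iteration in two norms. On bounded sets of `H^s` the field `F` is
Lipschitz for the `L²` norm, so for small `T` the iterates are Cauchy in `L²`. Once they are close
in `L²`, the `C_ε` term is negligible, and each further step halves the `H^s` distance up to an
arbitrarily small error; `T` is fixed before `ε`, so the iterates converge uniformly in `H^s`
(`PicardTime.strong_cauchy`). The same comparison, applied to two solutions, gives continuous
dependence, and Gronwall's inequality in `L²` gives uniqueness (`WeaklyLipschitz.wellPosed`). -/

/-! ### Fourier description of `H^s` and completeness -/

/-- The real-valued square-integrable functions on the line. -/
abbrev RealL2 := Lp ℝ 2 (volume : Measure ℝ)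

/-- The complex-valued square-integrable functions on the line. -/
abbrev ComplexL2 := Lp ℂ 2 (volume : Measure ℝ)

/-- The complexification of a real square-integrable function. -/
def complexify : RealL2 →L[ℝ] ComplexL2 := Complex.ofRealCLM.compLpL 2 volume

theorem coeFn_complexify (w : RealL2) : complexify w =ᵐ[volume] fun x => (w x : ℂ) :=
  Complex.ofRealCLM.coeFn_compLpL w

theorem norm_complexify (w : RealL2) : ‖complexify w‖ = ‖w‖ := by
  rw [Lp.norm_def, Lp.norm_def]
  congr 1
  apply eLpNorm_congr_norm_ae
  filter_upwards [coeFn_complexify w] with x hx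
  rw [hx, Complex.norm_real]

/-- The Fourier transform of a real square-integrable function. -/
def hat : RealL2 →L[ℝ] ComplexL2 :=
  ((Lp.fourierTransformₗᵢ ℝ ℂ).toContinuousLinearEquiv.toContinuousLinearMap.restrictScalars ℝ) ∘L
    complexify

theorem hat_apply (w : RealL2) : hat w = 𝓕 (complexify w) := rfl

theorem norm_hat (w : RealL2) : ‖hat w‖ = ‖w‖ := by
  rw [hat_apply, Lp.norm_fourier_eq, norm_complexify]

theorem Lp.locallyIntegrable_two {E : Type*} [NormedAddCommGroup E]
    (f : Lp E 2 (volume : Measure ℝ)) : LocallyIntegrable f :=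
  (Lp.memLp f).locallyIntegrable (by norm_num)

/-- Locally integrable functions which agree when tested agree almost everywhere. -/
theorem ae_eq_of_test {F G : ℝ → ℂ} (hF : LocallyIntegrable F) (hG : LocallyIntegrable G)
    (h : ∀ θ : ℝ → ℂ, ContDiff ℝ ∞ θ → HasCompactSupport θ → ∫ x, θ x * F x = ∫ x, θ x * G x) :
    F =ᵐ[volume] G := by
  apply ae_eq_of_integral_contDiff_smul_eq hF hG
  intro g hg hg'
  have := h (Complex.ofRealCLM ∘ g) (by fun_prop) (hg'.comp_left rfl)
  simpa using this

theorem integral_fourier_mul (w : ComplexL2) (θ : 𝓢(ℝ, ℂ)) :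
    ∫ x, θ x * (𝓕 w : ComplexL2) x = ∫ x, (𝓕 (θ : ℝ → ℂ)) x * w x := by
  have h := Lp.fourier_toTemperedDistribution_eq w
  have h2 := DFunLike.congr_fun h θ
  rw [TemperedDistribution.fourier_apply, Lp.toTemperedDistribution_apply,
    Lp.toTemperedDistribution_apply] at h2
  simpa [SchwartzMap.fourier_coe] using h2.symm

/-- The Fourier weight `(1 + ξ²)^(s/2)`. -/
def japanese (s ξ : ℝ) : ℝ := (1 + ξ ^ 2) ^ (s / 2)

theorem japanese_pos (s ξ : ℝ) : 0 < japanese s ξ := by unfold japanese; positivity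

theorem continuous_japanese (s : ℝ) : Continuous (japanese s) := by
  unfold japanese
  exact (by fun_prop : Continuous fun ξ : ℝ => 1 + ξ ^ 2).rpow_const
    fun x => Or.inl (by positivity)

/-- The `H^s` norm of a square-integrable function, possibly infinite. -/
def sobNorm (s : ℝ) (w : RealL2) : ENNReal :=
  eLpNorm (fun ξ => (japanese s ξ : ℂ) * hat w ξ) 2 volume

theorem aestronglyMeasurable_weight_hat (s : ℝ) (w : RealL2) :
    AEStronglyMeasurable (fun ξ => (japanese s ξ : ℂ) * hat w ξ) volume :=
  (Complex.continuous_ofReal.comp (continuous_japanese s)).aestronglyMeasurable.mul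
    (Lp.aestronglyMeasurable _)

/-- The Bessel potential is a Fourier multiplier, so after a Fourier transform both sides are
locally integrable functions and can be compared by testing. This replaces the distributional
definition of `H^s` by a weighted `L²` norm, on which all later estimates are made. -/
theorem besselPotential_eq_iff (s : ℝ) (w : RealL2) (g : ComplexL2) :
    TemperedDistribution.besselPotential ℝ ℂ s (realL2ToTempered w) =
      Lp.toTemperedDistributionCLM ℂ (volume : Measure ℝ) 2 g ↔
    (𝓕 g : ComplexL2) =ᵐ[volume] fun ξ => (japanese s ξ : ℂ) * hat w ξ := by
  have hinj : Function.Injective (𝓕 : 𝓢'(ℝ, ℂ) → 𝓢'(ℝ, ℂ)) := fun a b h => by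
    simpa using congrArg 𝓕⁻ h
  rw [← hinj.eq_iff]
  have h1 : realL2ToTempered w = Lp.toTemperedDistribution (complexify w) := rfl
  rw [TemperedDistribution.fourier_besselPotential_eq_smulLeftCLM_fourier_apply,
    Lp.toTemperedDistributionCLM_apply, Lp.fourier_toTemperedDistribution_eq, h1,
    Lp.fourier_toTemperedDistribution_eq, ← hat_apply]
  have hg : (fun x : ℝ ↦ (((1 + ‖x‖ ^ 2) ^ (s / 2) : ℝ) : ℂ)).HasTemperateGrowth := by fun_prop
  have key : ∀ θ : 𝓢(ℝ, ℂ), (TemperedDistribution.smulLeftCLM ℂ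
      (fun x : ℝ ↦ (((1 + ‖x‖ ^ 2) ^ (s / 2) : ℝ) : ℂ)) (Lp.toTemperedDistribution (hat w))) θ =
      ∫ x, θ x * ((japanese s x : ℂ) * hat w x) := by
    intro θ
    rw [TemperedDistribution.smulLeftCLM_apply_apply, Lp.toTemperedDistribution_apply]
    congr 1
    ext x
    rw [SchwartzMap.smulLeftCLM_apply_apply hg]
    simp only [japanese, Real.norm_eq_abs, sq_abs, smul_eq_mul]
    ring
  constructor
  · intro h
    symm
    apply ae_eq_of_test
    · exact (Lp.locallyIntegrable_two (hat w)).continuous_smul (𝕜 := ℂ)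
        (Complex.continuous_ofReal.comp (continuous_japanese s))
    · exact Lp.locallyIntegrable_two _
    · intro θ h1 h2
      have := DFunLike.congr_fun h (h2.toSchwartzMap h1)
      rw [key, Lp.toTemperedDistribution_apply] at this
      simpa using this
  · intro h
    ext θ
    rw [key, Lp.toTemperedDistribution_apply]
    apply integral_congr_ae
    filter_upwards [h] with x hx
    rw [hx, smul_eq_mul]

theorem SobolevH.enorm_eq_sobNorm {s : ℝ} (u : SobolevH s) : ‖u‖ₑ = sobNorm s (toL2 u) := by
  have h := (besselPotential_eq_iff s _ _).1 u.bessel_spec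
  have h1 : ‖u‖ = ‖u.bessel‖ := rfl
  rw [← ofReal_norm, h1, ← Lp.norm_fourier_eq, ofReal_norm, Lp.enorm_def]
  exact eLpNorm_congr_ae h

theorem mem_sobolevSubmodule_iff {s : ℝ} {w : RealL2} :
    w ∈ sobolevSubmodule s ↔ sobNorm s w < ⊤ := by
  constructor
  · intro h
    have := SobolevH.enorm_eq_sobNorm (⟨w, h⟩ : sobolevSubmodule s)
    exact this ▸ enorm_lt_top
  · intro h
    have hm : MemLp (fun ξ => (japanese s ξ : ℂ) * hat w ξ) 2 volume :=
      ⟨aestronglyMeasurable_weight_hat s w, h⟩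
    refine ⟨𝓕⁻ hm.toLp, ?_⟩
    refine (besselPotential_eq_iff s w _).2 ?_
    rw [fourier_fourierInv_eq]
    exact hm.coeFn_toLp

/-- The element of `H^s` given by a square-integrable function of finite `H^s` norm. -/
def SobolevH.mk {s : ℝ} (w : RealL2) (h : sobNorm s w < ⊤) : SobolevH s :=
  ⟨w, mem_sobolevSubmodule_iff.2 h⟩

theorem SobolevH.toL2_injective {s : ℝ} :
    Function.Injective (toL2 : SobolevH s → RealL2) := Subtype.val_injective

theorem SobolevH.sobNorm_lt_top {s : ℝ} (u : SobolevH s) : sobNorm s (toL2 u) < ⊤ := by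
  rw [← enorm_eq_sobNorm]; exact enorm_lt_top

theorem sobNorm_mono {r s : ℝ} (h : r ≤ s) (w : RealL2) : sobNorm r w ≤ sobNorm s w := by
  apply eLpNorm_mono
  intro ξ
  simp only [norm_mul, Complex.norm_real, Real.norm_eq_abs, abs_of_pos (japanese_pos _ _)]
  gcongr
  unfold japanese
  exact Real.rpow_le_rpow_of_exponent_le (by nlinarith [sq_nonneg ξ]) (by linarith)

theorem sobNorm_zero_order (w : RealL2) : sobNorm 0 w = ‖w‖ₑ := by
  rw [← ofReal_norm, ← norm_hat, ofReal_norm, Lp.enorm_def, sobNorm]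
  simp [japanese]

theorem enorm_le_sobNorm {s : ℝ} (hs : 0 ≤ s) (w : RealL2) : ‖w‖ₑ ≤ sobNorm s w := by
  rw [← sobNorm_zero_order]; exact sobNorm_mono hs w

theorem sobNorm_add_le (s : ℝ) (v w : RealL2) : sobNorm s (v + w) ≤ sobNorm s v + sobNorm s w := by
  unfold sobNorm
  refine le_trans (le_of_eq ?_) (eLpNorm_add_le (aestronglyMeasurable_weight_hat s v)
    (aestronglyMeasurable_weight_hat s w) (by norm_num))
  apply eLpNorm_congr_ae
  rw [map_add]
  filter_upwards [Lp.coeFn_add (hat v) (hat w)] with x hx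
  simp only [Pi.add_apply, ← mul_add]
  rw [hx, Pi.add_apply]

theorem sobNorm_smul (s c : ℝ) (w : RealL2) : sobNorm s (c • w) = ‖c‖ₑ * sobNorm s w := by
  unfold sobNorm
  rw [← eLpNorm_const_smul]
  apply eLpNorm_congr_ae
  rw [map_smul]
  filter_upwards [Lp.coeFn_smul c (hat w)] with x hx
  simp only [hx, Pi.smul_apply, Complex.real_smul]
  ring

theorem sobNorm_neg (s : ℝ) (w : RealL2) : sobNorm s (-w) = sobNorm s w := by
  rw [← neg_one_smul ℝ, sobNorm_smul]; simp

theorem sobNorm_sub_le (s : ℝ) (v w : RealL2) : sobNorm s (v - w) ≤ sobNorm s v + sobNorm s w := by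
  rw [sub_eq_add_neg, ← sobNorm_neg s w]; exact sobNorm_add_le _ _ _

theorem sobNorm_sq (s : ℝ) (w : RealL2) :
    sobNorm s w ^ 2 = ∫⁻ ξ, ENNReal.ofReal ((1 + ξ ^ 2) ^ s) * ‖hat w ξ‖ₑ ^ 2 := by
  rw [sobNorm, eLpNorm_eq_lintegral_rpow_enorm_toReal (by norm_num) (by norm_num)]
  simp only [ENNReal.toReal_ofNat, ENNReal.rpow_ofNat, one_div]
  rw [← ENNReal.rpow_natCast, ← ENNReal.rpow_mul]
  norm_num
  apply lintegral_congr
  intro ξ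
  rw [mul_pow]
  congr 1
  rw [← ofReal_norm, ← ENNReal.ofReal_pow (norm_nonneg _), Complex.norm_real, Real.norm_eq_abs,
    abs_of_pos (japanese_pos _ _), japanese, ← Real.rpow_mul_natCast (by positivity)]
  congr 2
  push_cast; ring

theorem enorm_sq_eq_lintegral_hat (w : RealL2) : ‖w‖ₑ ^ 2 = ∫⁻ ξ, ‖hat w ξ‖ₑ ^ 2 := by
  rw [← sobNorm_zero_order, sobNorm_sq]; simp

theorem SobolevH.norm_toL2_le {s : ℝ} (hs : 0 ≤ s) (u : SobolevH s) : ‖toL2 u‖ ≤ ‖u‖ := by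
  have := enorm_le_sobNorm hs (toL2 u)
  rw [← SobolevH.enorm_eq_sobNorm] at this
  exact enorm_le_iff_norm_le.1 this

/-- The inclusion of `H^s` in `L²` for `s ≥ 0`. -/
def SobolevH.toL2L {s : ℝ} (hs : 0 ≤ s) : SobolevH s →L[ℝ] RealL2 :=
  LinearMap.mkContinuous toL2 1 fun u => by simpa using norm_toL2_le hs u

theorem SobolevH.toL2L_apply {s : ℝ} (hs : 0 ≤ s) (u : SobolevH s) : toL2L hs u = toL2 u := rfl

/-- A Cauchy sequence converges in `L²` together with its Bessel potentials. The Bessel potential is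
continuous on tempered distributions, so its graph is closed and the two limits still match. -/
theorem SobolevH.completeSpace {s : ℝ} (hs : 0 ≤ s) : CompleteSpace (SobolevH s) := by
  apply Metric.complete_of_cauchySeq_tendsto
  intro u hu
  have h1 : CauchySeq fun n => toL2L hs (u n) :=
    hu.map (toL2L hs).uniformContinuous
  have hb : Isometry (bessel : SobolevH s → ComplexL2) := by
    refine Isometry.of_dist_eq fun a b => ?_
    rw [dist_eq_norm, dist_eq_norm]
    have : bessel a - bessel b = bessel (a - b) := ((besselₗ (s := s)).map_sub a b).symm
    rw [this]
    rfl
  have h2 : CauchySeq fun n => bessel (u n) := hu.map hb.uniformContinuous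
  obtain ⟨w, hw⟩ := cauchySeq_tendsto_of_complete h1
  obtain ⟨g, hg⟩ := cauchySeq_tendsto_of_complete h2
  have key : TemperedDistribution.besselPotential ℝ ℂ s (realL2ToTempered w) =
      Lp.toTemperedDistributionCLM ℂ (volume : Measure ℝ) 2 g := by
    have c1 : Continuous (realL2ToTempered : RealL2 → 𝓢'(ℝ, ℂ)) :=
      (Lp.toTemperedDistributionCLM ℂ (volume : Measure ℝ) 2).continuous.comp
        complexify.continuous
    have t1 := (((TemperedDistribution.besselPotential ℝ ℂ s).continuous.comp c1).tendsto w).comp hw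
    have t2 := ((Lp.toTemperedDistributionCLM ℂ (volume : Measure ℝ) 2).continuous.tendsto g).comp
      hg
    refine tendsto_nhds_unique t1 (t2.congr fun n => ?_)
    exact (bessel_spec (u n)).symm
  let v : SobolevH s := ⟨w, ⟨g, key⟩⟩
  have hv : bessel v = g := tempered_injective (by rw [← bessel_spec]; exact key)
  refine ⟨v, ?_⟩
  rw [← hv] at hg
  exact hb.isEmbedding.isInducing.tendsto_nhds_iff.2 hg

/-! ### Translations on `L²` and `H^s` -/

/-- The translate `x ↦ w (x + h)`. -/
def shift (h : ℝ) : RealL2 →ₗᵢ[ℝ] RealL2 :=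
  Lp.compMeasurePreservingₗᵢ ℝ (fun x => x + h) (measurePreserving_add_right volume h)

theorem coeFn_shift (h : ℝ) (w : RealL2) : shift h w =ᵐ[volume] fun x => w (x + h) :=
  Lp.coeFn_compMeasurePreserving w (measurePreserving_add_right volume h)

/-- The character `ξ ↦ exp (2 π i h ξ)`. -/
def wave (h ξ : ℝ) : ℂ := Complex.exp (2 * Real.pi * h * ξ * Complex.I)

theorem contDiff_wave (h : ℝ) : ContDiff ℝ ∞ (wave h) := by
  unfold wave
  have : ContDiff ℝ ∞ fun ξ : ℝ => (ξ : ℂ) := Complex.ofRealCLM.contDiff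
  fun_prop

theorem norm_wave (h ξ : ℝ) : ‖wave h ξ‖ = 1 := by
  unfold wave
  convert Complex.norm_exp_ofReal_mul_I (2 * Real.pi * h * ξ) using 3
  push_cast; ring

theorem fourier_eq_integral_wave (θ : ℝ → ℂ) (x : ℝ) : 𝓕 θ x = ∫ ξ, wave (-x) ξ * θ ξ := by
  rw [Real.fourier_eq']
  apply integral_congr_ae
  filter_upwards with ξ
  simp only [wave, smul_eq_mul]
  congr 2
  simp
  ring

theorem wave_mul (a b ξ : ℝ) : wave a ξ * wave b ξ = wave (a + b) ξ := by
  unfold wave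
  rw [← Complex.exp_add]
  congr 1
  push_cast; ring

theorem continuous_wave_uncurry : Continuous fun p : ℝ × ℝ => wave p.1 p.2 := by
  unfold wave; fun_prop

theorem integral_mul_hat (w : RealL2) {θ : ℝ → ℂ} (h1 : ContDiff ℝ ∞ θ)
    (h2 : HasCompactSupport θ) : ∫ x, θ x * hat w x = ∫ x, 𝓕 θ x * w x := by
  refine (integral_fourier_mul (complexify w) (h2.toSchwartzMap h1)).trans ?_
  apply integral_congr_ae
  filter_upwards [coeFn_complexify w] with x hx
  rw [hx]
  rfl

/-- By duality with test functions: multiplying a test function by a character translates its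
Fourier transform. -/
theorem hat_shift (h : ℝ) (w : RealL2) :
    hat (shift h w) =ᵐ[volume] fun ξ => wave h ξ * hat w ξ := by
  apply ae_eq_of_test (Lp.locallyIntegrable_two _)
  · exact (Lp.locallyIntegrable_two (hat w)).continuous_smul (𝕜 := ℂ) (contDiff_wave h).continuous
  intro θ h1 h2
  have : ∫ x, θ x * (wave h x * hat w x) = ∫ x, (wave h x * θ x) * hat w x := by
    congr 1; ext x; ring
  rw [this, integral_mul_hat _ h1 h2, integral_mul_hat _ ((contDiff_wave h).mul h1) h2.mul_left,
    ← integral_add_right_eq_self (fun x => 𝓕 (fun x => wave h x * θ x) x * (w x : ℂ)) h]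
  apply integral_congr_ae
  filter_upwards [coeFn_shift h w] with x hx
  rw [hx]
  congr 1
  rw [fourier_eq_integral_wave, fourier_eq_integral_wave]
  congr 1
  ext ξ
  rw [← mul_assoc, wave_mul]
  congr 2
  ring

theorem sobNorm_shift (s h : ℝ) (w : RealL2) : sobNorm s (shift h w) = sobNorm s w := by
  apply eLpNorm_congr_norm_ae
  filter_upwards [hat_shift h w] with ξ hξ
  rw [hξ, norm_mul, norm_mul, norm_mul, norm_wave, one_mul]

theorem hat_shift_sub (h : ℝ) (w : RealL2) :
    hat (shift h w - w) =ᵐ[volume] fun ξ => (wave h ξ - 1) * hat w ξ := by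
  rw [map_sub]
  filter_upwards [hat_shift h w, Lp.coeFn_sub (hat (shift h w)) (hat w)] with ξ h1 h2
  rw [h2, Pi.sub_apply, h1]
  ring

theorem sobNorm_shift_sub_sq (s h : ℝ) (w : RealL2) : sobNorm s (shift h w - w) ^ 2 =
    ∫⁻ ξ, ‖wave h ξ - 1‖ₑ ^ 2 * (ENNReal.ofReal ((1 + ξ ^ 2) ^ s) * ‖hat w ξ‖ₑ ^ 2) := by
  rw [sobNorm_sq]
  apply lintegral_congr_ae
  filter_upwards [hat_shift_sub h w] with ξ hξ
  rw [hξ, enorm_mul]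
  ring

theorem measurable_weight (s : ℝ) :
    Measurable fun ξ : ℝ => ENNReal.ofReal ((1 + ξ ^ 2) ^ s) := by
  have : Continuous fun ξ : ℝ => (1 + ξ ^ 2) ^ s :=
    (by fun_prop : Continuous fun ξ : ℝ => 1 + ξ ^ 2).rpow_const fun x => Or.inl (by positivity)
  exact this.measurable.ennreal_ofReal

theorem measurable_hat (w : RealL2) : Measurable (hat w) := (Lp.stronglyMeasurable _).measurable

theorem ENNReal.tendsto_pow_zero_iff {α : Type*} {l : Filter α} {f : α → ENNReal} :
    Tendsto (fun a => f a ^ 2) l (𝓝 0) ↔ Tendsto f l (𝓝 0) := by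
  constructor
  · intro h
    have := (ENNReal.continuous_rpow_const (y := (1 / 2 : ℝ))).continuousAt.tendsto.comp h
    rw [ENNReal.zero_rpow_of_pos (by norm_num)] at this
    refine this.congr fun a => ?_
    rw [Function.comp_apply, ← ENNReal.rpow_natCast, ← ENNReal.rpow_mul]
    norm_num
  · intro h
    simpa using ENNReal.Tendsto.pow (n := 2) h

/-- Dominated convergence on the Fourier side: the multiplier `wave h ξ - 1` tends to zero pointwise
and is bounded by 2. This gives strong continuity of translations, hence the Bochner integrals over
translates used for `μ ∗ u`. -/
theorem tendsto_sobNorm_shift_sub {s : ℝ} {w : RealL2} (hw : sobNorm s w < ⊤) :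
    Tendsto (fun h => sobNorm s (shift h w - w)) (𝓝 0) (𝓝 0) := by
  have main : Tendsto (fun h => sobNorm s (shift h w - w) ^ 2) (𝓝 0) (𝓝 0) := by
    simp_rw [sobNorm_shift_sub_sq]
    have := measurable_weight s
    have := measurable_hat w
    suffices H : Tendsto (fun h => ∫⁻ ξ : ℝ, ‖wave h ξ - 1‖ₑ ^ 2 *
        (ENNReal.ofReal ((1 + ξ ^ 2) ^ s) * ‖hat w ξ‖ₑ ^ 2)) (𝓝 0) (𝓝 (∫⁻ _ : ℝ, 0)) by
      simpa using H
    refine tendsto_lintegral_filter_of_dominated_convergence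
      (fun ξ => 4 * (ENNReal.ofReal ((1 + ξ ^ 2) ^ s) * ‖hat w ξ‖ₑ ^ 2)) ?_ ?_ ?_ ?_
    · refine Eventually.of_forall fun h => ?_
      have := (contDiff_wave h).continuous.measurable
      fun_prop
    · refine Eventually.of_forall fun h => Eventually.of_forall fun ξ => ?_
      gcongr
      have : ‖wave h ξ - 1‖ₑ ≤ 2 := by
        refine enorm_sub_le.trans ?_
        rw [← ofReal_norm, norm_wave]
        simp
        norm_num
      calc _ ≤ (2 : ENNReal) ^ 2 := by gcongr
        _ = 4 := by norm_num
    · rw [lintegral_const_mul _ (by fun_prop), ← sobNorm_sq]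
      exact ENNReal.mul_ne_top (by norm_num) (ENNReal.pow_ne_top hw.ne)
    · refine Eventually.of_forall fun ξ => ?_
      have hc : Continuous fun h => wave h ξ :=
        continuous_wave_uncurry.comp (by fun_prop : Continuous fun h : ℝ => (h, ξ))
      have h1 : Tendsto (fun h => ‖wave h ξ - 1‖ₑ ^ 2) (𝓝 0) (𝓝 0) := by
        have : Continuous fun h => ‖wave h ξ - 1‖ₑ ^ 2 := by fun_prop
        simpa [wave] using this.tendsto 0
      simpa using ENNReal.Tendsto.mul_const h1 (b := ENNReal.ofReal ((1 + ξ ^ 2) ^ s) *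
        ‖hat w ξ‖ₑ ^ 2) (Or.inr (by finiteness))
  exact (ENNReal.tendsto_pow_zero_iff).1 main

/-- Translation on `H^s`. -/
def SobolevH.shiftH {s : ℝ} (h : ℝ) (u : SobolevH s) : SobolevH s :=
  SobolevH.mk (shift h (toL2 u)) (by rw [sobNorm_shift]; exact u.sobNorm_lt_top)

namespace SobolevH
variable {s : ℝ}

theorem toL2_shiftH (h : ℝ) (u : SobolevH s) : toL2 (shiftH h u) = shift h (toL2 u) := rfl

theorem norm_shiftH (h : ℝ) (u : SobolevH s) : ‖shiftH h u‖ = ‖u‖ := by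
  rw [← enorm_eq_iff_norm_eq, enorm_eq_sobNorm, enorm_eq_sobNorm, toL2_shiftH, sobNorm_shift]

end SobolevH

theorem shift_add (a b : ℝ) (w : RealL2) : shift (a + b) w = shift a (shift b w) := by
  apply Lp.ext
  have := (measurePreserving_add_right (volume : Measure ℝ) a).quasiMeasurePreserving.ae_eq_comp
    (coeFn_shift b w)
  filter_upwards [coeFn_shift (a + b) w, coeFn_shift a (shift b w), this] with x h1 h2 h3
  simp only [Function.comp_apply] at h3
  rw [h1, h2, h3]
  congr 1; ring

theorem SobolevH.continuous_shiftH {s : ℝ} (u : SobolevH s) : Continuous fun h => shiftH h u := by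
  rw [continuous_iff_continuousAt]
  intro a
  have h1 : ∀ h, ‖shiftH h u - shiftH a u‖ₑ = sobNorm s (shift (h - a) (toL2 u) - toL2 u) := by
    intro h
    rw [enorm_eq_sobNorm, map_sub, toL2_shiftH, toL2_shiftH]
    have : shift h (toL2 u) = shift a (shift (h - a) (toL2 u)) := by
      rw [← shift_add]; congr 2; ring
    rw [this, ← map_sub, sobNorm_shift]
  have h2 : Tendsto (fun h => h - a) (𝓝 a) (𝓝 0) := by
    have : Continuous fun h : ℝ => h - a := by fun_prop
    simpa using this.tendsto a
  have h3 := (tendsto_sobNorm_shift_sub u.sobNorm_lt_top).comp h2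
  refine tendsto_iff_norm_sub_tendsto_zero.2 ?_
  have h4 := (ENNReal.tendsto_toReal (by simp)).comp h3
  refine h4.congr fun h => ?_
  rw [Function.comp_apply, Function.comp_apply, ← h1, toReal_enorm]

/-! ### Sobolev embedding and interpolation -/

theorem memLp_japanese_neg {s : ℝ} (hs : 1 / 2 < s) :
    MemLp (fun ξ => (japanese (-s) ξ : ℂ)) 2 volume := by
  have hm : AEStronglyMeasurable (fun ξ => (japanese (-s) ξ : ℂ)) volume :=
    (Complex.continuous_ofReal.comp (continuous_japanese (-s))).aestronglyMeasurable
  rw [memLp_two_iff_integrable_sq_norm hm]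
  have := integrable_rpow_neg_one_add_norm_sq (E := ℝ) (μ := volume) (r := 2 * s)
    (by simp; linarith)
  refine this.congr (Eventually.of_forall fun ξ => ?_)
  simp only [japanese, Complex.norm_real, Real.norm_eq_abs, sq_abs]
  rw [← Real.rpow_mul_natCast (by positivity)]
  congr 1
  push_cast; ring

/-- The constant of the embedding of `H^s` in the bounded functions. -/
def embedConst (s : ℝ) : ENNReal := eLpNorm (fun ξ => (japanese (-s) ξ : ℂ)) 2 volume

theorem embedConst_lt_top {s : ℝ} (hs : 1 / 2 < s) : embedConst s < ⊤ :=
  (memLp_japanese_neg hs).2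

/-- Cauchy–Schwarz for the factorization of `hat w` into `(1 + ξ²)^(-s/2)` and `(1 + ξ²)^(s/2) hat
w`. -/
theorem eLpNorm_one_hat_le {s : ℝ} (w : RealL2) :
    eLpNorm (hat w) 1 volume ≤ embedConst s * sobNorm s w := by
  have h : (hat w : ℝ → ℂ) = (fun ξ => (japanese (-s) ξ : ℂ)) •
      fun ξ => (japanese s ξ : ℂ) * hat w ξ := by
    ext ξ
    simp only [Pi.smul_apply', smul_eq_mul]
    rw [← mul_assoc, ← Complex.ofReal_mul]
    have : japanese (-s) ξ * japanese s ξ = 1 := by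
      unfold japanese
      rw [← Real.rpow_add (by positivity)]
      simp [neg_div]
    rw [this]; simp
  nth_rw 1 [h]
  refine eLpNorm_smul_le_mul_eLpNorm (aestronglyMeasurable_weight_hat s w) ?_
  exact (Complex.continuous_ofReal.comp (continuous_japanese (-s))).aestronglyMeasurable

theorem integrable_hat {s : ℝ} (hs : 1 / 2 < s) {w : RealL2} (hw : sobNorm s w < ⊤) :
    Integrable (hat w) := by
  rw [← memLp_one_iff_integrable]
  exact ⟨Lp.aestronglyMeasurable _,
    (eLpNorm_one_hat_le w).trans_lt (ENNReal.mul_lt_top (embedConst_lt_top hs) hw)⟩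

theorem integrable_wave_mul {F : ℝ → ℂ} (hF : Integrable F) (x : ℝ) :
    Integrable fun ξ => wave x ξ * F ξ := by
  refine hF.bdd_mul (contDiff_wave x).continuous.aestronglyMeasurable
    (Eventually.of_forall fun ξ => (norm_wave x ξ).le)

theorem continuous_integral_wave {F : ℝ → ℂ} (hF : Integrable F) :
    Continuous fun x => ∫ ξ, wave x ξ * F ξ := by
  refine continuous_of_dominated (bound := fun ξ => ‖F ξ‖) ?_ ?_ hF.norm ?_
  · exact fun x => (integrable_wave_mul hF x).aestronglyMeasurable
  · refine fun x => Eventually.of_forall fun ξ => ?_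
    rw [norm_mul, norm_wave, one_mul]
  · refine Eventually.of_forall fun ξ => ?_
    exact (continuous_wave_uncurry.comp (by fun_prop : Continuous fun x : ℝ => (x, ξ))).mul
      continuous_const

theorem integrable_wave_prod {F G : ℝ → ℂ} (hF : Integrable F) (hG : Integrable G) :
    Integrable (fun p : ℝ × ℝ => wave p.1 p.2 * (F p.1 * G p.2)) (volume.prod volume) := by
  refine (hF.mul_prod hG).bdd_mul continuous_wave_uncurry.aestronglyMeasurable
    (Eventually.of_forall fun p => (norm_wave p.1 p.2).le)

theorem wave_comm (a b : ℝ) : wave a b = wave b a := by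
  unfold wave; congr 1; ring

/-- Fourier inversion for a square-integrable function with integrable Fourier transform. -/
theorem ae_eq_integral_wave_hat {w : RealL2} (hw : Integrable (hat w)) :
    (fun x => (w x : ℂ)) =ᵐ[volume] fun x => ∫ ξ, wave x ξ * hat w ξ := by
  apply ae_eq_of_test
  · have := Lp.locallyIntegrable_two (complexify w)
    exact fun x => (this x).congr (coeFn_complexify w)
  · exact (continuous_integral_wave hw).locallyIntegrable
  intro φ h1 h2
  let Φ := h2.toSchwartzMap h1
  -- The test function is written as the Fourier transform of `𝓕⁻ Φ`, so that duality moves the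
  -- transform onto `w`.
  have e := integral_fourier_mul (complexify w) (𝓕⁻ Φ)
  have e2 : 𝓕 ((𝓕⁻ Φ : 𝓢(ℝ, ℂ)) : ℝ → ℂ) = φ := by
    rw [← SchwartzMap.fourier_coe]
    simp [fourier_fourierInv_eq]
    rfl
  rw [e2] at e
  have hφ : Integrable φ := Φ.integrable
  have e3 : ∀ ξ, (𝓕⁻ Φ : 𝓢(ℝ, ℂ)) ξ = ∫ x, wave ξ x * φ x := by
    intro ξ
    rw [SchwartzMap.fourierInv_coe, Real.fourierInv_eq_fourier_neg, fourier_eq_integral_wave,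
      neg_neg]
    rfl
  calc ∫ x, φ x * (w x : ℂ) = ∫ x, φ x * complexify w x := by
        apply integral_congr_ae
        filter_upwards [coeFn_complexify w] with x hx
        rw [hx]
    _ = ∫ ξ, (∫ x, wave ξ x * φ x) * hat w ξ := by
        rw [← e]
        apply integral_congr_ae
        filter_upwards with ξ
        rw [e3]
        rfl
    _ = ∫ ξ, ∫ x, wave x ξ * (φ x * hat w ξ) := by
        congr 1; ext ξ
        rw [← integral_mul_const]
        congr 1; ext x
        rw [wave_comm]; ring
    _ = ∫ x, ∫ ξ, wave x ξ * (φ x * hat w ξ) :=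
        (integral_integral_swap (integrable_wave_prod hφ hw)).symm
    _ = _ := by
        congr 1; ext x
        rw [← integral_const_mul]
        congr 1; ext ξ
        ring

theorem ae_enorm_le_embedConst {s : ℝ} (hs : 1 / 2 < s) (w : RealL2) :
    ∀ᵐ x, ‖w x‖ₑ ≤ embedConst s * sobNorm s w := by
  by_cases hw : sobNorm s w < ⊤
  · filter_upwards [ae_eq_integral_wave_hat (integrable_hat hs hw)] with x hx
    have : ‖w x‖ₑ = ‖(w x : ℂ)‖ₑ := by rw [← ofReal_norm, ← ofReal_norm, Complex.norm_real]
    rw [this, hx]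
    refine (enorm_integral_le_lintegral_enorm _).trans (le_trans (le_of_eq ?_)
      (eLpNorm_one_hat_le w))
    rw [eLpNorm_one_eq_lintegral_enorm]
    congr 1; ext ξ
    rw [enorm_mul, ← ofReal_norm (wave x ξ), norm_wave]
    simp
  -- For an infinite `H^s` norm the bound is trivial only if the constant is nonzero, as `0 * ⊤ = 0`
  -- in `ENNReal`.
  · have : embedConst s ≠ 0 := by
      intro h
      rw [embedConst, eLpNorm_eq_zero_iff (memLp_japanese_neg hs).1 (by norm_num)] at h
      have : ∀ᵐ ξ : ℝ, False := by
        filter_upwards [h] with ξ hξ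
        exact (japanese_pos (-s) ξ).ne' (by simpa using hξ)
      simpa using this.exists
    rw [not_lt_top_iff.1 hw, ENNReal.mul_top this]
    simp

/-- Where `(1 + ξ²)^((s-r)/2) ≥ 1/η`, the first term alone dominates. Elsewhere the frequency is
bounded, and raising the opposite inequality to the power `r/(s-r)` gives the constant. -/
theorem exists_japanese_le {r s : ℝ} (hr : 0 ≤ r) (hrs : r < s) {η : ℝ} (hη : 0 < η) :
    ∃ C : ℝ, 0 ≤ C ∧ ∀ ξ, japanese r ξ ≤ η * japanese s ξ + C := by
  refine ⟨(1 / η) ^ (r / (s - r)), by positivity, fun ξ => ?_⟩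
  have hy : 0 < 1 + ξ ^ 2 := by positivity
  have hsr : 0 < s - r := by linarith
  rcases le_total (1 / η) (japanese (s - r) ξ) with h | h
  · have : japanese s ξ = japanese (s - r) ξ * japanese r ξ := by
      unfold japanese
      rw [← Real.rpow_add hy]; congr 1; ring
    have h2 : 1 ≤ η * japanese (s - r) ξ := by
      rw [div_le_iff₀ hη] at h; linarith
    have h3 : 0 ≤ (1 / η) ^ (r / (s - r)) := by positivity
    rw [this]
    nlinarith [japanese_pos r ξ]
  · have h1 : japanese r ξ = japanese (s - r) ξ ^ (r / (s - r)) := by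
      unfold japanese
      rw [← Real.rpow_mul hy.le]; congr 1; field_simp
    have h2 : japanese (s - r) ξ ^ (r / (s - r)) ≤ (1 / η) ^ (r / (s - r)) :=
      Real.rpow_le_rpow (japanese_pos _ _).le h (by positivity)
    have := mul_pos hη (japanese_pos s ξ)
    linarith

theorem exists_sobNorm_le {r s : ℝ} (hr : 0 ≤ r) (hrs : r < s) {η : ℝ≥0} (hη : 0 < η) :
    ∃ C : ℝ≥0, ∀ w, sobNorm r w ≤ η * sobNorm s w + C * ‖w‖ₑ := by
  obtain ⟨C, hC, h⟩ := exists_japanese_le hr hrs (η := η) hη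
  lift C to ℝ≥0 using hC
  have hC : (0 : ℝ) ≤ C := C.2
  refine ⟨C, fun w => ?_⟩
  have h1 : (η : ENNReal) * sobNorm s w =
      eLpNorm ((η : ℝ) • fun ξ => (japanese s ξ : ℂ) * hat w ξ) 2 volume := by
    rw [eLpNorm_const_smul, sobNorm]
    simp
  have h2 : (C : ENNReal) * ‖w‖ₑ = eLpNorm ((C : ℝ) • (hat w : ℝ → ℂ)) 2 volume := by
    rw [eLpNorm_const_smul, ← ofReal_norm w, ← norm_hat, ofReal_norm, Lp.enorm_def]
    congr 1
    simp
  rw [h1, h2]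
  have m1 := (aestronglyMeasurable_weight_hat s w).norm.const_smul (η : ℝ)
  have m2 := (Lp.aestronglyMeasurable (hat w)).norm.const_smul (C : ℝ)
  rw [← eLpNorm_norm ((η : ℝ) • fun ξ => (japanese s ξ : ℂ) * hat w ξ),
    ← eLpNorm_norm ((C : ℝ) • (hat w : ℝ → ℂ))]
  refine le_trans (eLpNorm_mono_real fun ξ => ?_) (eLpNorm_add_le ?_ ?_ (by norm_num))
  · simp only [norm_mul, Complex.norm_real, Real.norm_eq_abs, abs_of_pos (japanese_pos _ _),
      Pi.add_apply, Pi.smul_apply, norm_smul, NNReal.abs_eq, abs_of_nonneg hC]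
    rw [← mul_assoc, ← add_mul]
    gcongr
    exact h ξ
  · exact ((aestronglyMeasurable_weight_hat s w).const_smul (η : ℝ)).norm
  · exact ((Lp.aestronglyMeasurable (hat w)).const_smul (C : ℝ)).norm

/-- The embedding is applied at an order `r` strictly between `1/2` and `s`, which leaves room to
interpolate between `L²` and `H^s`. The arbitrarily small factor `η` is what later keeps the
Lipschitz constant of the superposition operator independent of the error. -/
theorem exists_ae_enorm_le {s : ℝ} (hs : 1 / 2 < s) {η : ℝ≥0} (hη : 0 < η) :
    ∃ C : ℝ≥0, ∀ w : RealL2, ∀ᵐ x, ‖w x‖ₑ ≤ η * sobNorm s w + C * ‖w‖ₑ := by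
  obtain ⟨r, hr, hrs⟩ := exists_between hs
  lift embedConst r to ℝ≥0 using (embedConst_lt_top hr).ne with K hK
  obtain ⟨C, hC⟩ := exists_sobNorm_le (r := r) (s := s) (by linarith) hrs
    (η := η / (K + 1)) (by positivity)
  refine ⟨K * C, fun w => ?_⟩
  filter_upwards [ae_enorm_le_embedConst hr w] with x hx
  refine hx.trans ?_
  rw [← hK]
  calc (K : ENNReal) * sobNorm r w ≤ K * ((η / (K + 1) : ℝ≥0) * sobNorm s w + C * ‖w‖ₑ) := by
        gcongr; exact hC w
    _ = ((K * (η / (K + 1)) : ℝ≥0) : ENNReal) * sobNorm s w + (K * C : ℝ≥0) * ‖w‖ₑ := by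
        push_cast; ring
    _ ≤ _ := by
        gcongr
        rw [mul_div_assoc', div_le_iff₀ (by positivity)]
        nlinarith [η.2, K.2]

/-! ### Products as convolutions of Fourier transforms -/

theorem ENNReal.sq_lintegral_mul_le {α : Type*} [MeasurableSpace α] {μ : Measure α}
    {F G : α → ENNReal} (hF : AEMeasurable F μ) (hG : AEMeasurable G μ) :
    (∫⁻ x, F x * G x ∂μ) ^ 2 ≤ (∫⁻ x, F x ^ 2 ∂μ) * ∫⁻ x, G x ^ 2 ∂μ := by
  have h := ENNReal.lintegral_mul_le_Lp_mul_Lq μ Real.HolderConjugate.two_two hF hG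
  simp only [ENNReal.rpow_ofNat, Pi.mul_apply] at h
  calc _ ≤ ((∫⁻ x, F x ^ 2 ∂μ) ^ (1 / 2 : ℝ) * (∫⁻ x, G x ^ 2 ∂μ) ^ (1 / 2 : ℝ)) ^ 2 := by gcongr
    _ = _ := by
      rw [mul_pow, ← ENNReal.rpow_natCast, ← ENNReal.rpow_natCast, ← ENNReal.rpow_mul,
        ← ENNReal.rpow_mul]
      norm_num

theorem lintegral_enorm_sq_lt_top (F : ComplexL2) : ∫⁻ x, ‖F x‖ₑ ^ 2 < ⊤ := by
  have := (Lp.memLp F).eLpNorm_lt_top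
  rw [eLpNorm_lt_top_iff_lintegral_rpow_enorm_lt_top (by norm_num) (by norm_num)] at this
  simpa using this

/-- For fixed `η`, `|Θ H| ≤ |Θ|² + |H|²` bounds the inner integral uniformly by translation
invariance; `G` is then integrated. This justifies the interchange of integrals behind the
convolution formula. -/
theorem integrable_mul_mul_comp_sub {Θ G : ℝ → ℂ} (hΘ : Measurable Θ)
    (hΘ2 : ∫⁻ x, ‖Θ x‖ₑ ^ 2 < ⊤) (hG : Integrable G) (H : ComplexL2) :
    Integrable (fun p : ℝ × ℝ => Θ p.1 * (G p.2 * H (p.1 - p.2))) (volume.prod volume) := by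
  have hH : Measurable H := (Lp.stronglyMeasurable H).measurable
  have hHs := hH.comp (by fun_prop : Measurable fun p : ℝ × ℝ => p.1 - p.2)
  have hm : AEStronglyMeasurable (fun p : ℝ × ℝ => Θ p.1 * (G p.2 * H (p.1 - p.2)))
      (volume.prod volume) :=
    (hΘ.comp measurable_fst).aestronglyMeasurable.mul
      (hG.aestronglyMeasurable.comp_snd.mul hHs.aestronglyMeasurable)
  refine ⟨hm, ?_⟩
  have hle : ∀ η, ∫⁻ ξ, ‖Θ ξ * (G η * H (ξ - η))‖ₑ ≤
      ‖G η‖ₑ * ((∫⁻ x, ‖Θ x‖ₑ ^ 2) + ∫⁻ x, ‖H x‖ₑ ^ 2) := by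
    intro η
    have h1 : ∀ ξ, ‖Θ ξ * (G η * H (ξ - η))‖ₑ ≤ ‖G η‖ₑ * (‖Θ ξ‖ₑ ^ 2 + ‖H (ξ - η)‖ₑ ^ 2) := by
      intro ξ
      rw [enorm_mul, enorm_mul, mul_left_comm]
      gcongr
      rcases le_total ‖Θ ξ‖ₑ ‖H (ξ - η)‖ₑ with h | h
      · exact le_trans (by rw [sq]; gcongr) le_add_self
      · exact le_trans (by rw [sq]; gcongr) le_self_add
    calc _ ≤ ∫⁻ ξ, ‖G η‖ₑ * (‖Θ ξ‖ₑ ^ 2 + ‖H (ξ - η)‖ₑ ^ 2) := lintegral_mono h1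
      _ = _ := by
        have := hH.comp (by fun_prop : Measurable fun ξ : ℝ => ξ - η)
        rw [lintegral_const_mul _ (by fun_prop), lintegral_add_left (by fun_prop),
          lintegral_sub_right_eq_self (fun x => ‖H x‖ₑ ^ 2) η]
  rw [HasFiniteIntegral, lintegral_prod_symm _ hm.enorm]
  refine (lintegral_mono hle).trans_lt ?_
  rw [lintegral_mul_const'' _ hG.aestronglyMeasurable.enorm]
  exact ENNReal.mul_lt_top hG.2 (ENNReal.add_lt_top.2 ⟨hΘ2, lintegral_enorm_sq_lt_top H⟩)

theorem fourier_comp_add (θ : ℝ → ℂ) (η x : ℝ) :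
    𝓕 (fun ξ => θ (ξ + η)) x = wave x η * 𝓕 θ x := by
  rw [fourier_eq_integral_wave, fourier_eq_integral_wave, ← integral_const_mul,
    ← integral_sub_right_eq_self _ η]
  congr 1; ext ξ
  rw [sub_add_cancel, ← mul_assoc]
  congr 1
  unfold wave
  rw [← Complex.exp_add]
  congr 1
  push_cast; ring

theorem locallyIntegrable_integral_mul_comp_sub {G : ℝ → ℂ} (hG : Integrable G) (H : ComplexL2) :
    LocallyIntegrable fun ξ => ∫ η, G η * H (ξ - η) := by
  rw [locallyIntegrable_iff]
  intro K hK
  have hKm := hK.measurableSet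
  have hfin : ∫⁻ x, ‖K.indicator (fun _ => (1 : ℂ)) x‖ₑ ^ 2 < ⊤ := by
    have : ∀ x, ‖K.indicator (fun _ => (1 : ℂ)) x‖ₑ ^ 2 = K.indicator (fun _ => 1) x := by
      intro x
      by_cases hx : x ∈ K <;> simp [hx]
    simp_rw [this]
    rw [lintegral_indicator hKm]
    simpa using hK.measure_lt_top
  have := (integrable_mul_mul_comp_sub (measurable_const.indicator hKm) hfin hG H).integral_prod_left
  rw [← integrable_indicator_iff hKm]
  refine this.congr (Eventually.of_forall fun ξ => ?_)
  simp only [integral_const_mul]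
  by_cases hξ : ξ ∈ K <;> simp [hξ]

theorem integrable_fourier_mul {θ : ℝ → ℂ} (h1 : ContDiff ℝ ∞ θ) (h2 : HasCompactSupport θ)
    (h : RealL2) : Integrable fun x => 𝓕 θ x * (h x : ℂ) := by
  have m1 : MemLp (𝓕 θ) 2 volume := (𝓕 (h2.toSchwartzMap h1)).memLp 2 volume
  have m2 : MemLp (fun x => (h x : ℂ)) 2 volume := (Lp.memLp h).ofReal
  exact m1.integrable_mul m2

theorem integral_wave_mul_eq {θ : ℝ → ℂ} (h1 : ContDiff ℝ ∞ θ) (h2 : HasCompactSupport θ)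
    (h : RealL2) (η : ℝ) :
    ∫ x, wave x η * (𝓕 θ x * h x) = ∫ ξ, θ ξ * hat h (ξ - η) := by
  have e := integral_mul_hat h (θ := fun ξ => θ (ξ + η)) (by fun_prop)
    (h2.comp_homeomorph (Homeomorph.addRight η))
  calc _ = ∫ x, 𝓕 (fun ξ => θ (ξ + η)) x * h x := by
        congr 1; ext x
        rw [fourier_comp_add]; ring
    _ = _ := by
        rw [← e, ← integral_sub_right_eq_self _ η]
        simp

theorem integral_mul_integral_wave {A G : ℝ → ℂ} (hA : Integrable A) (hG : Integrable G) :
    ∫ x, A x * ∫ η, wave x η * G η = ∫ η, G η * ∫ x, wave x η * A x := by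
  calc _ = ∫ x, ∫ η, wave x η * (A x * G η) := by
        congr 1; ext x
        rw [← integral_const_mul]
        congr 1; ext η; ring
    _ = ∫ η, ∫ x, wave x η * (A x * G η) := integral_integral_swap (integrable_wave_prod hA hG)
    _ = _ := by
        congr 1; ext η
        rw [← integral_const_mul]
        congr 1; ext x; ring

theorem integral_mul_integral_comp_sub {Θ G : ℝ → ℂ} (hΘ : Measurable Θ)
    (hΘ2 : ∫⁻ x, ‖Θ x‖ₑ ^ 2 < ⊤) (hG : Integrable G) (H : ComplexL2) :
    ∫ ξ, Θ ξ * ∫ η, G η * H (ξ - η) = ∫ η, G η * ∫ ξ, Θ ξ * H (ξ - η) := by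
  calc _ = ∫ ξ, ∫ η, Θ ξ * (G η * H (ξ - η)) := by
        congr 1; ext x
        rw [← integral_const_mul]
    _ = ∫ η, ∫ ξ, Θ ξ * (G η * H (ξ - η)) :=
        integral_integral_swap (integrable_mul_mul_comp_sub hΘ hΘ2 hG H)
    _ = _ := by
        congr 1; ext η
        rw [← integral_const_mul]
        congr 1; ext x; ring

theorem lintegral_enorm_sq_lt_top_of_hasCompactSupport {θ : ℝ → ℂ} (h1 : Continuous θ)
    (h2 : HasCompactSupport θ) : ∫⁻ x, ‖θ x‖ₑ ^ 2 < ⊤ := by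
  have := (h1.memLp_of_hasCompactSupport h2 (p := 2) (μ := volume)).eLpNorm_lt_top
  rw [eLpNorm_lt_top_iff_lintegral_rpow_enorm_lt_top (by norm_num) (by norm_num)] at this
  simpa using this

theorem integral_test_mul_hat_mul {g h p : RealL2} (hg : Integrable (hat g))
    (hp : p =ᵐ[volume] fun x => g x * h x) {θ : ℝ → ℂ} (h1 : ContDiff ℝ ∞ θ)
    (h2 : HasCompactSupport θ) :
    ∫ x, θ x * hat p x = ∫ x, (𝓕 θ x * h x) * ∫ η, wave x η * hat g η := by
  rw [integral_mul_hat _ h1 h2]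
  apply integral_congr_ae
  filter_upwards [hp, ae_eq_integral_wave_hat hg] with x hx hx'
  rw [hx, ← hx']
  push_cast
  ring

/-- The Fourier transform turns products into convolutions. -/
theorem hat_eq_convolution {g h p : RealL2} (hg : Integrable (hat g))
    (hp : p =ᵐ[volume] fun x => g x * h x) :
    hat p =ᵐ[volume] fun ξ => ∫ η, hat g η * hat h (ξ - η) := by
  refine ae_eq_of_test (Lp.locallyIntegrable_two _)
    (locallyIntegrable_integral_mul_comp_sub hg (hat h)) fun θ h1 h2 => ?_
  -- Fourier inversion turns the factor `g` into a superposition of waves, and a wave times `h` has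
  -- a translate of `hat h` as its Fourier transform. Fubini is used on both sides.
  rw [integral_test_mul_hat_mul hg hp h1 h2,
    integral_mul_integral_wave (integrable_fourier_mul h1 h2 h) hg,
    integral_mul_integral_comp_sub h1.continuous.measurable
      (lintegral_enorm_sq_lt_top_of_hasCompactSupport h1.continuous h2) hg (hat h)]
  simp_rw [integral_wave_mul_eq h1 h2 h]

/-- The squared Fourier weight `(1 + ξ²)^s`. -/
def weight (s ξ : ℝ) : ENNReal := ENNReal.ofReal ((1 + ξ ^ 2) ^ s)

theorem measurable_weight' (s : ℝ) : Measurable (weight s) := measurable_weight s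

theorem weight_mul (s t ξ : ℝ) : weight s ξ * weight t ξ = weight (s + t) ξ := by
  rw [weight, weight, weight, ← ENNReal.ofReal_mul (by positivity), Real.rpow_add (by positivity)]

theorem weight_zero (ξ : ℝ) : weight 0 ξ = 1 := by simp [weight]

theorem lintegral_weight_neg (s : ℝ) : ∫⁻ ξ, weight (-s) ξ = embedConst s ^ 2 := by
  rw [embedConst, eLpNorm_eq_lintegral_rpow_enorm_toReal (by norm_num) (by norm_num)]
  simp only [ENNReal.toReal_ofNat, ENNReal.rpow_ofNat, one_div]
  rw [← ENNReal.rpow_natCast, ← ENNReal.rpow_mul]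
  norm_num
  apply lintegral_congr
  intro ξ
  rw [← ofReal_norm, ← ENNReal.ofReal_pow (norm_nonneg _), Complex.norm_real, Real.norm_eq_abs,
    abs_of_pos (japanese_pos _ _), japanese, ← Real.rpow_mul_natCast (by positivity), weight]
  congr 2
  push_cast; ring

/-- `1 + ξ² ≤ 2X + 2Y` is at most four times the larger of `X = 1 + η²` and `Y = 1 + (ξ - η)²`, so
the weight of order `b` is absorbed by the larger one. If that is `X`, the leftover `X^(b-a)` is at
most `Y^(b-a)` because `b ≤ a`. The right side is integrable in `η` uniformly in `ξ`. -/
theorem weight_mul_le {a b : ℝ} (hb : 0 ≤ b) (hba : b ≤ a) (ξ η : ℝ) :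
    weight b ξ * (weight (-a) η * weight (-b) (ξ - η)) ≤
      ENNReal.ofReal (4 ^ b) * (weight (-a) η + weight (-a) (ξ - η)) := by
  unfold weight
  rw [← ENNReal.ofReal_mul (by positivity), ← ENNReal.ofReal_mul (by positivity),
    ← ENNReal.ofReal_add (by positivity) (by positivity), ← ENNReal.ofReal_mul (by positivity)]
  apply ENNReal.ofReal_le_ofReal
  set X := 1 + η ^ 2 with hX
  set Y := 1 + (ξ - η) ^ 2 with hY
  have hX0 : 0 < X := by positivity
  have hY0 : 0 < Y := by positivity
  have hle : 1 + ξ ^ 2 ≤ 2 * X + 2 * Y := by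
    rw [hX, hY]; nlinarith [sq_nonneg (ξ - 2 * η)]
  have aux : ∀ Z W : ℝ, 0 < Z → 0 < W → Z ≤ W → 1 + ξ ^ 2 ≤ 4 * W →
      (1 + ξ ^ 2) ^ b * W ^ (-b) ≤ 4 ^ b := by
    intro Z W _ hW _ h
    calc _ ≤ (4 * W) ^ b * W ^ (-b) := by gcongr
      _ = 4 ^ b := by
        rw [Real.mul_rpow (by norm_num) hW.le, mul_assoc, ← Real.rpow_add hW]; simp
  rcases le_total X Y with h | h
  · have := aux X Y hX0 hY0 h (by linarith)
    have hp : 0 < X ^ (-a) := by positivity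
    have hq : 0 < Y ^ (-a) := by positivity
    have h4 : (0 : ℝ) < 4 ^ b := by positivity
    nlinarith [mul_pos h4 hq]
  · have := aux Y X hY0 hX0 h (by linarith)
    have hp : 0 < X ^ (-a) := by positivity
    have hq : 0 < Y ^ (-a) := by positivity
    have h4 : (0 : ℝ) < 4 ^ b := by positivity
    have e1 : X ^ (-a) = X ^ (-b) * X ^ (b - a) := by
      rw [← Real.rpow_add hX0]; congr 1; ring
    have e2 : Y ^ (-a) = Y ^ (-b) * Y ^ (b - a) := by
      rw [← Real.rpow_add hY0]; congr 1; ring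
    have e3 : X ^ (b - a) ≤ Y ^ (b - a) :=
      Real.rpow_le_rpow_of_nonpos hY0 h (by linarith)
    calc (1 + ξ ^ 2) ^ b * (X ^ (-a) * Y ^ (-b))
        = ((1 + ξ ^ 2) ^ b * X ^ (-b)) * (Y ^ (-b) * X ^ (b - a)) := by rw [e1]; ring
      _ ≤ 4 ^ b * (Y ^ (-b) * Y ^ (b - a)) := by gcongr
      _ = 4 ^ b * Y ^ (-a) := by rw [e2]
      _ ≤ _ := by nlinarith [mul_pos h4 hp]

theorem sobNorm_sq' (s : ℝ) (w : RealL2) :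
    sobNorm s w ^ 2 = ∫⁻ ξ, weight s ξ * ‖hat w ξ‖ₑ ^ 2 := sobNorm_sq s w

/-- Multiplication `H^a × H^b → H^b` for `a > 1/2` and `0 ≤ b ≤ a`. -/
theorem exists_sobNorm_mul_le {a b : ℝ} (ha : 1 / 2 < a) (hb : 0 ≤ b) (hba : b ≤ a) :
    ∃ C : ℝ≥0, ∀ g h p : RealL2, sobNorm a g < ⊤ → (p =ᵐ[volume] fun x => g x * h x) →
      sobNorm b p ≤ C * (sobNorm a g * sobNorm b h) := by
  -- `D` bounds `weight b ξ * ∫ weight (-a) η * weight (-b) (ξ - η)` uniformly in `ξ`; the operator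
  -- constant is its square root, since the estimate is proved for squared norms.
  set D : ENNReal := ENNReal.ofReal (4 ^ b) * (embedConst a ^ 2 + embedConst a ^ 2) with hD
  have hDt : D ^ (1 / 2 : ℝ) ≠ ⊤ := by
    have := embedConst_lt_top ha
    refine (ENNReal.rpow_lt_top_of_nonneg (by norm_num) ?_).ne
    rw [hD]; finiteness
  lift D ^ (1 / 2 : ℝ) to ℝ≥0 using hDt with C hC
  have hC2 : (C : ENNReal) ^ 2 = D := by
    rw [hC, ← ENNReal.rpow_natCast, ← ENNReal.rpow_mul]; norm_num
  refine ⟨C, fun g h p hg hp => ?_⟩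
  have mg := measurable_hat g
  have mh := measurable_hat h
  have mw := measurable_weight'
  rw [← ENNReal.pow_le_pow_left_iff two_ne_zero, mul_pow, mul_pow, hC2, sobNorm_sq', sobNorm_sq',
    sobNorm_sq']
  have key : ∀ᵐ ξ, weight b ξ * ‖hat p ξ‖ₑ ^ 2 ≤ D * ∫⁻ η, (weight a η * ‖hat g η‖ₑ ^ 2) *
      (weight b (ξ - η) * ‖hat h (ξ - η)‖ₑ ^ 2) := by
    filter_upwards [hat_eq_convolution (integrable_hat ha hg) hp] with ξ hξ
    have ms : Measurable fun η : ℝ => ξ - η := by fun_prop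
    have m1 := mh.comp ms
    have m2 := fun s => (mw s).comp ms
    simp only [Function.comp_def] at m1 m2
    -- The weights are inserted and removed so that Cauchy–Schwarz separates the kernel, whose
    -- integral is controlled by `D`, from the two weighted transforms.
    have h1 : ‖hat p ξ‖ₑ ≤ ∫⁻ η, (weight (-a / 2) η * weight (-b / 2) (ξ - η)) *
        ((weight (a / 2) η * ‖hat g η‖ₑ) * (weight (b / 2) (ξ - η) * ‖hat h (ξ - η)‖ₑ)) := by
      rw [hξ]
      refine (enorm_integral_le_lintegral_enorm _).trans (lintegral_mono fun η => le_of_eq ?_)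
      rw [enorm_mul]
      have e1 := weight_mul (-a / 2) (a / 2) η
      have e2 := weight_mul (-b / 2) (b / 2) (ξ - η)
      rw [show -a / 2 + a / 2 = 0 by ring, weight_zero] at e1
      rw [show -b / 2 + b / 2 = 0 by ring, weight_zero] at e2
      calc ‖hat g η‖ₑ * ‖hat h (ξ - η)‖ₑ
          = (weight (-a / 2) η * weight (a / 2) η) * (weight (-b / 2) (ξ - η) *
            weight (b / 2) (ξ - η)) * (‖hat g η‖ₑ * ‖hat h (ξ - η)‖ₑ) := by rw [e1, e2]; ring
        _ = _ := by ring
    have h2 : ‖hat p ξ‖ₑ ^ 2 ≤ (∫⁻ η, weight (-a) η * weight (-b) (ξ - η)) *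
        ∫⁻ η, (weight a η * ‖hat g η‖ₑ ^ 2) * (weight b (ξ - η) * ‖hat h (ξ - η)‖ₑ ^ 2) := by
      refine (by gcongr : _ ≤ _ ^ 2).trans ((ENNReal.sq_lintegral_mul_le ?_ ?_).trans
        (le_of_eq ?_))
      · fun_prop
      · fun_prop
      · have hsq : ∀ s x, weight (s / 2) x ^ 2 = weight s x := by
          intro s x
          rw [sq, weight_mul]; congr 1; ring
        simp only [mul_pow, hsq]
    have h3 : weight b ξ * ∫⁻ η, weight (-a) η * weight (-b) (ξ - η) ≤ D := by
      rw [← lintegral_const_mul _ (by fun_prop)]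
      refine (lintegral_mono fun η => weight_mul_le hb hba ξ η).trans (le_of_eq ?_)
      rw [lintegral_const_mul _ (by fun_prop), lintegral_add_left (by fun_prop),
        lintegral_sub_left_eq_self (weight (-a)) ξ, lintegral_weight_neg]
    refine (mul_le_mul_right h2 _).trans ?_
    rw [← mul_assoc]
    gcongr
  refine (lintegral_mono_ae key).trans (le_of_eq ?_)
  have ms : Measurable fun p : ℝ × ℝ => p.1 - p.2 := by fun_prop
  have m1 := mh.comp ms
  have m2 := fun s => (mw s).comp ms
  simp only [Function.comp_def] at m1 m2
  have mm : Measurable fun p : ℝ × ℝ => (weight a p.2 * ‖hat g p.2‖ₑ ^ 2) *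
      (weight b (p.1 - p.2) * ‖hat h (p.1 - p.2)‖ₑ ^ 2) := by
    have := (mw a).comp (by fun_prop : Measurable fun p : ℝ × ℝ => p.2)
    have := mg.comp (by fun_prop : Measurable fun p : ℝ × ℝ => p.2)
    have := m2 b
    fun_prop
  rw [lintegral_const_mul _ mm.lintegral_prod_right', lintegral_lintegral_swap mm.aemeasurable]
  congr 1
  rw [← lintegral_mul_const _ (by fun_prop)]
  congr 1; ext η
  have := mh.comp (by fun_prop : Measurable fun ξ : ℝ => ξ - η)
  have := (mw b).comp (by fun_prop : Measurable fun ξ : ℝ => ξ - η)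
  simp only [Function.comp_def] at *
  rw [lintegral_const_mul _ (by fun_prop),
    lintegral_sub_right_eq_self (fun x => weight b x * ‖hat h x‖ₑ ^ 2) η]

/-! ### The Gagliardo seminorm for orders between 0 and 1 -/

/-- The squared Gagliardo seminorm of order `σ`. -/
def gagliardo (σ : ℝ) (w : RealL2) : ENNReal :=
  ∫⁻ h in Ioi (0 : ℝ), ENNReal.ofReal (h ^ (-1 - 2 * σ)) * ‖shift h w - w‖ₑ ^ 2

/-- The Fourier symbol of the squared Gagliardo seminorm. -/
def gagliardoSymbol (σ ξ : ℝ) : ENNReal :=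
  ∫⁻ h in Ioi (0 : ℝ), ENNReal.ofReal (h ^ (-1 - 2 * σ)) * ‖wave h ξ - 1‖ₑ ^ 2

theorem lintegral_gagliardo_swap (σ : ℝ) {G : ℝ → ENNReal} (hG : Measurable G) :
    ∫⁻ h in Ioi (0 : ℝ), ENNReal.ofReal (h ^ (-1 - 2 * σ)) *
      ∫⁻ ξ, ‖wave h ξ - 1‖ₑ ^ 2 * G ξ = ∫⁻ ξ, gagliardoSymbol σ ξ * G ξ := by
  have mv : Measurable fun p : ℝ × ℝ => wave p.1 p.2 := continuous_wave_uncurry.measurable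
  have mv1 : ∀ ξ, Measurable fun h : ℝ => wave h ξ := fun ξ => by
    simp_rw [wave_comm _ ξ]; exact (contDiff_wave _).continuous.measurable
  have mv2 : ∀ h, Measurable fun ξ : ℝ => wave h ξ := fun h =>
    (contDiff_wave h).continuous.measurable
  have e1 : ∀ h : ℝ, ENNReal.ofReal (h ^ (-1 - 2 * σ)) * ∫⁻ ξ, ‖wave h ξ - 1‖ₑ ^ 2 * G ξ =
      ∫⁻ ξ, ENNReal.ofReal (h ^ (-1 - 2 * σ)) * (‖wave h ξ - 1‖ₑ ^ 2 * G ξ) := by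
    intro h
    have := mv2 h
    rw [lintegral_const_mul _ (by fun_prop)]
  have e2 : ∀ ξ, ∫⁻ h in Ioi (0 : ℝ), ENNReal.ofReal (h ^ (-1 - 2 * σ)) *
      (‖wave h ξ - 1‖ₑ ^ 2 * G ξ) = gagliardoSymbol σ ξ * G ξ := by
    intro ξ
    have := mv1 ξ
    rw [gagliardoSymbol, ← lintegral_mul_const _ (by fun_prop)]
    congr 1; ext h
    ring
  simp_rw [e1, ← e2]
  refine lintegral_lintegral_swap ?_
  refine Measurable.aemeasurable ?_
  unfold Function.uncurry
  fun_prop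

/-- Plancherel for each increment `h`, then Tonelli. Comparing seminorm and `H^σ` norm thus reduces
to two bounds on the symbol. -/
theorem gagliardo_eq (σ : ℝ) (w : RealL2) :
    gagliardo σ w = ∫⁻ ξ, gagliardoSymbol σ ξ * ‖hat w ξ‖ₑ ^ 2 := by
  have mw := measurable_hat w
  rw [← lintegral_gagliardo_swap σ (by fun_prop), gagliardo]
  congr 1; ext h
  rw [← sobNorm_zero_order, sobNorm_shift_sub_sq]
  simp

theorem norm_wave_sub_one_le (h ξ : ℝ) : ‖wave h ξ - 1‖ ≤ 2 * Real.pi * |h * ξ| := by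
  have e : wave h ξ = Complex.exp (Complex.I * ((2 * Real.pi * h * ξ : ℝ) : ℂ)) := by
    unfold wave; congr 1; push_cast; ring
  rw [e]
  refine (Real.norm_exp_I_mul_ofReal_sub_one_le).trans (le_of_eq ?_)
  rw [Real.norm_eq_abs, mul_assoc, abs_mul, abs_of_pos (by positivity : 0 < 2 * Real.pi)]

theorem norm_wave_sub_one_sq (h ξ : ℝ) :
    ‖wave h ξ - 1‖ ^ 2 = 2 - 2 * Real.cos (2 * Real.pi * h * ξ) := by
  have e : wave h ξ = Complex.exp (((2 * Real.pi * h * ξ : ℝ) : ℂ) * Complex.I) := by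
    unfold wave; congr 1; push_cast; ring
  rw [e, ← Complex.normSq_eq_norm_sq, Complex.normSq_apply]
  simp only [Complex.sub_re, Complex.sub_im, Complex.exp_ofReal_mul_I_re,
    Complex.exp_ofReal_mul_I_im, Complex.one_re, Complex.one_im]
  nlinarith [Real.sin_sq_add_cos_sq (2 * Real.pi * h * ξ)]

theorem enorm_sq_eq_ofReal (z : ℂ) : ‖z‖ₑ ^ 2 = ENNReal.ofReal (‖z‖ ^ 2) := by
  rw [← ofReal_norm, ENNReal.ofReal_pow (norm_nonneg _)]

theorem lintegral_ofReal_rpow_Ioi {a c : ℝ} (ha : a < -1) (hc : 0 < c) :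
    ∫⁻ t in Ioi c, ENNReal.ofReal (t ^ a) = ENNReal.ofReal (-c ^ (a + 1) / (a + 1)) := by
  rw [← integral_Ioi_rpow_of_lt ha hc,
    ofReal_integral_eq_lintegral_ofReal (integrableOn_Ioi_rpow_of_lt ha hc)]
  filter_upwards [ae_restrict_mem measurableSet_Ioi] with t ht
  have : 0 < t := hc.trans ht
  positivity

theorem lintegral_ofReal_rpow_Ioc {a c : ℝ} (ha : -1 < a) (hc : 0 < c) :
    ∫⁻ t in Ioc 0 c, ENNReal.ofReal (t ^ a) = ENNReal.ofReal (c ^ (a + 1) / (a + 1)) := by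
  have h := integral_rpow (a := 0) (b := c) (Or.inl ha)
  rw [Real.zero_rpow (by linarith), sub_zero, intervalIntegral.integral_of_le hc.le] at h
  rw [← h, ofReal_integral_eq_lintegral_ofReal]
  · exact (intervalIntegral.intervalIntegrable_rpow' ha).1
  · filter_upwards [ae_restrict_mem measurableSet_Ioc] with t ht
    have : 0 < t := ht.1
    positivity

/-- The integral is split at `h = 1/R` with `R = (1 + ξ²)^(1/2)`. Below, `|wave h ξ - 1| ≤ 2π h |ξ|`
and `σ < 1` gives convergence at zero; above, `|wave h ξ - 1|² ≤ 4` and `σ > 0` gives convergence at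
infinity. Both pieces scale as `R^(2σ)`. -/
theorem exists_gagliardoSymbol_le {σ : ℝ} (h0 : 0 < σ) (h1 : σ < 1) :
    ∃ C : ℝ≥0, ∀ ξ, gagliardoSymbol σ ξ ≤ C * weight σ ξ := by
  set K : ℝ := 4 * Real.pi ^ 2 / (2 - 2 * σ) + 4 / (2 * σ) with hK
  have hK1 : 0 ≤ 4 * Real.pi ^ 2 / (2 - 2 * σ) := div_nonneg (by positivity) (by linarith)
  have hK2 : 0 ≤ 4 / (2 * σ) := by positivity
  refine ⟨⟨K, by positivity⟩, fun ξ => ?_⟩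
  set y : ℝ := 1 + ξ ^ 2 with hy
  have hy0 : 0 < y := by positivity
  set R : ℝ := y ^ (1 / 2 : ℝ) with hR
  have hR0 : 0 < R := by positivity
  have hR2 : R ^ 2 = y := by
    rw [hR, ← Real.rpow_mul_natCast hy0.le]; norm_num
  have hRs : R ^ (2 * σ) = y ^ σ := by
    rw [hR, ← Real.rpow_mul hy0.le]; congr 1; ring
  have hc : 0 < R⁻¹ := by positivity
  have hsplit : Ioi (0 : ℝ) = Ioc 0 R⁻¹ ∪ Ioi R⁻¹ := (Ioc_union_Ioi_eq_Ioi hc.le).symm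
  have p1 : ∫⁻ h in Ioc 0 R⁻¹, ENNReal.ofReal (h ^ (-1 - 2 * σ)) * ‖wave h ξ - 1‖ₑ ^ 2 ≤
      ENNReal.ofReal (4 * Real.pi ^ 2 / (2 - 2 * σ) * y ^ σ) := by
    calc _ ≤ ∫⁻ h in Ioc 0 R⁻¹, ENNReal.ofReal (4 * Real.pi ^ 2 * y) *
          ENNReal.ofReal (h ^ (1 - 2 * σ)) := by
          refine setLIntegral_mono' measurableSet_Ioc fun h hh => ?_
          have hh0 : 0 < h := hh.1
          rw [enorm_sq_eq_ofReal, ← ENNReal.ofReal_mul (by positivity),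
            ← ENNReal.ofReal_mul (by positivity)]
          apply ENNReal.ofReal_le_ofReal
          have e : h ^ (1 - 2 * σ) = h ^ (-1 - 2 * σ) * h ^ 2 := by
            rw [← Real.rpow_natCast, ← Real.rpow_add hh0]; congr 1; push_cast; ring
          have b : ‖wave h ξ - 1‖ ^ 2 ≤ (2 * Real.pi * |h * ξ|) ^ 2 := by
            gcongr; exact norm_wave_sub_one_le h ξ
          have b2 : (2 * Real.pi * |h * ξ|) ^ 2 ≤ 4 * Real.pi ^ 2 * y * h ^ 2 := by
            rw [mul_pow, sq_abs, hy]
            nlinarith [mul_nonneg (sq_nonneg Real.pi) (sq_nonneg h)]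
          rw [e]
          have : 0 < h ^ (-1 - 2 * σ) := by positivity
          nlinarith
      _ = _ := by
          rw [lintegral_const_mul _ (by fun_prop), lintegral_ofReal_rpow_Ioc (by linarith) hc,
            ← ENNReal.ofReal_mul (by positivity)]
          congr 1
          have : R⁻¹ ^ (1 - 2 * σ + 1) = y ^ σ * y⁻¹ := by
            rw [← hRs, ← hR2, Real.inv_rpow hR0.le, ← Real.rpow_neg hR0.le, ← Real.rpow_natCast,
              ← Real.rpow_neg hR0.le, ← Real.rpow_add hR0]
            congr 1; push_cast; ring
          rw [this]
          have : 1 - 2 * σ + 1 = 2 - 2 * σ := by ring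
          rw [this]
          field_simp
  have p2 : ∫⁻ h in Ioi R⁻¹, ENNReal.ofReal (h ^ (-1 - 2 * σ)) * ‖wave h ξ - 1‖ₑ ^ 2 ≤
      ENNReal.ofReal (4 / (2 * σ) * y ^ σ) := by
    calc _ ≤ ∫⁻ h in Ioi R⁻¹, ENNReal.ofReal 4 * ENNReal.ofReal (h ^ (-1 - 2 * σ)) := by
          refine setLIntegral_mono' measurableSet_Ioi fun h hh => ?_
          rw [enorm_sq_eq_ofReal, mul_comm]
          gcongr
          rw [norm_wave_sub_one_sq]
          linarith [Real.neg_one_le_cos (2 * Real.pi * h * ξ)]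
      _ = _ := by
          rw [lintegral_const_mul _ (by fun_prop), lintegral_ofReal_rpow_Ioi (by linarith) hc,
            ← ENNReal.ofReal_mul (by positivity)]
          congr 1
          have : R⁻¹ ^ (-1 - 2 * σ + 1) = y ^ σ := by
            rw [← hRs, Real.inv_rpow hR0.le, ← Real.rpow_neg hR0.le]
            congr 1; ring
          rw [this]
          have : -1 - 2 * σ + 1 = -(2 * σ) := by ring
          rw [this, neg_div_neg_eq]
          field_simp
  rw [gagliardoSymbol, hsplit]
  refine (lintegral_union_le _ _ _).trans ((add_le_add p1 p2).trans (le_of_eq ?_))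
  rw [← ENNReal.ofReal_add (by positivity) (by positivity), ← add_mul, ← hK, weight,
    ENNReal.ofReal_mul (by positivity)]
  congr 1
  exact ENNReal.ofReal_eq_coe_nnreal _

/-- For `|ξ| ≥ 1` it suffices to integrate over `1/(4|ξ|) < h ≤ 1/(2|ξ|)`. There the phase `2π h
|ξ|` lies between `π/2` and `π`, so the cosine is nonpositive and `|wave h ξ - 1|² ≥ 2`. For `|ξ| ≤
1` the weight is at most 2. -/
theorem weight_le_gagliardoSymbol {σ : ℝ} (h0 : 0 < σ) (h1 : σ < 1) (ξ : ℝ) :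
    weight σ ξ ≤ 2 + gagliardoSymbol σ ξ := by
  rcases le_total |ξ| 1 with h | h
  · refine le_trans ?_ le_self_add
    have : weight σ ξ ≤ ENNReal.ofReal 2 := by
      apply ENNReal.ofReal_le_ofReal
      have hx : ξ ^ 2 ≤ 1 := by rw [← sq_abs]; nlinarith [abs_nonneg ξ]
      calc (1 + ξ ^ 2) ^ σ ≤ 2 ^ σ := by gcongr; linarith
        _ ≤ 2 ^ (1 : ℝ) := by gcongr; norm_num
        _ = 2 := by norm_num
    simpa using this
  · refine le_trans ?_ le_add_self
    set x := |ξ| with hx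
    have hx0 : 0 < x := by linarith
    have hsub : Ioc (1 / (4 * x)) (1 / (2 * x)) ⊆ Ioi 0 := fun t ht =>
      (by positivity : 0 < 1 / (4 * x)).trans ht.1
    calc weight σ ξ ≤ ENNReal.ofReal ((2 * x) ^ (1 + 2 * σ) * 2) * ENNReal.ofReal (1 / (4 * x)) := by
          rw [← ENNReal.ofReal_mul (by positivity)]
          apply ENNReal.ofReal_le_ofReal
          have e1 : (2 * x) ^ (1 + 2 * σ) * 2 * (1 / (4 * x)) = (2 * x) ^ (2 * σ) := by
            rw [Real.rpow_add (by positivity), Real.rpow_one]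
            field_simp
            norm_num
          rw [e1, Real.rpow_mul (by positivity)]
          gcongr
          rw [Real.rpow_ofNat, mul_pow, hx, sq_abs]
          have : 1 ≤ ξ ^ 2 := by rw [← sq_abs]; nlinarith
          linarith
      _ = ∫⁻ h in Ioc (1 / (4 * x)) (1 / (2 * x)), ENNReal.ofReal ((2 * x) ^ (1 + 2 * σ) * 2) := by
          rw [setLIntegral_const, Real.volume_Ioc]
          congr 2
          field_simp
          norm_num
      _ ≤ ∫⁻ h in Ioc (1 / (4 * x)) (1 / (2 * x)),
          ENNReal.ofReal (h ^ (-1 - 2 * σ)) * ‖wave h ξ - 1‖ₑ ^ 2 := by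
          refine setLIntegral_mono' measurableSet_Ioc fun t ht => ?_
          have ht0 : 0 < t := hsub ht
          rw [enorm_sq_eq_ofReal, ← ENNReal.ofReal_mul (by positivity), norm_wave_sub_one_sq]
          apply ENNReal.ofReal_le_ofReal
          have hcos : Real.cos (2 * Real.pi * t * ξ) ≤ 0 := by
            have e : Real.cos (2 * Real.pi * t * ξ) = Real.cos (2 * Real.pi * t * x) := by
              rw [← Real.cos_abs, abs_mul, abs_of_pos (by positivity : 0 < 2 * Real.pi * t)]
            have ht1 := ht.1
            have ht2 := ht.2
            rw [div_lt_iff₀ (by positivity)] at ht1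
            rw [le_div_iff₀ (by positivity)] at ht2
            rw [e]
            apply Real.cos_nonpos_of_pi_div_two_le_of_le <;> nlinarith [Real.pi_pos]
          have hp : (2 * x) ^ (1 + 2 * σ) ≤ t ^ (-1 - 2 * σ) := by
            have : t ^ (-1 - 2 * σ) = (t⁻¹) ^ (1 + 2 * σ) := by
              rw [Real.inv_rpow ht0.le, ← Real.rpow_neg ht0.le]; congr 1; ring
            rw [this]
            gcongr
            have ht2 := ht.2
            rw [le_div_iff₀ (by positivity)] at ht2
            rw [le_inv_comm₀ (by positivity) ht0, ← one_div, le_div_iff₀ (by positivity)]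
            exact ht2
          have : 0 < (2 * x) ^ (1 + 2 * σ) := by positivity
          nlinarith
      _ ≤ gagliardoSymbol σ ξ := lintegral_mono_set hsub

theorem exists_gagliardo_le {σ : ℝ} (h0 : 0 < σ) (h1 : σ < 1) :
    ∃ C : ℝ≥0, ∀ w, gagliardo σ w ≤ C * sobNorm σ w ^ 2 := by
  obtain ⟨C, hC⟩ := exists_gagliardoSymbol_le h0 h1
  refine ⟨C, fun w => ?_⟩
  have := measurable_hat w
  have := measurable_weight' σ
  rw [gagliardo_eq, sobNorm_sq', ← lintegral_const_mul _ (by fun_prop)]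
  refine lintegral_mono fun ξ => ?_
  rw [← mul_assoc]
  gcongr
  exact hC ξ

theorem sobNorm_sq_le_gagliardo {σ : ℝ} (h0 : 0 < σ) (h1 : σ < 1) (w : RealL2) :
    sobNorm σ w ^ 2 ≤ 2 * ‖w‖ₑ ^ 2 + gagliardo σ w := by
  have := measurable_hat w
  rw [gagliardo_eq, sobNorm_sq', enorm_sq_eq_lintegral_hat, ← lintegral_const_mul _ (by fun_prop),
    ← lintegral_add_left (by fun_prop)]
  refine lintegral_mono fun ξ => ?_
  rw [← add_mul]
  gcongr
  exact weight_le_gagliardoSymbol h0 h1 ξ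

/-! ### Pointwise estimates for `C¹` functions -/

theorem exists_abs_le_of_continuous {k : ℝ → ℝ} (hk : Continuous k) (M : ℝ) :
    ∃ B : ℝ, 0 ≤ B ∧ ∀ x, |x| ≤ M → |k x| ≤ B := by
  obtain ⟨B, hB⟩ := (isCompact_Icc (a := -M) (b := M)).exists_bound_of_continuousOn
    hk.continuousOn
  exact ⟨max B 0, le_max_right _ _, fun x hx => (hB x (abs_le.1 hx)).trans (le_max_left _ _)⟩

/-- Uniform continuity on a compact interval in affine form: beyond the distance `δ` the crude bound
`2B` is at most `(2B/δ) |x - y|`. Applied to `f'`, it stands in for a Lipschitz condition. -/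
theorem exists_abs_sub_le_of_continuous {k : ℝ → ℝ} (hk : Continuous k) (M : ℝ) {ε : ℝ}
    (hε : 0 < ε) : ∃ C : ℝ, 0 ≤ C ∧ ∀ x y, |x| ≤ M → |y| ≤ M → |k x - k y| ≤ ε + C * |x - y| := by
  obtain ⟨B, hB0, hB⟩ := exists_abs_le_of_continuous hk M
  have huc := (isCompact_Icc (a := -M) (b := M)).uniformContinuousOn_of_continuous hk.continuousOn
  rw [Metric.uniformContinuousOn_iff] at huc
  obtain ⟨δ, hδ, h⟩ := huc ε hε
  refine ⟨2 * B / δ, by positivity, fun x y hx hy => ?_⟩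
  rcases lt_or_ge |x - y| δ with h1 | h1
  · have := h x (abs_le.1 hx) y (abs_le.1 hy) h1
    rw [Real.dist_eq] at this
    have : 0 ≤ 2 * B / δ * |x - y| := by positivity
    linarith
  · have h2 : |k x - k y| ≤ 2 * B := by
      calc _ ≤ |k x| + |k y| := abs_sub _ _
        _ ≤ _ := by linarith [hB x hx, hB y hy]
    have h3 : 2 * B ≤ 2 * B / δ * |x - y| := by
      rw [div_mul_eq_mul_div, le_div_iff₀ hδ]
      gcongr
    linarith

theorem abs_le_of_mem_segment {M p q : ℝ} (hp : |p| ≤ M) (hq : |q| ≤ M) {t : ℝ}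
    (ht : t ∈ Icc (0 : ℝ) 1) : |q + t * (p - q)| ≤ M := by
  have : q + t * (p - q) = (1 - t) * q + t * p := by ring
  rw [this]
  calc _ ≤ |(1 - t) * q| + |t * p| := abs_add_le _ _
    _ = (1 - t) * |q| + t * |p| := by
      rw [abs_mul, abs_mul, abs_of_nonneg ht.1, abs_of_nonneg (by linarith [ht.2])]
    _ ≤ (1 - t) * M + t * M := by
      have := ht.1
      have : 0 ≤ 1 - t := by linarith [ht.2]
      gcongr
    _ = M := by ring

theorem exists_abs_sub_le_mul {f : ℝ → ℝ} (hf : ContDiff ℝ 1 f) (M : ℝ) :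
    ∃ L : ℝ, 0 ≤ L ∧ ∀ p q, |p| ≤ M → |q| ≤ M → |f p - f q| ≤ L * |p - q| := by
  obtain ⟨L, hL, h⟩ := exists_abs_le_of_continuous (hf.continuous_deriv_one) M
  refine ⟨L, hL, fun p q hp hq => ?_⟩
  exact (convex_Icc (-M) M).norm_image_sub_le_of_norm_deriv_le
    (fun x _ => hf.differentiable_one.differentiableAt) (fun x hx => h x (abs_le.2 hx))
    (abs_le.1 hq) (abs_le.1 hp)

/-- The mean value inequality is applied to the difference of `f` along the segments from `q` to `p`
and from `q'` to `p'`. Its derivative splits into `f'` times a difference of increments and a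
difference of values of `f'` times an increment. `L` bounds `f'` and is fixed before `ε`; only the
second part costs `ε + C m`. -/
theorem exists_second_difference_le {f : ℝ → ℝ} (hf : ContDiff ℝ 1 f) (M : ℝ) :
    ∃ L : ℝ, 0 ≤ L ∧ ∀ ε > 0, ∃ C : ℝ, 0 ≤ C ∧ ∀ m p q p' q', |p| ≤ M → |q| ≤ M → |p'| ≤ M →
      |q'| ≤ M → |p - p'| ≤ m → |q - q'| ≤ m →
      |(f p - f q) - (f p' - f q')| ≤ L * |(p - q) - (p' - q')| + (ε + C * m) * |p' - q'| := by
  obtain ⟨L, hL, h⟩ := exists_abs_le_of_continuous (hf.continuous_deriv_one) M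
  refine ⟨L, hL, fun ε hε => ?_⟩
  obtain ⟨C, hC, h'⟩ := exists_abs_sub_le_of_continuous (hf.continuous_deriv_one) M hε
  refine ⟨C, hC, fun m p q p' q' hp hq hp' hq' hpm hqm => ?_⟩
  have hd : ∀ a b t : ℝ, HasDerivAt (fun t => f (b + t * (a - b)))
      (deriv f (b + t * (a - b)) * (a - b)) t := by
    intro a b t
    have h1 : HasDerivAt (fun t : ℝ => b + t * (a - b)) (a - b) t := by
      simpa using ((hasDerivAt_id t).mul_const (a - b)).const_add b
    exact (hf.differentiable_one.differentiableAt.hasDerivAt).comp t h1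
  have key := norm_image_sub_le_of_norm_deriv_le_segment_01'
    (f := fun t => f (q + t * (p - q)) - f (q' + t * (p' - q')))
    (f' := fun t => deriv f (q + t * (p - q)) * (p - q) - deriv f (q' + t * (p' - q')) * (p' - q'))
    (C := L * |(p - q) - (p' - q')| + (ε + C * m) * |p' - q'|)
    (fun t _ => ((hd p q t).sub (hd p' q' t)).hasDerivWithinAt) ?_
  · rw [sub_sub_sub_comm]
    simpa using key
  · intro t ht
    have ht' : t ∈ Icc (0 : ℝ) 1 := Ico_subset_Icc_self ht
    have hA := abs_le_of_mem_segment hp hq ht'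
    have hA' := abs_le_of_mem_segment hp' hq' ht'
    have hAA : |(q + t * (p - q)) - (q' + t * (p' - q'))| ≤ m := by
      have := abs_le_of_mem_segment hpm hqm ht'
      convert this using 2; ring
    have e : deriv f (q + t * (p - q)) * (p - q) - deriv f (q' + t * (p' - q')) * (p' - q') =
        deriv f (q + t * (p - q)) * ((p - q) - (p' - q')) +
        (deriv f (q + t * (p - q)) - deriv f (q' + t * (p' - q'))) * (p' - q') := by ring
    rw [e, Real.norm_eq_abs]
    refine (abs_add_le _ _).trans ?_
    rw [abs_mul, abs_mul]
    gcongr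
    · exact h _ hA
    · refine (h' _ _ hA hA').trans ?_
      gcongr

theorem exists_first_order_le {f : ℝ → ℝ} (hf : ContDiff ℝ 1 f) (M : ℝ) {ε : ℝ} (hε : 0 < ε) :
    ∃ δ > 0, ∀ p q, |p| ≤ M → |q| ≤ M → |p - q| ≤ δ →
      |f p - f q - deriv f q * (p - q)| ≤ ε * |p - q| := by
  obtain ⟨C, hC, h⟩ := exists_abs_sub_le_of_continuous (hf.continuous_deriv_one) M (half_pos hε)
  refine ⟨ε / 2 / (C + 1), by positivity, fun p q hp hq hpq => ?_⟩
  have hmem : ∀ x ∈ uIcc q p, |x| ≤ M ∧ |x - q| ≤ |p - q| := by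
    intro x hx
    refine ⟨?_, ?_⟩
    · have := uIcc_subset_Icc (abs_le.1 hq) (abs_le.1 hp) hx
      exact abs_le.2 this
    · exact abs_sub_left_of_mem_uIcc hx
  have key := (convex_uIcc q p).norm_image_sub_le_of_norm_hasDerivWithin_le
    (f := fun x => f x - deriv f q * x) (f' := fun x => deriv f x - deriv f q * 1) (C := ε)
    (fun x _ => ((hf.differentiable_one.differentiableAt.hasDerivAt (x := x)).sub
      ((hasDerivAt_id x).const_mul (deriv f q))).hasDerivWithinAt) ?_ left_mem_uIcc right_mem_uIcc
  · rw [Real.norm_eq_abs, Real.norm_eq_abs] at key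
    convert key using 2; ring
  · intro x hx
    obtain ⟨h1, h2⟩ := hmem x hx
    rw [mul_one, Real.norm_eq_abs]
    refine (h x q h1 hq).trans ?_
    have : C * |x - q| ≤ ε / 2 := by
      have h3 : |x - q| ≤ ε / 2 / (C + 1) := h2.trans hpq
      rw [le_div_iff₀ (by positivity)] at h3
      nlinarith [abs_nonneg (x - q)]
    linarith

/-! ### Superposition in `L²` -/

theorem Lp.norm_le_of_ae_le {r u v : RealL2} {a b : ℝ} (ha : 0 ≤ a) (hb : 0 ≤ b)
    (h : ∀ᵐ x, |r x| ≤ a * |u x| + b * |v x|) : ‖r‖ ≤ a * ‖u‖ + b * ‖v‖ := by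
  have h1 : ‖r‖ ≤ ‖a • |u| + b • |v|‖ := by
    apply Lp.norm_le_norm_of_ae_le
    filter_upwards [h, Lp.coeFn_add (a • |u|) (b • |v|), Lp.coeFn_smul a |u|, Lp.coeFn_smul b |v|,
      Lp.coeFn_abs u, Lp.coeFn_abs v] with x h h1 h2 h3 h4 h5
    rw [h1, Pi.add_apply, h2, h3, Pi.smul_apply, Pi.smul_apply, h4, h5]
    exact h.trans (le_abs_self _)
  refine h1.trans ((norm_add_le _ _).trans (le_of_eq ?_))
  rw [norm_smul, norm_smul, Real.norm_of_nonneg ha, Real.norm_of_nonneg hb, norm_abs_eq_norm,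
    norm_abs_eq_norm]

/-- The superposition of a function with a square-integrable function. -/
def nem (f : ℝ → ℝ) (w : RealL2) : RealL2 :=
  -- The default value is not reached when `f` is `C¹` with `f 0 = 0` and `w` is essentially
  -- bounded; see `memLp_comp`.
  open Classical in if h : MemLp (fun x => f (w x)) 2 volume then h.toLp else 0

theorem memLp_comp {f : ℝ → ℝ} (hf : ContDiff ℝ 1 f) (hf0 : f 0 = 0) {w : RealL2} {M : ℝ}
    (hw : ∀ᵐ x, |w x| ≤ M) : MemLp (fun x => f (w x)) 2 volume := by
  obtain ⟨L, hL, h⟩ := exists_abs_sub_le_mul hf M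
  refine (Lp.memLp w).of_le_mul (c := L) (hf.continuous.comp_aestronglyMeasurable
    (Lp.aestronglyMeasurable w)) ?_
  filter_upwards [hw] with x hx
  have := h (w x) 0 hx (by simpa using (abs_nonneg _).trans hx)
  simpa [hf0] using this

theorem coeFn_nem {f : ℝ → ℝ} (hf : ContDiff ℝ 1 f) (hf0 : f 0 = 0) {w : RealL2} {M : ℝ}
    (hw : ∀ᵐ x, |w x| ≤ M) : nem f w =ᵐ[volume] fun x => f (w x) := by
  rw [nem, dif_pos (memLp_comp hf hf0 hw)]
  exact MemLp.coeFn_toLp _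

theorem nem_zero {f : ℝ → ℝ} (hf : ContDiff ℝ 1 f) (hf0 : f 0 = 0) : nem f 0 = 0 := by
  apply Lp.ext
  have h0 : ∀ᵐ x, |(0 : RealL2) x| ≤ 0 := by
    filter_upwards [Lp.coeFn_zero ℝ 2 (volume : Measure ℝ)] with x hx
    simp
  filter_upwards [coeFn_nem hf hf0 h0, Lp.coeFn_zero ℝ 2 (volume : Measure ℝ)] with x h1 h2
  rw [h1, h2]
  simp [hf0]

theorem exists_norm_nem_sub_le {f : ℝ → ℝ} (hf : ContDiff ℝ 1 f) (hf0 : f 0 = 0) (M : ℝ) :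
    ∃ L : ℝ, 0 ≤ L ∧ ∀ u v : RealL2, (∀ᵐ x, |u x| ≤ M) → (∀ᵐ x, |v x| ≤ M) →
      ‖nem f u - nem f v‖ ≤ L * ‖u - v‖ := by
  obtain ⟨L, hL, h⟩ := exists_abs_sub_le_mul hf M
  refine ⟨L, hL, fun u v hu hv => ?_⟩
  have := Lp.norm_le_of_ae_le (r := nem f u - nem f v) (u := u - v) (v := 0) hL le_rfl ?_
  · simpa using this
  · filter_upwards [hu, hv, coeFn_nem hf hf0 hu, coeFn_nem hf hf0 hv, Lp.coeFn_sub u v,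
      Lp.coeFn_sub (nem f u) (nem f v)] with x h1 h2 h3 h4 h5 h6
    rw [h6, h5, Pi.sub_apply, Pi.sub_apply, h3, h4]
    simpa using h _ _ h1 h2

/-! ### Derivatives in the mean and the chain rule -/

/-- The difference quotient of `w` with increment `h`. -/
def diffQuot (w : RealL2) (h : ℝ) : RealL2 := h⁻¹ • (shift h w - w)

/-- `g` is the derivative of `w` in the mean. -/
def HasL2Deriv (w g : RealL2) : Prop := Tendsto (diffQuot w) (𝓝[≠] 0) (𝓝 g)

theorem hat_diffQuot (w : RealL2) (h : ℝ) :
    hat (diffQuot w h) =ᵐ[volume] fun ξ => ((h : ℂ)⁻¹ * (wave h ξ - 1)) * hat w ξ := by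
  rw [diffQuot, map_smul]
  filter_upwards [Lp.coeFn_smul h⁻¹ (hat (shift h w - w)), hat_shift_sub h w] with ξ h1 h2
  rw [h1, Pi.smul_apply, h2, Complex.real_smul]
  push_cast; ring

theorem tendsto_wave_quot (ξ : ℝ) :
    Tendsto (fun h : ℝ => (h : ℂ)⁻¹ * (wave h ξ - 1)) (𝓝[≠] 0)
      (𝓝 (2 * Real.pi * ξ * Complex.I)) := by
  have h1 : HasDerivAt (fun h : ℝ => wave h ξ) (2 * Real.pi * ξ * Complex.I) 0 := by
    have : HasDerivAt (fun h : ℝ => 2 * (Real.pi : ℂ) * h * ξ * Complex.I)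
        (2 * Real.pi * ξ * Complex.I) 0 := by
      have := (((Complex.ofRealCLM.hasDerivAt (x := 0)).const_mul (2 * (Real.pi : ℂ))).mul_const
        (ξ : ℂ)).mul_const Complex.I
      simpa using this
    simpa [wave] using this.cexp
  have h2 := h1.tendsto_slope
  refine h2.congr fun h => ?_
  simp [slope, wave]

/-- Convergence of the transformed difference quotients in `L²` gives convergence almost everywhere
along a sequence of increments, where the multiplier tends to `2πiξ`. -/
theorem HasL2Deriv.hat_eq {w g : RealL2} (h : HasL2Deriv w g) :
    hat g =ᵐ[volume] fun ξ => (2 * Real.pi * ξ * Complex.I) * hat w ξ := by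
  obtain ⟨t, ht⟩ := exists_seq_tendsto (𝓝[≠] (0 : ℝ))
  have h1 : Tendsto (fun n => hat (diffQuot w (t n))) atTop (𝓝 (hat g)) :=
    (hat.continuous.tendsto g).comp (h.comp ht)
  obtain ⟨ns, hns, h2⟩ := (tendstoInMeasure_of_tendsto_Lp h1).exists_seq_tendsto_ae
  have h3 : ∀ᵐ ξ, ∀ n, hat (diffQuot w (t n)) ξ =
      ((t n : ℂ)⁻¹ * (wave (t n) ξ - 1)) * hat w ξ :=
    ae_all_iff.2 fun n => hat_diffQuot w (t n)
  filter_upwards [h2, h3] with ξ h2 h3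
  refine tendsto_nhds_unique h2 ?_
  simp_rw [h3]
  exact (((tendsto_wave_quot ξ).comp ht).comp hns.tendsto_atTop).mul_const _

theorem norm_wave_quot_le (h ξ : ℝ) : ‖(h : ℂ)⁻¹ * (wave h ξ - 1)‖ ≤ 2 * Real.pi * |ξ| := by
  rcases eq_or_ne h 0 with rfl | hh
  · simp; positivity
  rw [norm_mul, norm_inv, Complex.norm_real, Real.norm_eq_abs, inv_mul_le_iff₀ (by positivity)]
  refine (norm_wave_sub_one_le h ξ).trans (le_of_eq ?_)
  rw [abs_mul]; ring

theorem lintegral_sq_mul_hat_lt_top {w : RealL2} (hw : sobNorm 1 w < ⊤) :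
    ∫⁻ ξ, ENNReal.ofReal (ξ ^ 2) * ‖hat w ξ‖ₑ ^ 2 < ⊤ := by
  refine lt_of_le_of_lt (lintegral_mono fun ξ => ?_) ((sobNorm_sq' 1 w).symm ▸
    ENNReal.pow_lt_top (n := 2) hw)
  unfold weight
  gcongr
  rw [Real.rpow_one]; linarith

theorem exists_hasL2Deriv {w : RealL2} (hw : sobNorm 1 w < ⊤) : ∃ g, HasL2Deriv w g := by
  have mw := measurable_hat w
  have hsq := lintegral_sq_mul_hat_lt_top hw
  have hm : MemLp (fun ξ : ℝ => (2 * Real.pi * ξ * Complex.I) * hat w ξ) 2 volume := by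
    refine ⟨(by fun_prop : Measurable _).aestronglyMeasurable, ?_⟩
    rw [eLpNorm_lt_top_iff_lintegral_rpow_enorm_lt_top (by norm_num) (by norm_num)]
    have e : ∀ ξ : ℝ, ‖(2 * Real.pi * ξ * Complex.I) * hat w ξ‖ₑ ^ (2 : ENNReal).toReal =
        ENNReal.ofReal ((2 * Real.pi) ^ 2) * (ENNReal.ofReal (ξ ^ 2) * ‖hat w ξ‖ₑ ^ 2) := by
      intro ξ
      rw [ENNReal.toReal_ofNat, ENNReal.rpow_ofNat, enorm_mul, mul_pow, ← mul_assoc,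
        ← ENNReal.ofReal_mul (by positivity), enorm_sq_eq_ofReal, ← mul_pow]
      congr 2
      simp [mul_pow]
    simp_rw [e]
    rw [lintegral_const_mul _ (by fun_prop)]
    exact ENNReal.mul_lt_top (by simp) hsq
  have key : Tendsto (fun h => hat (diffQuot w h)) (𝓝[≠] 0) (𝓝 hm.toLp) := by
    rw [tendsto_iff_edist_tendsto_0, ← ENNReal.tendsto_pow_zero_iff]
    have e : ∀ h : ℝ, edist (hat (diffQuot w h)) hm.toLp ^ 2 = ∫⁻ ξ,
        ‖(h : ℂ)⁻¹ * (wave h ξ - 1) - 2 * Real.pi * ξ * Complex.I‖ₑ ^ 2 * ‖hat w ξ‖ₑ ^ 2 := by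
      intro h
      rw [Lp.edist_def, eLpNorm_eq_lintegral_rpow_enorm_toReal (by norm_num) (by norm_num)]
      simp only [ENNReal.toReal_ofNat, ENNReal.rpow_ofNat, one_div]
      rw [← ENNReal.rpow_natCast, ← ENNReal.rpow_mul]
      norm_num
      apply lintegral_congr_ae
      filter_upwards [hat_diffQuot w h, hm.coeFn_toLp] with ξ h1 h2
      rw [h1, h2, ← mul_pow, ← enorm_mul, sub_mul]
    simp_rw [e]
    suffices H : Tendsto (fun h : ℝ => ∫⁻ ξ, ‖(h : ℂ)⁻¹ * (wave h ξ - 1) -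
        2 * Real.pi * ξ * Complex.I‖ₑ ^ 2 * ‖hat w ξ‖ₑ ^ 2) (𝓝[≠] 0) (𝓝 (∫⁻ _ : ℝ, 0)) by
      simpa using H
    refine tendsto_lintegral_filter_of_dominated_convergence
      (fun ξ => ENNReal.ofReal ((4 * Real.pi) ^ 2) * (ENNReal.ofReal (ξ ^ 2) * ‖hat w ξ‖ₑ ^ 2))
      ?_ ?_ ?_ ?_
    · refine Eventually.of_forall fun h => ?_
      have := (contDiff_wave h).continuous.measurable
      fun_prop
    · refine Eventually.of_forall fun h => Eventually.of_forall fun ξ => ?_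
      rw [← mul_assoc, ← ENNReal.ofReal_mul (by positivity), enorm_sq_eq_ofReal]
      gcongr
      have h1 : ‖(h : ℂ)⁻¹ * (wave h ξ - 1) - 2 * Real.pi * ξ * Complex.I‖ ≤ 4 * Real.pi * |ξ| := by
        refine (norm_sub_le _ _).trans ?_
        have h2 : ‖(2 * Real.pi * ξ * Complex.I : ℂ)‖ = 2 * Real.pi * |ξ| := by
          simp [abs_of_pos Real.pi_pos]
        rw [h2]
        linarith [norm_wave_quot_le h ξ]
      calc _ ≤ (4 * Real.pi * |ξ|) ^ 2 := by gcongr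
        _ = _ := by rw [mul_pow, sq_abs]
    · rw [lintegral_const_mul _ (by fun_prop)]
      exact (ENNReal.mul_lt_top (by simp) hsq).ne
    · refine Eventually.of_forall fun ξ => ?_
      have h1 : Tendsto (fun h : ℝ => ‖(h : ℂ)⁻¹ * (wave h ξ - 1) -
          2 * Real.pi * ξ * Complex.I‖ₑ ^ 2) (𝓝[≠] 0) (𝓝 0) := by
        have := ((tendsto_wave_quot ξ).sub_const (2 * Real.pi * ξ * Complex.I)).enorm
        rw [sub_self, enorm_zero] at this
        exact ENNReal.tendsto_pow_zero_iff.2 this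
      simpa using ENNReal.Tendsto.mul_const h1 (b := ‖hat w ξ‖ₑ ^ 2) (Or.inr (by finiteness))
  -- The limit has been found among complex functions on the Fourier side. Inverting and taking real
  -- parts is continuous and recovers each real difference quotient, so it carries the limit back to
  -- `RealL2`.
  refine ⟨Complex.reCLM.compLpL 2 volume (𝓕⁻ hm.toLp), ?_⟩
  have c : Continuous fun F : ComplexL2 => Complex.reCLM.compLpL 2 volume (𝓕⁻ F : ComplexL2) :=
    (Complex.reCLM.compLpL 2 volume).continuous.comp (Lp.fourierTransformₗᵢ ℝ ℂ).symm.continuous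
  refine ((c.tendsto _).comp key).congr fun h => ?_
  rw [Function.comp_apply, hat_apply, fourierInv_fourier_eq]
  apply Lp.ext
  filter_upwards [Complex.reCLM.coeFn_compLpL (p := 2) (complexify (diffQuot w h)),
    coeFn_complexify (diffQuot w h)] with x h1 h2
  rw [h1, h2]
  simp

theorem exists_sobNorm_le_deriv {s : ℝ} (hs : 0 ≤ s) : ∃ C : ℝ≥0, ∀ w g, HasL2Deriv w g →
    sobNorm s w ≤ C * ‖w‖ₑ + sobNorm (s - 1) g := by
  have hC : 0 ≤ (2 : ℝ) ^ s := by positivity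
  -- `C² = 2^s` bounds the weight where `ξ² ≤ 1`. Where `ξ² ≥ 1`, `1 + ξ² ≤ (2πξ)²`, and the
  -- derivative alone suffices.
  set C : ℝ≥0 := (Real.toNNReal (2 ^ s)) ^ (1 / 2 : ℝ) with hCdef
  have hC2 : (C : ENNReal) ^ 2 = ENNReal.ofReal (2 ^ s) := by
    rw [hCdef, ← ENNReal.coe_pow, ← NNReal.rpow_natCast, ← NNReal.rpow_mul]
    norm_num
    rfl
  refine ⟨C, fun w g h => ?_⟩
  have mw := measurable_hat w
  have mg := measurable_hat g
  have mwt := measurable_weight'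
  rw [← ENNReal.pow_le_pow_left_iff two_ne_zero]
  calc sobNorm s w ^ 2 ≤ C ^ 2 * ‖w‖ₑ ^ 2 + sobNorm (s - 1) g ^ 2 := by
        rw [hC2, sobNorm_sq', enorm_sq_eq_lintegral_hat, sobNorm_sq',
          ← lintegral_const_mul _ (by fun_prop), ← lintegral_add_left (by fun_prop)]
        apply lintegral_mono_ae
        filter_upwards [h.hat_eq] with ξ hξ
        rw [hξ, enorm_mul, mul_pow, ← mul_assoc, ← add_mul,
          enorm_sq_eq_ofReal (2 * Real.pi * ξ * Complex.I)]
        gcongr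
        unfold weight
        rw [← ENNReal.ofReal_mul (by positivity), ← ENNReal.ofReal_add (by positivity)
          (by positivity)]
        apply ENNReal.ofReal_le_ofReal
        have e : ‖(2 * Real.pi * ξ * Complex.I : ℂ)‖ ^ 2 = (2 * Real.pi) ^ 2 * ξ ^ 2 := by
          simp [mul_pow]
        rw [e]
        have hp : 0 < (1 + ξ ^ 2) ^ (s - 1) := by positivity
        have hsplit : (1 + ξ ^ 2) ^ s = (1 + ξ ^ 2) ^ (s - 1) * (1 + ξ ^ 2) := by
          rw [← Real.rpow_add_one (by positivity)]; congr 1; ring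
        rcases le_total (ξ ^ 2) 1 with h1 | h1
        · have : (1 + ξ ^ 2) ^ s ≤ 2 ^ s := by gcongr; linarith
          have : 0 ≤ (1 + ξ ^ 2) ^ (s - 1) * ((2 * Real.pi) ^ 2 * ξ ^ 2) := by positivity
          linarith
        · have : 1 + ξ ^ 2 ≤ (2 * Real.pi) ^ 2 * ξ ^ 2 := by
            have h2 : 2 ≤ (2 * Real.pi) ^ 2 := by nlinarith [Real.pi_gt_three]
            nlinarith
          rw [hsplit]
          nlinarith [mul_le_mul_of_nonneg_left this hp.le]
    _ ≤ (C * ‖w‖ₑ + sobNorm (s - 1) g) ^ 2 := by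
        rw [← mul_pow, add_sq]
        exact add_le_add_left le_self_add _

/-- The factor 7 is a numerical bound for `2π`: on the Fourier side `(2πξ)² ≤ 49 (1 + ξ²)`. -/
theorem HasL2Deriv.sobNorm_le {w g : RealL2} (h : HasL2Deriv w g) (s : ℝ) :
    sobNorm (s - 1) g ≤ 7 * sobNorm s w := by
  have mw := measurable_hat w
  have mwt := measurable_weight'
  rw [← ENNReal.pow_le_pow_left_iff two_ne_zero, mul_pow, sobNorm_sq', sobNorm_sq',
    ← lintegral_const_mul _ (by fun_prop)]
  apply lintegral_mono_ae
  filter_upwards [h.hat_eq] with ξ hξ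
  rw [hξ, enorm_mul, mul_pow, ← mul_assoc, ← mul_assoc,
    enorm_sq_eq_ofReal (2 * Real.pi * ξ * Complex.I)]
  refine mul_le_mul' ?_ le_rfl
  have e7 : (7 : ENNReal) ^ 2 = ENNReal.ofReal 49 := by norm_num
  unfold weight
  rw [e7, ← ENNReal.ofReal_mul (by positivity), ← ENNReal.ofReal_mul (by positivity)]
  apply ENNReal.ofReal_le_ofReal
  have e : ‖(2 * Real.pi * ξ * Complex.I : ℂ)‖ ^ 2 = (2 * Real.pi) ^ 2 * ξ ^ 2 := by
    simp [mul_pow]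
  rw [e]
  have hp : 0 < (1 + ξ ^ 2) ^ (s - 1) := by positivity
  have hsplit : (1 + ξ ^ 2) ^ s = (1 + ξ ^ 2) ^ (s - 1) * (1 + ξ ^ 2) := by
    rw [← Real.rpow_add_one (by positivity)]; congr 1; ring
  rw [hsplit]
  have : (2 * Real.pi) ^ 2 * ξ ^ 2 ≤ 49 * (1 + ξ ^ 2) := by
    nlinarith [Real.pi_lt_d2, Real.pi_pos, sq_nonneg ξ, mul_nonneg Real.pi_pos.le (sq_nonneg ξ)]
  nlinarith [mul_le_mul_of_nonneg_left this hp.le]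

theorem coeFn_diffQuot (w : RealL2) (h : ℝ) :
    diffQuot w h =ᵐ[volume] fun x => h⁻¹ * (w (x + h) - w x) := by
  filter_upwards [Lp.coeFn_smul h⁻¹ (shift h w - w), Lp.coeFn_sub (shift h w) w,
    coeFn_shift h w] with x h1 h2 h3
  rw [diffQuot, h1, Pi.smul_apply, h2, Pi.sub_apply, h3, smul_eq_mul]

theorem ae_comp_add {P : ℝ → Prop} (h : ∀ᵐ x, P x) (a : ℝ) : ∀ᵐ x : ℝ, P (x + a) :=
  (measurePreserving_add_right (volume : Measure ℝ) a).quasiMeasurePreserving.ae h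

theorem eventually_ae_abs_shift_sub_le {w : RealL2} (hw : sobNorm 1 w < ⊤) {δ : ℝ} (hδ : 0 < δ) :
    ∀ᶠ h in 𝓝 (0 : ℝ), ∀ᵐ x, |w (x + h) - w x| ≤ δ := by
  have h1 := tendsto_sobNorm_shift_sub hw
  have h2 : Tendsto (fun h => embedConst 1 * sobNorm 1 (shift h w - w)) (𝓝 0) (𝓝 0) := by
    simpa using ENNReal.Tendsto.const_mul h1 (Or.inr (embedConst_lt_top (by norm_num)).ne)
  have hδ' : (0 : ENNReal) < ENNReal.ofReal δ := by simpa using hδ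
  filter_upwards [h2.eventually (gt_mem_nhds hδ')] with h hh
  filter_upwards [ae_enorm_le_embedConst (s := 1) (by norm_num) (shift h w - w),
    Lp.coeFn_sub (shift h w) w, coeFn_shift h w] with x h3 h4 h5
  rw [h4, Pi.sub_apply, h5] at h3
  have := h3.trans hh.le
  rwa [← ofReal_norm, ENNReal.ofReal_le_ofReal_iff hδ.le, Real.norm_eq_abs] at this

/-- The chain rule. -/
theorem HasL2Deriv.comp {f : ℝ → ℝ} (hf : ContDiff ℝ 1 f) {w g p q : RealL2}
    (hw : sobNorm 1 w < ⊤) (hg : HasL2Deriv w g) (hp : p =ᵐ[volume] fun x => f (w x))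
    (hq : q =ᵐ[volume] fun x => deriv f (w x) * g x) : HasL2Deriv p q := by
  obtain ⟨M, hM⟩ : ∃ M : ℝ, ∀ᵐ x, |w x| ≤ M := by
    refine ⟨(embedConst 1 * sobNorm 1 w).toReal, ?_⟩
    filter_upwards [ae_enorm_le_embedConst (s := 1) (by norm_num) w] with x hx
    have hfin := ENNReal.mul_lt_top (embedConst_lt_top (s := 1) (by norm_num)) hw
    have := ENNReal.toReal_mono hfin.ne hx
    simpa using this
  obtain ⟨L, hL, hL'⟩ := exists_abs_le_of_continuous hf.continuous_deriv_one M
  rw [HasL2Deriv, tendsto_iff_norm_sub_tendsto_zero]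
  -- By the embedding of `H¹` the increments of `w` are uniformly small for small `h`, so the
  -- first-order remainder of `f` is at most `ε` times the increment. What is left is `f'(w)` times
  -- the error of the difference quotient of `w`.
  have main : ∀ ε > 0, ∀ᶠ h in 𝓝[≠] (0 : ℝ),
      ‖diffQuot p h - q‖ ≤ ε * ‖diffQuot w h‖ + L * ‖diffQuot w h - g‖ := by
    intro ε hε
    obtain ⟨δ, hδ, hd⟩ := exists_first_order_le hf M hε
    filter_upwards [(eventually_ae_abs_shift_sub_le hw hδ).filter_mono nhdsWithin_le_nhds] with h hh
    apply Lp.norm_le_of_ae_le hε.le hL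
    filter_upwards [hh, hM, ae_comp_add hM h, hp, ae_comp_add hp h, hq, coeFn_diffQuot p h,
      coeFn_diffQuot w h, Lp.coeFn_sub (diffQuot p h) q, Lp.coeFn_sub (diffQuot w h) g] with
      x a1 a2 a3 a4 a5 a6 a7 a8 a9 a10
    rw [a9, a10, Pi.sub_apply, Pi.sub_apply, a7, a8, a4, a5, a6]
    have e : h⁻¹ * (f (w (x + h)) - f (w x)) - deriv f (w x) * g x =
        h⁻¹ * (f (w (x + h)) - f (w x) - deriv f (w x) * (w (x + h) - w x)) +
        deriv f (w x) * (h⁻¹ * (w (x + h) - w x) - g x) := by ring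
    rw [e]
    refine (abs_add_le _ _).trans ?_
    rw [abs_mul, abs_mul, abs_mul h⁻¹]
    have b1 := hd _ _ a3 a2 a1
    have b2 := hL' _ a2
    calc _ ≤ |h⁻¹| * (ε * |w (x + h) - w x|) + L * |h⁻¹ * (w (x + h) - w x) - g x| := by gcongr
      _ = _ := by ring
  have t1 : Tendsto (fun h => ‖diffQuot w h‖) (𝓝[≠] 0) (𝓝 ‖g‖) := hg.norm
  have t2 : Tendsto (fun h => L * ‖diffQuot w h - g‖) (𝓝[≠] 0) (𝓝 0) := by
    simpa using (tendsto_iff_norm_sub_tendsto_zero.1 hg).const_mul L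
  rw [Metric.tendsto_nhds]
  intro ε hε
  set η := ε / 2 / (‖g‖ + 1) with hη
  have hη0 : 0 < η := by positivity
  filter_upwards [main η hη0, t1.eventually (gt_mem_nhds (lt_add_one ‖g‖)),
    t2.eventually (gt_mem_nhds (half_pos hε))] with h a1 a2 a3
  have : η * ‖diffQuot w h‖ ≤ ε / 2 := by
    calc _ ≤ η * (‖g‖ + 1) := by gcongr
      _ = ε / 2 := by rw [hη]; field_simp
  rw [Real.dist_eq, sub_zero, abs_norm]
  linarith

/-! ### Superposition in `H^s` -/

/-- The superposition operator of `f` is, on bounded sets of `H^s`, Lipschitz continuous up to an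
arbitrarily small error and a multiple of the `L²` distance. -/
def NemBound (s : ℝ) (f : ℝ → ℝ) : Prop :=
  ∀ M : ℝ≥0, ∃ L : ℝ≥0, ∀ ε : ℝ≥0, 0 < ε → ∃ C : ℝ≥0, ∀ u v : RealL2, sobNorm s u ≤ M →
    sobNorm s v ≤ M →
    sobNorm s (nem f u - nem f v) ≤ L * sobNorm s (u - v) + C * ‖u - v‖ₑ + ε

theorem exists_ae_abs_le {s : ℝ} (hs : 1 / 2 < s) (M : ℝ≥0) :
    ∃ R : ℝ, ∀ u : RealL2, sobNorm s u ≤ M → ∀ᵐ x, |u x| ≤ R := by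
  have hfin : embedConst s * M < ⊤ := ENNReal.mul_lt_top (embedConst_lt_top hs) (by simp)
  refine ⟨(embedConst s * M).toReal, fun u hu => ?_⟩
  filter_upwards [ae_enorm_le_embedConst hs u] with x hx
  have h1 : ‖u x‖ₑ ≤ embedConst s * M := hx.trans (by gcongr)
  simpa using ENNReal.toReal_mono hfin.ne h1

theorem enorm_le_of_norm_le {E F G : Type*} [NormedAddCommGroup E] [NormedAddCommGroup F]
    [NormedAddCommGroup G] {r : E} {u : F} {v : G} {a b : ℝ≥0}
    (h : ‖r‖ ≤ a * ‖u‖ + b * ‖v‖) : ‖r‖ₑ ≤ a * ‖u‖ₑ + b * ‖v‖ₑ := by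
  simp only [enorm_eq_nnnorm]
  exact_mod_cast h

theorem continuous_shift (w : RealL2) : Continuous fun h => shift h w := by
  have h0 : sobNorm 0 w < ⊤ := by rw [sobNorm_zero_order]; exact enorm_lt_top
  exact (SobolevH.toL2L le_rfl).continuous.comp (SobolevH.continuous_shiftH (SobolevH.mk w h0))

theorem ENNReal.add_sq_le_two_mul (a b : ENNReal) : (a + b) ^ 2 ≤ 2 * (a ^ 2 + b ^ 2) := by
  induction a with
  | top => simp
  | coe a =>
    induction b with
    | top => simp
    | coe b =>
      have : (a + b) ^ 2 ≤ 2 * (a ^ 2 + b ^ 2) := add_sq_le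
      exact_mod_cast this

theorem sobNorm_zero (s : ℝ) : sobNorm s 0 = 0 := by
  simpa using sobNorm_smul s 0 0

theorem gagliardo_le_of_forall {σ : ℝ} {d u v : RealL2} {a b : ℝ≥0}
    (h : ∀ t, ‖shift t d - d‖ₑ ≤ a * ‖shift t u - u‖ₑ + b * ‖shift t v - v‖ₑ) :
    gagliardo σ d ≤ 2 * a ^ 2 * gagliardo σ u + 2 * b ^ 2 * gagliardo σ v := by
  have m := fun w => ((continuous_shift w).sub (continuous_const (y := w))).enorm.measurable
  have mu := m u
  have mv := m v
  unfold gagliardo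
  rw [← lintegral_const_mul _ (by fun_prop), ← lintegral_const_mul _ (by fun_prop),
    ← lintegral_add_left (by fun_prop)]
  refine lintegral_mono fun t => ?_
  calc _ ≤ ENNReal.ofReal (t ^ (-1 - 2 * σ)) *
        (a * ‖shift t u - u‖ₑ + b * ‖shift t v - v‖ₑ) ^ 2 := by gcongr; exact h t
    _ ≤ ENNReal.ofReal (t ^ (-1 - 2 * σ)) *
        (2 * ((a * ‖shift t u - u‖ₑ) ^ 2 + (b * ‖shift t v - v‖ₑ) ^ 2)) := by
        gcongr
        exact ENNReal.add_sq_le_two_mul _ _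
    _ = _ := by ring

/-- `exists_second_difference_le` bounds the translation differences of `f(u) - f(v)` by those of `u
- v` and those of `v`, the latter with factor `ε' + C' m` where `m` bounds `|u - v|`. Passing to
Gagliardo seminorms and bounding `m` by a small multiple of `‖u - v‖_s` plus a multiple of the `L²`
norm gives the claim. -/
theorem nemBound_of_lt_one {s : ℝ} (hs : 1 / 2 < s) (hs1 : s < 1) {f : ℝ → ℝ}
    (hf : ContDiff ℝ 1 f) (hf0 : f 0 = 0) : NemBound s f := by
  intro M
  obtain ⟨R, hR⟩ := exists_ae_abs_le hs M
  obtain ⟨L, hL, hL2⟩ := exists_second_difference_le hf R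
  obtain ⟨L0, hL0, hLip⟩ := exists_norm_nem_sub_le hf hf0 R
  obtain ⟨G0, hG0⟩ := exists_gagliardo_le (σ := s) (by linarith) hs1
  lift L to ℝ≥0 using hL
  lift L0 to ℝ≥0 using hL0
  set G : ℝ≥0 := G0 + 1
  have hG : ∀ w, gagliardo s w ≤ (G * sobNorm s w) ^ 2 := by
    intro w
    refine (hG0 w).trans ?_
    rw [mul_pow]
    gcongr
    have : G0 ≤ G ^ 2 := by
      have h1 : G0 ≤ G := le_self_add
      have h2 : 1 ≤ G := le_add_self
      calc G0 ≤ G * 1 := by simpa using h1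
        _ ≤ G * G := by gcongr
        _ = G ^ 2 := (sq G).symm
    exact_mod_cast this
  -- The summand 1 is reserved for the term `2 G M C' η ‖u - v‖_s`. `C'` may be large for small `ε`,
  -- but `η` is chosen after it so that `2 G M C' η ≤ 1`; likewise `ε'` is chosen so that `2 G M ε'
  -- ≤ ε`.
  refine ⟨2 * L * G + 1, fun ε hε => ?_⟩
  obtain ⟨C', hC', hC2⟩ := hL2 (ε / (2 * G * M + 1) : ℝ≥0) (by positivity)
  lift C' to ℝ≥0 using hC'
  obtain ⟨Cη, hCη⟩ := exists_ae_enorm_le hs (η := 1 / (2 * G * M * C' + 1)) (by positivity)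
  set η : ℝ≥0 := 1 / (2 * G * M * C' + 1) with hη
  set ε' : ℝ≥0 := ε / (2 * G * M + 1) with hε'
  refine ⟨2 * L0 + 2 * G * M * C' * Cη, fun u v hu hv => ?_⟩
  have hN : sobNorm s (u - v) < ⊤ := (sobNorm_sub_le s u v).trans_lt
    (ENNReal.add_lt_top.2 ⟨hu.trans_lt (by simp), hv.trans_lt (by simp)⟩)
  have hfin : η * sobNorm s (u - v) + Cη * ‖u - v‖ₑ ≠ ⊤ := by finiteness
  obtain ⟨m, hm⟩ := WithTop.ne_top_iff_exists.1 hfin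
  change (m : ENNReal) = _ at hm
  have hdiff : ∀ᵐ x, |u x - v x| ≤ m := by
    filter_upwards [hCη (u - v), Lp.coeFn_sub u v] with x h1 h2
    rw [← hm, h2, Pi.sub_apply] at h1
    rw [← Real.norm_eq_abs, ← coe_nnnorm]
    exact_mod_cast h1
  set κ : ℝ≥0 := ε' + C' * m with hκ
  set d := nem f u - nem f v with hd
  have hshift : ∀ t, ‖shift t d - d‖ₑ ≤
      L * ‖shift t (u - v) - (u - v)‖ₑ + κ * ‖shift t v - v‖ₑ := by
    intro t
    apply enorm_le_of_norm_le
    apply Lp.norm_le_of_ae_le L.2 κ.2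
    have aux : ∀ a b : RealL2, ∀ᵐ x, (shift t (a - b) - (a - b)) x =
        (a (x + t) - b (x + t)) - (a x - b x) := by
      intro a b
      filter_upwards [Lp.coeFn_sub (shift t (a - b)) (a - b), coeFn_shift t (a - b),
        Lp.coeFn_sub a b, ae_comp_add (Lp.coeFn_sub a b) t] with x h1 h2 h3 h4
      rw [h1, Pi.sub_apply, h2, h3, h4, Pi.sub_apply, Pi.sub_apply]
    have nu := coeFn_nem hf hf0 (hR u hu)
    have nv := coeFn_nem hf hf0 (hR v hv)
    filter_upwards [aux (nem f u) (nem f v), aux u v, Lp.coeFn_sub (shift t v) v, coeFn_shift t v,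
      nu, nv, ae_comp_add nu t, ae_comp_add nv t, hR u hu, hR v hv, ae_comp_add (hR u hu) t,
      ae_comp_add (hR v hv) t, hdiff, ae_comp_add hdiff t] with
      x a1 a2 a3 a4 a5 a6 a7 a8 a9 a10 a11 a12 a13 a14
    rw [hd, a1, a2, a3, Pi.sub_apply, a4, a5, a6, a7, a8]
    have := hC2 m (u (x + t)) (u x) (v (x + t)) (v x) a11 a9 a12 a10 a14 a13
    have e1 : f (u (x + t)) - f (v (x + t)) - (f (u x) - f (v x)) =
      f (u (x + t)) - f (u x) - (f (v (x + t)) - f (v x)) := by ring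
    have e2 : u (x + t) - v (x + t) - (u x - v x) =
      u (x + t) - u x - (v (x + t) - v x) := by ring
    rw [e1, e2]
    refine this.trans (le_of_eq ?_)
    simp [hκ]
  have hL2d : ‖d‖ₑ ≤ L0 * ‖u - v‖ₑ := by
    have := hLip u v (hR u hu) (hR v hv)
    have := enorm_le_of_norm_le (r := d) (u := u - v) (v := (0 : ℝ)) (a := L0) (b := 0)
      (by simpa using this)
    simpa using this
  have hsq : sobNorm s d ^ 2 ≤ (2 * L0 * ‖u - v‖ₑ + 2 * L * G * sobNorm s (u - v) +
      2 * κ * G * M) ^ 2 := by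
    calc sobNorm s d ^ 2 ≤ 2 * ‖d‖ₑ ^ 2 + gagliardo s d :=
          sobNorm_sq_le_gagliardo (by linarith) hs1 d
      _ ≤ 2 * (L0 * ‖u - v‖ₑ) ^ 2 + (2 * L ^ 2 * (G * sobNorm s (u - v)) ^ 2 +
          2 * κ ^ 2 * (G * M) ^ 2) := by
          gcongr
          refine (gagliardo_le_of_forall hshift).trans ?_
          gcongr
          · exact hG _
          · refine (hG v).trans ?_
            gcongr
      _ ≤ (2 * L0 * ‖u - v‖ₑ) ^ 2 + (2 * L * G * sobNorm s (u - v)) ^ 2 +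
          (2 * κ * G * M) ^ 2 := by
          have h24 : (2 : ENNReal) ≤ 4 := by norm_num
          calc _ = 2 * ((L0 * ‖u - v‖ₑ) ^ 2 + (L * G * sobNorm s (u - v)) ^ 2 +
                (κ * G * M) ^ 2) := by ring
            _ ≤ 4 * ((L0 * ‖u - v‖ₑ) ^ 2 + (L * G * sobNorm s (u - v)) ^ 2 +
                (κ * G * M) ^ 2) := by gcongr
            _ = _ := by ring
      -- A sum of squares of nonnegative terms is at most the square of the sum; the added terms are
      -- the cross terms.
      _ ≤ _ := by
          refine le_of_le_of_eq (b := _ + (2 * (2 * L0 * ‖u - v‖ₑ) * (2 * L * G * sobNorm s (u - v)) +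
            2 * (2 * L0 * ‖u - v‖ₑ) * (2 * κ * G * M) +
            2 * (2 * L * G * sobNorm s (u - v)) * (2 * κ * G * M))) le_self_add ?_
          ring
  rw [ENNReal.pow_le_pow_left_iff two_ne_zero] at hsq
  refine hsq.trans ?_
  have hκ' : (κ : ENNReal) = ε' + C' * (η * sobNorm s (u - v) + Cη * ‖u - v‖ₑ) := by
    rw [← hm, hκ]; push_cast; rfl
  have k1 : (2 * G * M * C' * η : ENNReal) ≤ 1 := by
    have : 2 * G * M * C' * η ≤ 1 := by
      rw [hη, mul_one_div]
      exact div_le_one_of_le₀ le_self_add (by positivity)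
    exact_mod_cast this
  have k2 : (2 * G * M * ε' : ENNReal) ≤ ε := by
    have : 2 * G * M * ε' ≤ ε := by
      rw [hε', mul_div_assoc', div_le_iff₀ (by positivity), mul_comm]
      gcongr
      exact le_self_add
    exact_mod_cast this
  rw [hκ']
  calc _ = (2 * L * G + 2 * G * M * C' * η) * sobNorm s (u - v) +
        (2 * L0 + 2 * G * M * C' * Cη) * ‖u - v‖ₑ + 2 * G * M * ε' := by ring
    _ ≤ (2 * L * G + 1) * sobNorm s (u - v) +
        (2 * L0 + 2 * G * M * C' * Cη) * ‖u - v‖ₑ + ε := by gcongr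
    _ = _ := by push_cast; rfl

theorem exists_ae_eq_mul {F : ℝ → ℝ} (hF : AEStronglyMeasurable F volume) {B : ℝ}
    (hB : ∀ᵐ x, |F x| ≤ B) (h : RealL2) : ∃ p : RealL2, p =ᵐ[volume] fun x => F x * h x := by
  have hm : MemLp (fun x => F x * h x) 2 volume := by
    refine (Lp.memLp h).of_le_mul (c := B) (hF.mul (Lp.aestronglyMeasurable h)) ?_
    filter_upwards [hB] with x hx
    rw [norm_mul]
    gcongr
    exact hx
  exact ⟨hm.toLp, hm.coeFn_toLp⟩

theorem HasL2Deriv.sub {w₁ w₂ g₁ g₂ : RealL2} (h₁ : HasL2Deriv w₁ g₁) (h₂ : HasL2Deriv w₂ g₂) :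
    HasL2Deriv (w₁ - w₂) (g₁ - g₂) := by
  refine (Tendsto.sub h₁ h₂).congr fun h => ?_
  simp only [diffQuot, map_sub, ← smul_sub]
  congr 1; abel

/-- With `g = f' - c` and `c = f'(0)`, the derivative of `f(u) - f(v)` is `g(u)(u' - v') + (g(u) -
g(v)) v' + c (u' - v')`. The products are estimated in `H^(s-1)` with the `g` factors in `H^a`.
Subtracting `c` makes `g` vanish at zero, so that `g(u)` is square-integrable. -/
theorem nemBound_of_deriv {s a : ℝ} (hs : 1 ≤ s) (ha : 1 / 2 < a) (hsa : s - 1 ≤ a) (has : a ≤ s)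
    {f : ℝ → ℝ} (hf : ContDiff ℝ 1 f) (hf0 : f 0 = 0)
    (hg1 : ContDiff ℝ 1 fun x => deriv f x - deriv f 0)
    (hg : NemBound a fun x => deriv f x - deriv f 0) : NemBound s f := by
  intro M
  set c := deriv f 0
  set g : ℝ → ℝ := fun x => deriv f x - c with hgdef
  have hg0 : g 0 = 0 := by simp [hgdef, c]
  obtain ⟨R, hR⟩ := exists_ae_abs_le (s := s) (by linarith) M
  obtain ⟨L0, hL0, hLip⟩ := exists_norm_nem_sub_le hf hf0 R
  obtain ⟨Bg, -, hBg⟩ := exists_abs_le_of_continuous hg1.continuous R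
  obtain ⟨Bd, -, hBd⟩ := exists_abs_le_of_continuous hf.continuous_deriv_one R
  obtain ⟨Cp, hCp⟩ := exists_sobNorm_mul_le ha (b := s - 1) (by linarith) hsa
  obtain ⟨Cd, hCd⟩ := exists_sobNorm_le_deriv (s := s) (by linarith)
  lift L0 to ℝ≥0 using hL0
  obtain ⟨L1, hL1⟩ := hg M
  obtain ⟨C1, hC1⟩ := hL1 1 one_pos
  -- `K` bounds `g(u)` in `H^a`: the bound for `g` is used with error 1 and second argument zero.
  set K : ℝ≥0 := L1 * M + C1 * M + 1 with hK
  refine ⟨7 * (Cp * K + Cp * L1 * M + ‖c‖₊), fun ε hε => ?_⟩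
  obtain ⟨C2, hC2⟩ := hL1 (ε / (7 * Cp * M + 1)) (by positivity)
  set ε' : ℝ≥0 := ε / (7 * Cp * M + 1) with hε'
  refine ⟨Cd * L0 + 7 * Cp * M * C2, fun u v hu hv => ?_⟩
  have hfin : ∀ {w}, sobNorm s w ≤ M → sobNorm 1 w < ⊤ := fun hw =>
    ((sobNorm_mono hs _).trans hw).trans_lt (by simp)
  have hMa : ∀ {w}, sobNorm s w ≤ M → sobNorm a w ≤ M := fun hw => (sobNorm_mono has _).trans hw
  obtain ⟨u', hu'⟩ := exists_hasL2Deriv (hfin hu)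
  obtain ⟨v', hv'⟩ := exists_hasL2Deriv (hfin hv)
  have nfu := coeFn_nem hf hf0 (hR u hu)
  have nfv := coeFn_nem hf hf0 (hR v hv)
  have ngu := coeFn_nem hg1 hg0 (hR u hu)
  have ngv := coeFn_nem hg1 hg0 (hR v hv)
  have bdu : ∃ q : RealL2, q =ᵐ[volume] fun x => deriv f (u x) * u' x := by
    refine exists_ae_eq_mul (hf.continuous_deriv_one.comp_aestronglyMeasurable
      (Lp.aestronglyMeasurable u)) (B := Bd) ?_ _
    filter_upwards [hR u hu] with x hx using hBd _ hx
  have bdv : ∃ q : RealL2, q =ᵐ[volume] fun x => deriv f (v x) * v' x := by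
    refine exists_ae_eq_mul (hf.continuous_deriv_one.comp_aestronglyMeasurable
      (Lp.aestronglyMeasurable v)) (B := Bd) ?_ _
    filter_upwards [hR v hv] with x hx using hBd _ hx
  obtain ⟨qu, hqu⟩ := bdu
  obtain ⟨qv, hqv⟩ := bdv
  obtain ⟨P1, hP1⟩ := exists_ae_eq_mul (Lp.aestronglyMeasurable (nem g u)) (B := Bg)
    (by filter_upwards [ngu, hR u hu] with x h1 h2; rw [h1]; exact hBg _ h2) (u' - v')
  obtain ⟨P2, hP2⟩ := exists_ae_eq_mul (Lp.aestronglyMeasurable (nem g u - nem g v)) (B := Bg + Bg)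
    (by
      filter_upwards [ngu, ngv, hR u hu, hR v hv, Lp.coeFn_sub (nem g u) (nem g v)] with
        x h1 h2 h3 h4 h5
      rw [h5, Pi.sub_apply, h1, h2]
      exact (abs_sub _ _).trans (add_le_add (hBg _ h3) (hBg _ h4))) v'
  have hsum : qu - qv = P1 + P2 + c • (u' - v') := by
    apply Lp.ext
    filter_upwards [Lp.coeFn_sub qu qv, Lp.coeFn_add (P1 + P2) (c • (u' - v')),
      Lp.coeFn_add P1 P2, Lp.coeFn_smul c (u' - v'), Lp.coeFn_sub u' v',
      Lp.coeFn_sub (nem g u) (nem g v), ngu, ngv, hP1, hP2, hqu, hqv] with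
      x a1 a2 a3 a4 a5 a6 a7 a8 a9 a10 a11 a12
    rw [a1, a2, Pi.sub_apply, Pi.add_apply, a3, Pi.add_apply, a4, Pi.smul_apply, a9, a10, a11, a12,
      a6, Pi.sub_apply, a5, Pi.sub_apply, a7, a8, smul_eq_mul]
    simp only [hgdef]
    ring
  have hD := (hu'.comp hf (hfin hu) nfu hqu).sub (hv'.comp hf (hfin hv) nfv hqv)
  have hd1 := (hu'.sub hv').sobNorm_le s
  have hgu : sobNorm a (nem g u) ≤ K := by
    have h := hC1 u 0 (hMa hu) (by simp [sobNorm_zero])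
    rw [nem_zero hg1 hg0, sub_zero, sub_zero] at h
    refine h.trans ?_
    rw [hK]
    push_cast
    gcongr
    · exact hMa hu
    · exact (enorm_le_sobNorm (by linarith) u).trans hu
  have hgsub : sobNorm a (nem g u - nem g v) ≤ L1 * sobNorm s (u - v) + C2 * ‖u - v‖ₑ + ε' := by
    refine (hC2 u v (hMa hu) (hMa hv)).trans ?_
    gcongr
    exact sobNorm_mono has _
  have hN : sobNorm s (u - v) < ⊤ := (sobNorm_sub_le s u v).trans_lt
    (ENNReal.add_lt_top.2 ⟨hu.trans_lt (by simp), hv.trans_lt (by simp)⟩)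
  have b1 : sobNorm (s - 1) P1 ≤ Cp * (K * (7 * sobNorm s (u - v))) := by
    refine (hCp _ _ _ (hgu.trans_lt (by simp)) hP1).trans ?_
    gcongr
  have b2 : sobNorm (s - 1) P2 ≤ Cp * ((L1 * sobNorm s (u - v) + C2 * ‖u - v‖ₑ + ε') *
      (7 * M)) := by
    refine (hCp _ _ _ (hgsub.trans_lt (by finiteness)) hP2).trans ?_
    gcongr
    refine (hv'.sobNorm_le s).trans ?_
    gcongr
  have b3 : sobNorm (s - 1) (c • (u' - v')) ≤ ‖c‖₊ * (7 * sobNorm s (u - v)) := by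
    rw [sobNorm_smul, enorm_eq_nnnorm]
    gcongr
  have b0 : ‖nem f u - nem f v‖ₑ ≤ L0 * ‖u - v‖ₑ := by
    have := hLip u v (hR u hu) (hR v hv)
    have := enorm_le_of_norm_le (r := nem f u - nem f v) (u := u - v) (v := (0 : ℝ)) (a := L0)
      (b := 0) (by simpa using this)
    simpa using this
  have k2 : (7 * Cp * M * ε' : ENNReal) ≤ ε := by
    have : 7 * Cp * M * ε' ≤ ε := by
      rw [hε', mul_div_assoc', div_le_iff₀ (by positivity), mul_comm]
      gcongr
      exact le_self_add
    exact_mod_cast this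
  calc sobNorm s (nem f u - nem f v) ≤ Cd * ‖nem f u - nem f v‖ₑ + sobNorm (s - 1) (qu - qv) :=
        hCd _ _ hD
    _ ≤ Cd * (L0 * ‖u - v‖ₑ) + (Cp * (K * (7 * sobNorm s (u - v))) +
        Cp * ((L1 * sobNorm s (u - v) + C2 * ‖u - v‖ₑ + ε') * (7 * M)) +
        ‖c‖₊ * (7 * sobNorm s (u - v))) := by
        rw [hsum]
        gcongr
        refine (sobNorm_add_le _ _ _).trans ?_
        gcongr
        refine (sobNorm_add_le _ _ _).trans ?_
        gcongr
    _ = 7 * (Cp * K + Cp * L1 * M + ‖c‖₊) * sobNorm s (u - v) +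
        (Cd * L0 + 7 * Cp * M * C2) * ‖u - v‖ₑ + 7 * Cp * M * ε' := by ring
    _ ≤ 7 * (Cp * K + Cp * L1 * M + ‖c‖₊) * sobNorm s (u - v) +
        (Cd * L0 + 7 * Cp * M * C2) * ‖u - v‖ₑ + ε := by gcongr
    _ = _ := by push_cast; rfl

/-- Induction on the number of derivatives: for `s ≥ 1`, differentiating once lowers both the
smoothness of `f` and the upper limit for the order by one. -/
theorem nemBound (n : ℕ) : ∀ {s : ℝ}, 1 / 2 < s → s < n + 1 → ∀ {f : ℝ → ℝ},
    ContDiff ℝ ((n + 1 : ℕ) : WithTop ℕ∞) f → f 0 = 0 → NemBound s f := by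
  induction n with
  | zero =>
    intro s hs hs1 f hf hf0
    exact nemBound_of_lt_one hs (by simpa using hs1) (by simpa using hf) hf0
  | succ n ih =>
    intro s hs hs1 f hf hf0
    have hf1 : ContDiff ℝ 1 f := hf.of_le (by norm_cast; omega)
    rcases lt_or_ge s 1 with h | h
    · exact nemBound_of_lt_one hs h hf1 hf0
    · push_cast at hs1
      have hn : (0 : ℝ) ≤ n := n.cast_nonneg
      have hd : ContDiff ℝ ((n + 1 : ℕ) : WithTop ℕ∞) (deriv f) := by
        have : ((n + 1 + 1 : ℕ) : WithTop ℕ∞) = ((n + 1 : ℕ) : WithTop ℕ∞) + 1 := by push_cast; rfl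
        rw [this, contDiff_succ_iff_deriv] at hf
        exact hf.2.2
      have hg := hd.sub (contDiff_const (c := deriv f 0))
      -- The order for `f'` should be `s - 1`, but it must stay above `1/2`; `3/4` serves as a floor
      -- that is still below `n + 1` and `s`.
      have ha : (1 : ℝ) / 2 < max (s - 1) (3 / 4) := lt_max_of_lt_right (by norm_num)
      refine nemBound_of_deriv h ha (le_max_left _ _) (max_le (by linarith) (by linarith)) hf1 hf0
        (hg.of_le (by norm_cast; omega)) (ih ha (max_lt (by linarith) (by linarith)) hg (sub_self _))

/-! ### Picard iteration with a weak and a strong norm -/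

/-- A vector field `F` on a space with a weaker norm `‖J ·‖`: bounded on bounded sets, Lipschitz on
bounded sets for the weaker norm, and Lipschitz on bounded sets up to an error which is small when
the points are close in the weaker norm. -/
structure WeaklyLipschitz {H E : Type*} [NormedAddCommGroup H] [NormedSpace ℝ H]
    [NormedAddCommGroup E] [NormedSpace ℝ E] (J : H →L[ℝ] E) (F : H → H) : Prop where
  bounded : ∀ M : ℝ, ∃ B : ℝ, 0 ≤ B ∧ ∀ u, ‖u‖ ≤ M → ‖F u‖ ≤ B
  weak : ∀ M : ℝ, ∃ L : ℝ, 0 ≤ L ∧ ∀ u v, ‖u‖ ≤ M → ‖v‖ ≤ M → ‖J (F u - F v)‖ ≤ L * ‖J (u - v)‖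
  strong : ∀ M : ℝ, ∃ L : ℝ, 0 ≤ L ∧ ∀ ε > 0, ∃ δ > 0, ∀ u v, ‖u‖ ≤ M → ‖v‖ ≤ M →
    ‖J (u - v)‖ ≤ δ → ‖F u - F v‖ ≤ L * ‖u - v‖ + ε

/-- The nearest point of `[0, T]`. -/
def clamp (T t : ℝ) : ℝ := max 0 (min t T)

theorem clamp_mem {T : ℝ} (hT : 0 ≤ T) (t : ℝ) : clamp T t ∈ Icc 0 T :=
  ⟨le_max_left _ _, max_le hT (min_le_right _ _)⟩

theorem clamp_of_mem {T t : ℝ} (ht : t ∈ Icc 0 T) : clamp T t = t := by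
  rw [clamp, min_eq_left ht.2, max_eq_right ht.1]

theorem continuous_clamp (T : ℝ) : Continuous (clamp T) := by unfold clamp; fun_prop

/-- Absorption: the hypothesis is used with `d` the supremum of `g`, which is finite by boundedness.
-/
theorem le_two_mul_of_forall_le_add_half {α : Type*} [Nonempty α] {g : α → ℝ} {a : ℝ}
    (hg : BddAbove (range g)) (h : ∀ d, (∀ t, g t ≤ d) → ∀ t, g t ≤ a + d / 2) (t : α) :
    g t ≤ 2 * a := by
  have h1 := h (⨆ t, g t) (le_ciSup hg)
  have h2 : ⨆ t, g t ≤ a + (⨆ t, g t) / 2 := ciSup_le h1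
  linarith [le_ciSup hg t]

section Picard

variable {H E : Type*} [NormedAddCommGroup H] [NormedSpace ℝ H]
  [NormedAddCommGroup E] [NormedSpace ℝ E] {J : H →L[ℝ] E} {F : H → H}

theorem WeaklyLipschitz.continuous (hF : WeaklyLipschitz J F) : Continuous F := by
  rw [continuous_iff_continuousAt]
  intro u
  obtain ⟨L, hL, h⟩ := hF.strong (‖u‖ + 1)
  rw [ContinuousAt, Metric.tendsto_nhds]
  intro ε hε
  obtain ⟨δ, hδ, h'⟩ := h (ε / 2) (half_pos hε)
  have c1 : Tendsto (fun v => ‖J (v - u)‖) (𝓝 u) (𝓝 0) := by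
    have : Continuous fun v => ‖J (v - u)‖ := by fun_prop
    simpa using this.tendsto u
  have c2 : Tendsto (fun v => L * ‖v - u‖) (𝓝 u) (𝓝 0) := by
    have : Continuous fun v => L * ‖v - u‖ := by fun_prop
    simpa using this.tendsto u
  have c3 : Tendsto (fun v => ‖v‖) (𝓝 u) (𝓝 ‖u‖) := continuous_norm.tendsto u
  filter_upwards [c1.eventually (gt_mem_nhds hδ), c2.eventually (gt_mem_nhds (half_pos hε)),
    c3.eventually (gt_mem_nhds (lt_add_one ‖u‖))] with v h1 h2 h3
  rw [dist_eq_norm]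
  have := h' v u h3.le (by linarith) h1.le
  linarith

/-- One step of the Picard iteration on `[0, T]`, extended by constants. -/
def picardStep (F : H → H) (T : ℝ) (ψ : H) (x : ℝ → H) (t : ℝ) : H :=
  ψ + ∫ τ in (0 : ℝ)..clamp T t, F (x τ)

theorem norm_integral_clamp_le {T A : ℝ} (hT : 0 ≤ T) {g : ℝ → H}
    (hg : ∀ t, ‖g t‖ ≤ A) (t : ℝ) : ‖∫ τ in (0 : ℝ)..clamp T t, g τ‖ ≤ T * A := by
  have hA : 0 ≤ A := (norm_nonneg _).trans (hg 0)
  have h1 := clamp_mem hT t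
  refine (intervalIntegral.norm_integral_le_of_norm_le_const fun τ _ => hg τ).trans ?_
  rw [sub_zero, abs_of_nonneg h1.1, mul_comm]
  exact mul_le_mul_of_nonneg_right h1.2 hA

theorem continuous_picardStep {T : ℝ} (hF : Continuous F) (ψ : H) {x : ℝ → H}
    (hx : Continuous x) : Continuous (picardStep F T ψ x) := by
  refine continuous_const.add ?_
  exact (intervalIntegral.continuous_primitive
    (fun a b => (hF.comp hx).intervalIntegrable a b) 0).comp (continuous_clamp T)

theorem picardStep_sub {T : ℝ} (hF : Continuous F) (ψ χ : H) {x y : ℝ → H}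
    (hx : Continuous x) (hy : Continuous y) (t : ℝ) :
    picardStep F T ψ x t - picardStep F T χ y t =
      (ψ - χ) + ∫ τ in (0 : ℝ)..clamp T t, (F (x τ) - F (y τ)) := by
  have i1 : IntervalIntegrable (fun τ => F (x τ)) volume 0 (clamp T t) :=
    (hF.comp hx).intervalIntegrable _ _
  have i2 : IntervalIntegrable (fun τ => F (y τ)) volume 0 (clamp T t) :=
    (hF.comp hy).intervalIntegrable _ _
  rw [intervalIntegral.integral_sub i1 i2, picardStep, picardStep]
  abel

theorem norm_picardStep_sub_le {T A : ℝ} (hT : 0 ≤ T) (hF : Continuous F) (ψ χ : H) {x y : ℝ → H}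
    (hx : Continuous x) (hy : Continuous y) (h : ∀ t, ‖F (x t) - F (y t)‖ ≤ A) (t : ℝ) :
    ‖picardStep F T ψ x t - picardStep F T χ y t‖ ≤ ‖ψ - χ‖ + T * A := by
  rw [picardStep_sub hF ψ χ hx hy]
  exact (norm_add_le _ _).trans (add_le_add_right (norm_integral_clamp_le hT h t) _)

theorem norm_map_picardStep_sub_le [CompleteSpace H] [CompleteSpace E]
    {T A : ℝ} (hT : 0 ≤ T) (hF : Continuous F)
    (ψ χ : H) {x y : ℝ → H} (hx : Continuous x) (hy : Continuous y)
    (h : ∀ t, ‖J (F (x t) - F (y t))‖ ≤ A) (t : ℝ) :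
    ‖J (picardStep F T ψ x t - picardStep F T χ y t)‖ ≤ ‖J (ψ - χ)‖ + T * A := by
  have i : IntervalIntegrable (fun τ => F (x τ) - F (y τ)) volume 0 (clamp T t) :=
    ((hF.comp hx).sub (hF.comp hy)).intervalIntegrable _ _
  rw [picardStep_sub hF ψ χ hx hy, map_add, ← J.intervalIntegral_comp_comm i]
  exact (norm_add_le _ _).trans (add_le_add_right (norm_integral_clamp_le hT h t) _)

theorem norm_picardStep_sub_self_le {T B : ℝ} (hT : 0 ≤ T) (ψ : H) {x : ℝ → H}
    (h : ∀ t, ‖F (x t)‖ ≤ B) (t : ℝ) : ‖picardStep F T ψ x t - ψ‖ ≤ T * B := by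
  rw [picardStep, add_sub_cancel_left]
  exact norm_integral_clamp_le hT h t

/-- The numerical conditions under which the Picard iteration works on `[0, T]` for initial data of
norm at most `M - 1`. -/
structure PicardTime (J : H →L[ℝ] E) (F : H → H) (M T L : ℝ) : Prop where
  pos : 0 < T
  nonneg : 0 ≤ L
  bound : ∀ u, ‖u‖ ≤ M → T * ‖F u‖ ≤ 1
  weak : ∀ u v, ‖u‖ ≤ M → ‖v‖ ≤ M → T * ‖J (F u - F v)‖ ≤ ‖J (u - v)‖ / 2
  contraction : T * L ≤ 1 / 2
  strong : ∀ ε > 0, ∃ δ > 0, ∀ u v, ‖u‖ ≤ M → ‖v‖ ≤ M →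
    ‖J (u - v)‖ ≤ δ → ‖F u - F v‖ ≤ L * ‖u - v‖ + ε

theorem WeaklyLipschitz.exists_picardTime (hF : WeaklyLipschitz J F) (M : ℝ) :
    ∃ T L, PicardTime J F M T L := by
  obtain ⟨B, hB, h1⟩ := hF.bounded M
  obtain ⟨K, hK, h2⟩ := hF.weak M
  obtain ⟨L, hL, h3⟩ := hF.strong M
  -- With `T = 1/D` all of `T B ≤ 1`, `T K ≤ 1/2` and `T L ≤ 1/2` hold; the final 1 keeps `D`
  -- positive.
  set D := B + 2 * K + 2 * L + 1 with hD
  have hD0 : 0 < D := by positivity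
  refine ⟨1 / D, L, by positivity, hL, fun u hu => ?_, fun u v hu hv => ?_, ?_, h3⟩
  · rw [one_div_mul_eq_div, div_le_one hD0]
    linarith [h1 u hu]
  · rw [one_div_mul_eq_div, div_le_iff₀ hD0]
    have := h2 u v hu hv
    have : 0 ≤ ‖J (u - v)‖ * (B + 2 * L + 1) := by positivity
    rw [hD]; nlinarith
  · rw [one_div_mul_eq_div, div_le_iff₀ hD0]
    linarith

variable {M T L : ℝ}

theorem PicardTime.weak_step [CompleteSpace H] [CompleteSpace E]
    (h : PicardTime J F M T L) (hF : Continuous F) (ψ χ : H)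
    {x y : ℝ → H} (hx : Continuous x) (hy : Continuous y) (hxM : ∀ t, ‖x t‖ ≤ M)
    (hyM : ∀ t, ‖y t‖ ≤ M) {d : ℝ} (hd : ∀ t, ‖J (x t - y t)‖ ≤ d) (t : ℝ) :
    ‖J (picardStep F T ψ x t - picardStep F T χ y t)‖ ≤ ‖J (ψ - χ)‖ + d / 2 := by
  have hT := h.pos
  refine (norm_map_picardStep_sub_le (A := d / 2 / T) hT.le hF ψ χ hx hy (fun t => ?_) t).trans
    (le_of_eq ?_)
  · rw [le_div_iff₀ hT, mul_comm]
    exact (h.weak _ _ (hxM t) (hyM t)).trans (by linarith [hd t])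
  · field_simp

theorem PicardTime.strong_step (h : PicardTime J F M T L) (hF : Continuous F) (ψ χ : H)
    {x y : ℝ → H} (hx : Continuous x) (hy : Continuous y) {d ε : ℝ}
    (hd : ∀ t, ‖F (x t) - F (y t)‖ ≤ L * d + ε) (hd0 : 0 ≤ d) (t : ℝ) :
    ‖picardStep F T ψ x t - picardStep F T χ y t‖ ≤ ‖ψ - χ‖ + T * ε + d / 2 := by
  refine (norm_picardStep_sub_le h.pos.le hF ψ χ hx hy hd t).trans ?_
  have := mul_le_mul_of_nonneg_right h.contraction hd0
  linarith

/-- The Picard iterates. -/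
def picardIter (F : H → H) (T : ℝ) (ψ : H) : ℕ → ℝ → H
  | 0 => fun _ => ψ
  | n + 1 => picardStep F T ψ (picardIter F T ψ n)

theorem PicardTime.picardIter_spec (h : PicardTime J F M T L) (hF : Continuous F) {ψ : H}
    (hψ : ‖ψ‖ + 1 ≤ M) (n : ℕ) :
    Continuous (picardIter F T ψ n) ∧ ∀ t, ‖picardIter F T ψ n t‖ ≤ M := by
  induction n with
  | zero => exact ⟨continuous_const, fun t => by simp only [picardIter]; linarith⟩
  | succ n ih =>
    refine ⟨continuous_picardStep hF ψ ih.1, fun t => ?_⟩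
    have hT := h.pos
    have h1 := norm_picardStep_sub_self_le (F := F) (B := 1 / T) hT.le ψ (x := picardIter F T ψ n)
      (fun t => by rw [le_div_iff₀ hT, mul_comm]; exact h.bound _ (ih.2 t)) t
    rw [mul_one_div_cancel hT.ne'] at h1
    have h2 := norm_le_norm_add_norm_sub' (picardStep F T ψ (picardIter F T ψ n) t) ψ
    change ‖picardStep F T ψ (picardIter F T ψ n) t‖ ≤ M
    linarith

theorem PicardTime.weak_cauchy [CompleteSpace H] [CompleteSpace E]
    (h : PicardTime J F M T L) (hF : Continuous F) {ψ : H}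
    (hψ : ‖ψ‖ + 1 ≤ M) (n : ℕ) : ∀ m, ∀ t,
    ‖J (picardIter F T ψ (n + m) t - picardIter F T ψ n t)‖ ≤ (‖J‖ * (M + M)) / 2 ^ n := by
  induction n with
  | zero =>
    intro m t
    have h1 := (h.picardIter_spec hF hψ (0 + m)).2 t
    have h2 := (h.picardIter_spec hF hψ 0).2 t
    rw [pow_zero, div_one]
    refine (J.le_opNorm _).trans ?_
    gcongr
    exact (norm_sub_le _ _).trans (add_le_add h1 h2)
  | succ n ih =>
    intro m t
    obtain ⟨c1, b1⟩ := h.picardIter_spec hF hψ (n + m)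
    obtain ⟨c2, b2⟩ := h.picardIter_spec hF hψ n
    have := h.weak_step hF ψ ψ c1 c2 b1 b2 (ih m) t
    rw [sub_self, map_zero, norm_zero, zero_add] at this
    rw [Nat.add_right_comm]
    refine this.trans (le_of_eq ?_)
    rw [pow_succ]; field_simp

/-- Induction on the number of halvings. A distance at most `d = 2M/2^k + ε` becomes at most `d/2 +
ε/2 = 2M/2^(k+1) + ε` after one step, provided the iterates are weakly within `δ`. The weak
contraction ensures this for large `n`, so the threshold grows with `k` while the error `ε` does not
accumulate. -/
theorem PicardTime.strong_cauchy [CompleteSpace H] [CompleteSpace E]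
    (h : PicardTime J F M T L) (hF : Continuous F) {ψ : H}
    (hψ : ‖ψ‖ + 1 ≤ M) {ε : ℝ} (hε : 0 < ε) (k : ℕ) : ∃ N, ∀ n ≥ N, ∀ m, ∀ t,
    ‖picardIter F T ψ (n + m) t - picardIter F T ψ n t‖ ≤ (M + M) / 2 ^ k + ε := by
  have hM : 0 ≤ M := by linarith [norm_nonneg ψ]
  induction k with
  | zero =>
    refine ⟨0, fun n _ m t => ?_⟩
    have h1 := (h.picardIter_spec hF hψ (n + m)).2 t
    have h2 := (h.picardIter_spec hF hψ n).2 t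
    rw [pow_zero, div_one]
    linarith [norm_sub_le (picardIter F T ψ (n + m) t) (picardIter F T ψ n t)]
  | succ k ih =>
    obtain ⟨N, hN⟩ := ih
    have hT := h.pos
    obtain ⟨δ, hδ, hs⟩ := h.strong (ε / 2 / T) (by positivity)
    have hlim : Tendsto (fun n : ℕ => (‖J‖ * (M + M)) / 2 ^ n) atTop (𝓝 0) := by
      simpa [div_eq_mul_inv, ← inv_pow] using
        (tendsto_pow_atTop_nhds_zero_of_lt_one (r := (2⁻¹ : ℝ)) (by norm_num)
          (by norm_num)).const_mul (‖J‖ * (M + M))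
    obtain ⟨N', hN'⟩ := (hlim.eventually (gt_mem_nhds hδ)).exists_forall_of_atTop
    refine ⟨max N N' + 1, fun n hn m t => ?_⟩
    obtain ⟨n, rfl⟩ : ∃ n', n = n' + 1 := ⟨n - 1, by omega⟩
    have hnN : N ≤ n := (le_max_left N N').trans (by omega)
    have hnN' : N' ≤ n := (le_max_right N N').trans (by omega)
    obtain ⟨c1, b1⟩ := h.picardIter_spec hF hψ (n + m)
    obtain ⟨c2, b2⟩ := h.picardIter_spec hF hψ n
    have := h.strong_step hF ψ ψ c1 c2 (d := (M + M) / 2 ^ k + ε) (ε := ε / 2 / T) (fun t => ?_)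
      (by positivity) t
    · rw [sub_self, norm_zero, zero_add] at this
      rw [Nat.add_right_comm]
      refine this.trans (le_of_eq ?_)
      rw [pow_succ]; field_simp; ring
    · refine (hs _ _ (b1 t) (b2 t) ((h.weak_cauchy hF hψ n m t).trans (hN' n hnN').le)).trans ?_
      have := h.nonneg
      gcongr
      exact hN n hnN m t

theorem PicardTime.exists_fixed [CompleteSpace H] [CompleteSpace E]
    (h : PicardTime J F M T L) (hF : Continuous F) {ψ : H}
    (hψ : ‖ψ‖ + 1 ≤ M) : ∃ x : ℝ → H, Continuous x ∧ (∀ t, ‖x t‖ ≤ M) ∧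
      ∀ t, x t = picardStep F T ψ x t := by
  have hM : 0 ≤ M := by linarith [norm_nonneg ψ]
  have hc : UniformCauchySeqOn (picardIter F T ψ) atTop univ := by
    rw [Metric.uniformCauchySeqOn_iff]
    intro ε hε
    obtain ⟨k, hk⟩ : ∃ k : ℕ, (M + M) / 2 ^ k < ε / 4 := by
      have hlim : Tendsto (fun n : ℕ => (M + M) / 2 ^ n) atTop (𝓝 0) := by
        simpa [div_eq_mul_inv, ← inv_pow] using
          (tendsto_pow_atTop_nhds_zero_of_lt_one (r := (2⁻¹ : ℝ)) (by norm_num)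
            (by norm_num)).const_mul (M + M)
      exact (hlim.eventually (gt_mem_nhds (by positivity))).exists
    obtain ⟨N, hN⟩ := h.strong_cauchy hF hψ (ε := ε / 8) (by positivity) k
    refine ⟨N, fun m hm n hn t _ => ?_⟩
    obtain ⟨m', rfl⟩ := Nat.exists_eq_add_of_le hm
    obtain ⟨n', rfl⟩ := Nat.exists_eq_add_of_le hn
    have h1 := hN N le_rfl m' t
    have h2 := hN N le_rfl n' t
    have := dist_triangle_right (picardIter F T ψ (N + m') t) (picardIter F T ψ (N + n') t)
      (picardIter F T ψ N t)
    rw [dist_eq_norm (picardIter F T ψ (N + m') t) (picardIter F T ψ N t),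
      dist_eq_norm (picardIter F T ψ (N + n') t) (picardIter F T ψ N t)] at this
    linarith
  choose x hx using fun t => cauchySeq_tendsto_of_complete (hc.cauchySeq (mem_univ t))
  have hu : TendstoUniformly (picardIter F T ψ) x atTop :=
    tendstoUniformlyOn_univ.1 (hc.tendstoUniformlyOn_of_tendsto fun t _ => hx t)
  have hxc : Continuous x :=
    hu.continuous (Eventually.of_forall fun n => (h.picardIter_spec hF hψ n).1).frequently
  refine ⟨x, hxc, fun t => le_of_tendsto (hx t).norm (Eventually.of_forall fun n =>
    (h.picardIter_spec hF hψ n).2 t), fun t => ?_⟩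
  refine tendsto_nhds_unique ((tendsto_add_atTop_iff_nat 1).2 (hx t)) ?_
  have hi : Tendsto (fun n => ∫ τ in (0 : ℝ)..clamp T t, F (picardIter F T ψ n τ)) atTop
      (𝓝 (∫ τ in (0 : ℝ)..clamp T t, F (x τ))) := by
    refine intervalIntegral.tendsto_integral_filter_of_dominated_convergence (fun _ => 1 / T)
      ?_ ?_ ?_ ?_
    · exact Eventually.of_forall fun n =>
        (hF.comp (h.picardIter_spec hF hψ n).1).aestronglyMeasurable
    · refine Eventually.of_forall fun n => Eventually.of_forall fun τ _ => ?_
      rw [le_div_iff₀ h.pos, mul_comm]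
      exact h.bound _ ((h.picardIter_spec hF hψ n).2 τ)
    · exact intervalIntegrable_const
    · exact Eventually.of_forall fun τ _ => (hF.tendsto _).comp (hx τ)
  exact hi.const_add ψ

theorem hasDerivWithinAt_of_eq_picardStep [CompleteSpace H] (hF : Continuous F) {ψ : H} {x : ℝ → H}
    (hx : Continuous x) (h : ∀ t, x t = picardStep F T ψ x t) {t : ℝ} (ht : t ∈ Icc 0 T) :
    HasDerivWithinAt x (F (x t)) (Icc 0 T) t := by
  have c := hF.comp hx
  have h1 : HasDerivAt (fun t => ψ + ∫ τ in (0 : ℝ)..t, F (x τ)) (F (x t)) t :=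
    (intervalIntegral.integral_hasDerivAt_right (c.intervalIntegrable _ _)
      (c.stronglyMeasurableAtFilter _ _) c.continuousAt).const_add ψ
  refine h1.hasDerivWithinAt.congr (fun s hs => ?_) ?_
  · rw [h s, picardStep, clamp_of_mem hs]
  · rw [h t, picardStep, clamp_of_mem ht]

theorem PicardTime.fixed_sub_weak [CompleteSpace H] [CompleteSpace E]
    (h : PicardTime J F M T L) (hF : Continuous F) {ψ χ : H}
    {x y : ℝ → H} (hx : Continuous x) (hy : Continuous y) (hxM : ∀ t, ‖x t‖ ≤ M)
    (hyM : ∀ t, ‖y t‖ ≤ M) (ex : ∀ t, x t = picardStep F T ψ x t)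
    (ey : ∀ t, y t = picardStep F T χ y t) (t : ℝ) :
    ‖J (x t - y t)‖ ≤ 2 * ‖J (ψ - χ)‖ := by
  refine le_two_mul_of_forall_le_add_half (g := fun t => ‖J (x t - y t)‖) ?_ (fun d hd t => ?_) t
  · refine ⟨‖J‖ * (M + M), ?_⟩
    rintro _ ⟨t, rfl⟩
    refine (J.le_opNorm _).trans ?_
    gcongr
    exact (norm_sub_le _ _).trans (add_le_add (hxM t) (hyM t))
  · rw [ex t, ey t]
    exact h.weak_step hF ψ χ hx hy hxM hyM hd t

theorem PicardTime.fixed_sub_strong (h : PicardTime J F M T L) (hF : Continuous F) {ψ χ : H}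
    {x y : ℝ → H} (hx : Continuous x) (hy : Continuous y) (hxM : ∀ t, ‖x t‖ ≤ M)
    (hyM : ∀ t, ‖y t‖ ≤ M) (ex : ∀ t, x t = picardStep F T ψ x t)
    (ey : ∀ t, y t = picardStep F T χ y t) {ε : ℝ}
    (hε : ∀ t, ‖F (x t) - F (y t)‖ ≤ L * ‖x t - y t‖ + ε) (t : ℝ) :
    ‖x t - y t‖ ≤ 2 * (‖ψ - χ‖ + T * ε) := by
  refine le_two_mul_of_forall_le_add_half (g := fun t => ‖x t - y t‖) ?_ (fun d hd t => ?_) t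
  · refine ⟨M + M, ?_⟩
    rintro _ ⟨t, rfl⟩
    exact (norm_sub_le _ _).trans (add_le_add (hxM t) (hyM t))
  · nth_rw 1 [ex t, ey t]
    refine h.strong_step hF ψ χ hx hy (fun t => (hε t).trans ?_) ((norm_nonneg _).trans (hd t)) t
    have := h.nonneg
    gcongr
    exact hd t

/-- Gronwall's inequality in the weak norm: continuous curves on a compact interval are bounded in
the strong norm, so `F` is Lipschitz for the weak norm along both. -/
theorem WeaklyLipschitz.eqOn (hF : WeaklyLipschitz J F) (hJ : Function.Injective J) {T : ℝ}
    {x y : ℝ → H} (hx : ∀ t ∈ Icc 0 T, HasDerivWithinAt x (F (x t)) (Icc 0 T) t)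
    (hy : ∀ t ∈ Icc 0 T, HasDerivWithinAt y (F (y t)) (Icc 0 T) t) (h0 : x 0 = y 0) :
    EqOn x y (Icc 0 T) := by
  have cx : ContinuousOn x (Icc 0 T) := fun t ht => (hx t ht).continuousWithinAt
  have cy : ContinuousOn y (Icc 0 T) := fun t ht => (hy t ht).continuousWithinAt
  obtain ⟨M1, hM1⟩ := isCompact_Icc.exists_bound_of_continuousOn cx
  obtain ⟨M2, hM2⟩ := isCompact_Icc.exists_bound_of_continuousOn cy
  obtain ⟨L, hL, h⟩ := hF.weak (max M1 M2)
  have key := eq_zero_of_abs_deriv_le_mul_abs_self_of_eq_zero_right (f := fun t => J (x t - y t))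
    (f' := fun t => J (F (x t) - F (y t))) (K := L) (a := 0) (b := T)
    (J.continuous.comp_continuousOn (cx.sub cy)) ?_ (by simp [h0]) ?_
  · intro t ht
    have := key t ht
    rw [← sub_eq_zero]
    exact hJ (by rw [this, map_zero])
  · intro t ht
    have := (J.hasFDerivAt.comp_hasDerivWithinAt t ((hx t (Ico_subset_Icc_self ht)).sub
      (hy t (Ico_subset_Icc_self ht))))
    exact this.mono_of_mem_nhdsWithin (Icc_mem_nhdsGE_of_mem ht)
  · intro t ht
    have ht' := Ico_subset_Icc_self ht
    exact h _ _ ((hM1 t ht').trans (le_max_left _ _)) ((hM2 t ht').trans (le_max_right _ _))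

theorem WeaklyLipschitz.wellPosed [CompleteSpace H] [CompleteSpace E]
    (hF : WeaklyLipschitz J F) (hJ : Function.Injective J) (φ : H) :
    ∃ T > 0, ∃ S : H → ℝ → H,
      (∀ ψ ∈ Metric.ball φ 1, S ψ 0 = ψ ∧ Continuous (S ψ) ∧
        ∀ t ∈ Icc 0 T, HasDerivWithinAt (S ψ) (F (S ψ t)) (Icc 0 T) t) ∧
      (∀ ψ ∈ Metric.ball φ 1, ∀ T' ≤ T, ∀ v : ℝ → H, v 0 = ψ →
        (∀ t ∈ Icc 0 T', HasDerivWithinAt v (F (v t)) (Icc 0 T') t) → EqOn v (S ψ) (Icc 0 T')) ∧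
      (∀ ψ ∈ Metric.ball φ 1, ∀ ε > 0, ∃ δ > 0, ∀ χ ∈ Metric.ball φ 1, ‖χ - ψ‖ < δ →
        ∀ t, ‖S χ t - S ψ t‖ < ε ∧ ‖F (S χ t) - F (S ψ t)‖ < ε) := by
  -- Data in the unit ball around `φ` have norm at most `‖φ‖ + 1`, one less than the radius in which
  -- the iterates must stay; hence one `T` serves the whole ball.
  obtain ⟨T, L, h⟩ := hF.exists_picardTime (‖φ‖ + 2)
  have hT := h.pos
  have hc := hF.continuous
  have hball : ∀ ψ ∈ Metric.ball φ 1, ‖ψ‖ + 1 ≤ ‖φ‖ + 2 := by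
    intro ψ hψ
    have h1 := mem_ball_iff_norm.1 hψ
    have h2 := norm_le_norm_add_norm_sub' ψ φ
    linarith
  have hex : ∀ ψ, ∃ x : ℝ → H, ψ ∈ Metric.ball φ 1 → Continuous x ∧ (∀ t, ‖x t‖ ≤ ‖φ‖ + 2) ∧
      ∀ t, x t = picardStep F T ψ x t := by
    intro ψ
    by_cases hψ : ψ ∈ Metric.ball φ 1
    · obtain ⟨x, hx⟩ := h.exists_fixed hc (hball ψ hψ)
      exact ⟨x, fun _ => hx⟩
    · exact ⟨0, fun h => absurd h hψ⟩
  choose S hS using hex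
  have h0 : ∀ ψ ∈ Metric.ball φ 1, S ψ 0 = ψ := by
    intro ψ hψ
    rw [(hS ψ hψ).2.2 0, picardStep, clamp_of_mem ⟨le_rfl, hT.le⟩]
    simp
  have hd : ∀ ψ ∈ Metric.ball φ 1, ∀ t ∈ Icc 0 T,
      HasDerivWithinAt (S ψ) (F (S ψ t)) (Icc 0 T) t := fun ψ hψ t ht =>
    hasDerivWithinAt_of_eq_picardStep hc (hS ψ hψ).1 (hS ψ hψ).2.2 ht
  refine ⟨T, hT, S, fun ψ hψ => ⟨h0 ψ hψ, (hS ψ hψ).1, hd ψ hψ⟩, ?_, ?_⟩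
  · intro ψ hψ T' hT' v hv0 hv
    refine hF.eqOn hJ hv (fun t ht => ?_) (by rw [hv0, h0 ψ hψ])
    exact (hd ψ hψ t ⟨ht.1, ht.2.trans hT'⟩).mono (Icc_subset_Icc_right hT')
  · intro ψ hψ ε hε
    have hL := h.nonneg
    set ε₀ := ε / (8 * (L + 1) * (T + 1)) with hε₀
    have hε₀0 : 0 < ε₀ := by positivity
    obtain ⟨δ, hδ, hs⟩ := h.strong ε₀ hε₀0
    -- The second bound keeps the two solutions weakly within `δ` at all times, so that the strong
    -- estimate with error `ε₀` applies. The first then gives `‖S χ t - S ψ t‖ ≤ 2 (T + 1) ε₀`.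
    refine ⟨min ε₀ (δ / (2 * (‖J‖ + 1))), by positivity, fun χ hχ hχψ t => ?_⟩
    obtain ⟨cx, bx, ex⟩ := hS χ hχ
    obtain ⟨cy, byy, ey⟩ := hS ψ hψ
    have hw : ∀ t, ‖J (S χ t - S ψ t)‖ ≤ δ := by
      intro t
      have h1 := h.fixed_sub_weak hc cx cy bx byy ex ey t
      have h2 : ‖χ - ψ‖ ≤ δ / (2 * (‖J‖ + 1)) := hχψ.le.trans (min_le_right _ _)
      rw [le_div_iff₀ (by positivity)] at h2
      have h3 := J.le_opNorm (χ - ψ)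
      nlinarith [norm_nonneg (χ - ψ)]
    have hst : ∀ t, ‖F (S χ t) - F (S ψ t)‖ ≤ L * ‖S χ t - S ψ t‖ + ε₀ := fun t =>
      hs _ _ (bx t) (byy t) (hw t)
    have h1 := h.fixed_sub_strong hc cx cy bx byy ex ey hst t
    have h2 : ‖χ - ψ‖ ≤ ε₀ := hχψ.le.trans (min_le_left _ _)
    have h3 : ‖S χ t - S ψ t‖ ≤ 2 * (T + 1) * ε₀ := by linarith
    have h4 := hst t
    have h5 : L * ‖S χ t - S ψ t‖ ≤ L * (2 * (T + 1) * ε₀) := by gcongr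
    have h6 : 8 * ((L + 1) * (T + 1) * ε₀) = ε := by rw [hε₀]; field_simp
    have h7 : 0 < (T + 1) * ε₀ := by positivity
    have h8 : 0 ≤ L * ((T + 1) * ε₀) := by positivity
    have h9 : 0 < T * ε₀ := by positivity
    constructor <;> nlinarith

end Picard

/-! ### Distributional derivative of a convolution -/

theorem integrable_mul_mul_bdd {ν : Measure ℝ} [SFinite ν] {A B V : ℝ → ℝ} (hA : Integrable A)
    (hB : Integrable B ν) (hV : Measurable V) {R : ℝ} (hR : ∀ x, |V x| ≤ R) :
    Integrable (fun p : ℝ × ℝ => A p.1 * (B p.2 * V (p.1 - p.2))) (volume.prod ν) := by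
  have h := (hA.mul_prod hB).mul_bdd (g := fun p : ℝ × ℝ => V (p.1 - p.2)) (c := R)
    (hV.comp (by fun_prop : Measurable fun p : ℝ × ℝ => p.1 - p.2)).aestronglyMeasurable
    (Eventually.of_forall fun p => hR _)
  simpa [mul_assoc] using h

theorem integrable_mul_comp_add_mul_bdd {ν : Measure ℝ} [SFinite ν] {A B V : ℝ → ℝ}
    (hA : Integrable A) (hAc : Continuous A) (hB : Integrable B ν) (hV : Measurable V) {R : ℝ}
    (hR : ∀ x, |V x| ≤ R) :
    Integrable (fun p : ℝ × ℝ => B p.1 * (A (p.2 + p.1) * V p.2)) (ν.prod volume) := by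
  have hm : AEStronglyMeasurable (fun p : ℝ × ℝ => B p.1 * (A (p.2 + p.1) * V p.2))
      (ν.prod volume) := by
    refine hB.aestronglyMeasurable.comp_fst.mul (AEStronglyMeasurable.mul ?_ ?_)
    · exact (hAc.comp (by fun_prop : Continuous fun p : ℝ × ℝ => p.2 + p.1)).aestronglyMeasurable
    · exact (hV.comp measurable_snd).aestronglyMeasurable
  have hi : ∀ t, Integrable fun x => A (x + t) * V x := fun t =>
    (hA.comp_add_right t).mul_bdd hV.aestronglyMeasurable (Eventually.of_forall hR)
  rw [integrable_prod_iff hm]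
  refine ⟨Eventually.of_forall fun t => (hi t).const_mul (B t), ?_⟩
  refine (hB.norm.mul_const (∫ x, |A x| * R)).mono hm.norm.integral_prod_right'
    (Eventually.of_forall fun t => ?_)
  have hR0 : 0 ≤ R := (abs_nonneg _).trans (hR 0)
  have h0 : 0 ≤ ∫ x, |A x| * R := integral_nonneg fun x => by positivity
  rw [Real.norm_of_nonneg (integral_nonneg fun x => norm_nonneg _),
    Real.norm_of_nonneg (by positivity)]
  simp_rw [norm_mul (B t)]
  rw [integral_const_mul]
  refine mul_le_mul_of_nonneg_left ?_ (norm_nonneg _)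
  rw [← integral_add_right_eq_self (fun x => |A x| * R) t]
  refine integral_mono (hi t).norm ((hA.abs.mul_const R).comp_add_right t) fun x => ?_
  change ‖A (x + t) * V x‖ ≤ |A (x + t)| * R
  rw [norm_mul]
  exact mul_le_mul_of_nonneg_left (hR x) (norm_nonneg _)

theorem locallyIntegrable_convolution_bdd {β V : ℝ → ℝ} (hβ : Integrable β) (hV : Measurable V)
    {R : ℝ} (hR : ∀ x, |V x| ≤ R) :
    LocallyIntegrable (β ⋆[ContinuousLinearMap.mul ℝ ℝ, volume] V) := by
  rw [locallyIntegrable_iff]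
  intro K hK
  have hKm := hK.measurableSet
  have hA : Integrable (K.indicator fun _ => (1 : ℝ)) := by
    rw [integrable_indicator_iff hKm]
    exact integrableOn_const hK.measure_lt_top.ne
  have := (integrable_mul_mul_bdd hA hβ hV hR).integral_prod_left
  rw [← integrable_indicator_iff hKm]
  refine this.congr (Eventually.of_forall fun x => ?_)
  simp only [integral_const_mul]
  by_cases hx : x ∈ K
  · simp only [hx, indicator_of_mem, one_mul]
    rfl
  · simp [hx]

/-- Fubini twice, with a translation in between, moves `β` from the bounded factor to the test
function. -/
theorem integral_convolution_mul {β V A : ℝ → ℝ} (hβ : Integrable β) (hV : Measurable V)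
    {R : ℝ} (hR : ∀ x, |V x| ≤ R) (hA : Integrable A) (hAc : Continuous A) :
    ∫ x, (β ⋆[ContinuousLinearMap.mul ℝ ℝ, volume] V) x * A x =
      ∫ x, (∫ t, β t * A (x + t)) * V x := by
  have e1 : ∀ x, (β ⋆[ContinuousLinearMap.mul ℝ ℝ, volume] V) x * A x =
      ∫ t, A x * (β t * V (x - t)) := by
    intro x
    rw [integral_const_mul, mul_comm]
    rfl
  have e2 : ∀ t, ∫ x, A x * (β t * V (x - t)) = ∫ x, β t * (A (x + t) * V x) := by
    intro t
    rw [← integral_add_right_eq_self (fun x => A x * (β t * V (x - t))) t]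
    congr 1; ext x
    rw [add_sub_cancel_right]; ring
  simp_rw [e1]
  rw [integral_integral_swap (f := fun x t => A x * (β t * V (x - t)))
    (integrable_mul_mul_bdd hA hβ hV hR)]
  simp_rw [e2]
  rw [integral_integral_swap (f := fun t x => β t * (A (x + t) * V x))
    (integrable_mul_comp_add_mul_bdd hA hAc hβ hV hR)]
  congr 1; ext x
  rw [← integral_mul_const]
  congr 1; ext t; ring

theorem integrable_deriv_of_hasCompactSupport {θ : ℝ → ℝ} (h1 : ContDiff ℝ ∞ θ)
    (h2 : HasCompactSupport θ) : Continuous (deriv θ) ∧ Integrable (deriv θ) := by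
  have hc : Continuous (deriv θ) := h1.continuous_deriv (by simp)
  exact ⟨hc, hc.integrable_of_hasCompactSupport h2.deriv⟩

theorem integral_measure_comp_add_mul (ν : Measure ℝ) [IsFiniteMeasure ν] {V θ : ℝ → ℝ}
    (hV : Measurable V) {R : ℝ} (hR : ∀ x, |V x| ≤ R) (hc : Continuous θ) (hi : Integrable θ) :
    Integrable (fun x => (∫ t, θ (x + t) ∂ν) * V x) ∧
    ∫ x, (∫ t, θ (x + t) ∂ν) * V x = ∫ t, (∫ x, θ x * V (x + -t)) ∂ν := by
  have hI := integrable_mul_comp_add_mul_bdd hi hc (integrable_const (μ := ν) (1 : ℝ)) hV hR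
  have e : ∀ x, (∫ t, θ (x + t) ∂ν) * V x = ∫ t, 1 * (θ (x + t) * V x) ∂ν := by
    intro x
    rw [← integral_mul_const]
    simp
  simp_rw [e]
  refine ⟨hI.integral_prod_right, ?_⟩
  rw [← integral_integral_swap (f := fun t x => 1 * (θ (x + t) * V x)) hI]
  congr 1; ext t
  rw [← integral_add_right_eq_self (fun x => θ x * V (x + -t)) t]
  congr 1; ext x
  rw [add_neg_cancel_right, one_mul]

/-- The derivative of a convolution is the convolution with the measure derivative. -/
theorem integral_convolution_mul_deriv {β : ℝ → ℝ} (hβ : Integrable β) {μ : SignedMeasure ℝ}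
    (hμ : HasMeasureDeriv β μ) {V : ℝ → ℝ} (hV : Measurable V) {R : ℝ} (hR : ∀ x, |V x| ≤ R)
    {θ : ℝ → ℝ} (h1 : ContDiff ℝ ∞ θ) (h2 : HasCompactSupport θ) :
    ∫ x, (β ⋆[ContinuousLinearMap.mul ℝ ℝ, volume] V) x * deriv θ x =
      (∫ t, (∫ x, θ x * V (x + -t)) ∂μ.toJordanDecomposition.negPart) -
        ∫ t, (∫ x, θ x * V (x + -t)) ∂μ.toJordanDecomposition.posPart := by
  obtain ⟨hc, hi⟩ := integrable_deriv_of_hasCompactSupport h1 h2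
  have hi' : Integrable θ := h1.continuous.integrable_of_hasCompactSupport h2
  obtain ⟨ip, ep⟩ := integral_measure_comp_add_mul μ.toJordanDecomposition.posPart hV hR
    h1.continuous hi'
  obtain ⟨im, em⟩ := integral_measure_comp_add_mul μ.toJordanDecomposition.negPart hV hR
    h1.continuous hi'
  rw [integral_convolution_mul hβ hV hR hi hc, ← ep, ← em, ← integral_sub im ip]
  congr 1; ext x
  -- For each `x` the definition of the measure derivative is tested with the translate `θ (x + ·)`.
  have := hμ.2 (fun t => θ (x + t)) (by fun_prop)
    (h2.comp_homeomorph (Homeomorph.addLeft x))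
  simp only [deriv_comp_const_add] at this
  rw [this]; ring

theorem HasWeakDeriv.ae_eq {v g₁ g₂ : ℝ → ℝ} (h₁ : HasWeakDeriv v g₁) (h₂ : HasWeakDeriv v g₂) :
    g₁ =ᵐ[volume] g₂ := by
  refine ae_eq_of_integral_contDiff_smul_eq h₁.2.1 h₂.2.1 fun θ a b => ?_
  have e1 := h₁.2.2 θ a b
  have e2 := h₂.2.2 θ a b
  simp only [smul_eq_mul, mul_comm (θ _)]
  linarith

/-! ### Convolution with a measure on `H^s` -/

namespace SobolevH

variable {s : ℝ}

/-- The convolution of an element of `H^s` with a measure. -/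
def smear (ν : Measure ℝ) (u : SobolevH s) : SobolevH s := ∫ z, shiftH (-z) u ∂ν

theorem integrable_shiftH (ν : Measure ℝ) [IsFiniteMeasure ν] (u : SobolevH s) :
    Integrable (fun z => shiftH (-z) u) ν := by
  refine Integrable.of_bound (C := ‖u‖)
    (u.continuous_shiftH.comp continuous_neg).aestronglyMeasurable
    (Eventually.of_forall fun z => (norm_shiftH _ u).le)

theorem smear_sub (ν : Measure ℝ) [IsFiniteMeasure ν] (u v : SobolevH s) :
    smear ν (u - v) = smear ν u - smear ν v := by
  rw [smear, smear, smear, ← integral_sub (integrable_shiftH ν u) (integrable_shiftH ν v)]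
  congr 1; ext z
  exact toL2_injective (by simp [toL2_shiftH])

theorem norm_smear_le (ν : Measure ℝ) [IsFiniteMeasure ν] (u : SobolevH s) :
    ‖smear ν u‖ ≤ ν.real univ * ‖u‖ := by
  refine (norm_integral_le_of_norm_le_const (C := ‖u‖)
    (Eventually.of_forall fun z => (norm_shiftH (-z) u).le)).trans (le_of_eq ?_)
  rw [mul_comm]

/-- The inclusion in `L²` is continuous and linear and so commutes with the Bochner integral; this
makes the `L²` bound available alongside the `H^s` bound. -/
theorem toL2_smear (hs : 0 ≤ s) (ν : Measure ℝ) [IsFiniteMeasure ν] (u : SobolevH s) :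
    toL2 (smear ν u) = ∫ z, shift (-z) (toL2 u) ∂ν := by
  have := completeSpace hs
  exact ((toL2L hs).integral_comp_comm (integrable_shiftH ν u)).symm

theorem norm_toL2_smear_le (hs : 0 ≤ s) (ν : Measure ℝ) [IsFiniteMeasure ν] (u : SobolevH s) :
    ‖toL2 (smear ν u)‖ ≤ ν.real univ * ‖toL2 u‖ := by
  rw [toL2_smear hs]
  refine (norm_integral_le_of_norm_le_const (C := ‖toL2 u‖)
    (Eventually.of_forall fun z => ((shift (-z)).norm_map _).le)).trans (le_of_eq ?_)
  rw [mul_comm]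

/-- Pairing with `θ` is a continuous functional on `L²` and passes under the Bochner integral. This
links the abstract convolution with the iterated integrals that appear in the distributional
derivative. -/
theorem integral_mul_smear (hs : 0 ≤ s) (ν : Measure ℝ) [IsFiniteMeasure ν] (u : SobolevH s)
    {V θ : ℝ → ℝ} (hV : toL2 u =ᵐ[volume] V) (hθ : MemLp θ 2 volume) :
    ∫ x, θ x * toL2 (smear ν u) x = ∫ z, (∫ x, θ x * V (x + -z)) ∂ν := by
  have hp : ∀ w : RealL2, innerSL ℝ hθ.toLp w = ∫ x, θ x * w x := by
    intro w
    rw [innerSL_apply_apply, L2.inner_def]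
    apply integral_congr_ae
    filter_upwards [hθ.coeFn_toLp] with x hx
    rw [hx]
    simp [mul_comm]
  have hi : Integrable (fun z => shift (-z) (toL2 u)) ν :=
    (toL2L hs).integrable_comp (integrable_shiftH ν u)
  rw [← hp, toL2_smear hs, ← (innerSL ℝ hθ.toLp).integral_comp_comm hi]
  congr 1; ext z
  rw [hp]
  apply integral_congr_ae
  filter_upwards [coeFn_shift (-z) (toL2 u), ae_comp_add hV (-z)] with x h1 h2
  rw [h1, h2]

/-- The operator `v ↦ -(β ∗ v)_x` on `H^s`, where `μ` is the derivative of `β`. -/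
def negDerivConv (μ : SignedMeasure ℝ) (u : SobolevH s) : SobolevH s :=
  smear μ.toJordanDecomposition.negPart u - smear μ.toJordanDecomposition.posPart u

/-- The total mass of a signed measure. -/
def totalMass (μ : SignedMeasure ℝ) : ℝ :=
  μ.toJordanDecomposition.negPart.real univ + μ.toJordanDecomposition.posPart.real univ

theorem negDerivConv_sub (μ : SignedMeasure ℝ) (u v : SobolevH s) :
    negDerivConv μ (u - v) = negDerivConv μ u - negDerivConv μ v := by
  simp only [negDerivConv, smear_sub]; abel

theorem norm_negDerivConv_le (μ : SignedMeasure ℝ) (u : SobolevH s) :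
    ‖negDerivConv μ u‖ ≤ totalMass μ * ‖u‖ := by
  rw [totalMass, add_mul]
  exact (norm_sub_le _ _).trans (add_le_add (norm_smear_le _ u) (norm_smear_le _ u))

theorem norm_toL2_negDerivConv_le (hs : 0 ≤ s) (μ : SignedMeasure ℝ) (u : SobolevH s) :
    ‖toL2 (negDerivConv μ u)‖ ≤ totalMass μ * ‖toL2 u‖ := by
  rw [totalMass, add_mul, negDerivConv, map_sub]
  exact (norm_sub_le _ _).trans
    (add_le_add (norm_toL2_smear_le hs _ u) (norm_toL2_smear_le hs _ u))

theorem hasWeakDeriv_convolution (hs : 0 ≤ s) {β : ℝ → ℝ} (hβ : Integrable β)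
    {μ : SignedMeasure ℝ} (hμ : HasMeasureDeriv β μ) {V : ℝ → ℝ} (hVm : Measurable V) {R : ℝ}
    (hR : ∀ᵐ x, |V x| ≤ R) (p : SobolevH s) (hp : toL2 p =ᵐ[volume] V) :
    HasWeakDeriv (β ⋆[ContinuousLinearMap.mul ℝ ℝ, volume] V)
      (fun x => -(negDerivConv μ p) x) := by
  have hR0 : 0 ≤ R := by
    obtain ⟨x, hx⟩ := hR.exists
    exact (abs_nonneg _).trans hx
  -- Truncation makes the bound hold everywhere, as the Fubini lemmas require, and changes `V` only
  -- on a null set, which the convolution does not see.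
  set W : ℝ → ℝ := fun x => max (-R) (min (V x) R) with hW
  have hWm : Measurable W := by fun_prop
  have hWR : ∀ x, |W x| ≤ R := fun x =>
    abs_le.2 ⟨le_max_left _ _, max_le (by linarith) (min_le_right _ _)⟩
  have hVW : V =ᵐ[volume] W := by
    filter_upwards [hR] with x hx
    have := abs_le.1 hx
    simp [hW, this.1, this.2]
  have hconv : β ⋆[ContinuousLinearMap.mul ℝ ℝ, volume] V =
      β ⋆[ContinuousLinearMap.mul ℝ ℝ, volume] W := by
    exact convolution_congr _ ae_eq_rfl hVW
  rw [hconv]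
  refine ⟨locallyIntegrable_convolution_bdd hβ hWm hWR, (Lp.locallyIntegrable_two _).neg,
    fun θ h1 h2 => ?_⟩
  rw [integral_convolution_mul_deriv hβ hμ hWm hWR h1 h2]
  have hθ : MemLp θ 2 volume := h1.continuous.memLp_of_hasCompactSupport h2
  have hpW := hp.trans hVW
  rw [← integral_mul_smear hs _ p hpW hθ, ← integral_mul_smear hs _ p hpW hθ,
    ← integral_sub, ← integral_neg]
  · apply integral_congr_ae
    filter_upwards [Lp.coeFn_sub (toL2 (smear μ.toJordanDecomposition.negPart p))
      (toL2 (smear μ.toJordanDecomposition.posPart p))] with x hx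
    rw [negDerivConv, map_sub, hx, Pi.sub_apply]
    ring
  · exact hθ.integrable_mul (Lp.memLp _)
  · exact hθ.integrable_mul (Lp.memLp _)

end SobolevH

/-! ### The evolution equation as an ordinary differential equation in `H^s` -/

namespace NemBound

open SobolevH

variable {s : ℝ} {f : ℝ → ℝ}

theorem sobNorm_nem_sub_le (h : NemBound s f) (M : ℝ) : ∃ L : ℝ, 0 ≤ L ∧ ∀ ε > 0, ∃ C : ℝ, 0 ≤ C ∧
    ∀ u v : SobolevH s, ‖u‖ ≤ M → ‖v‖ ≤ M → sobNorm s (nem f (toL2 u) - nem f (toL2 v)) ≤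
      ENNReal.ofReal (L * ‖u - v‖ + C * ‖toL2 (u - v)‖ + ε) := by
  obtain ⟨L, hL⟩ := h M.toNNReal
  refine ⟨L, L.coe_nonneg, fun ε hε => ?_⟩
  lift ε to ℝ≥0 using hε.le
  obtain ⟨C, hC⟩ := hL ε (by exact_mod_cast hε)
  refine ⟨C, C.coe_nonneg, fun u v hu hv => ?_⟩
  have key : ∀ w : SobolevH s, ‖w‖ ≤ M → sobNorm s (toL2 w) ≤ M.toNNReal := by
    intro w hw
    rw [← SobolevH.enorm_eq_sobNorm, ← ofReal_norm]
    exact ENNReal.ofReal_le_ofReal hw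
  refine (hC _ _ (key u hu) (key v hv)).trans (le_of_eq ?_)
  rw [ENNReal.ofReal_add (by positivity) hε.le, ENNReal.ofReal_add (by positivity) (by positivity),
    ENNReal.ofReal_mul L.coe_nonneg, ENNReal.ofReal_mul C.coe_nonneg, ofReal_norm, ofReal_norm,
    SobolevH.enorm_eq_sobNorm, map_sub, ENNReal.ofReal_coe_nnreal, ENNReal.ofReal_coe_nnreal,
    ENNReal.ofReal_coe_nnreal]

theorem sobNorm_nem_lt_top (h : NemBound s f) (hf : ContDiff ℝ 1 f) (hf0 : f 0 = 0)
    (u : SobolevH s) : sobNorm s (nem f (toL2 u)) < ⊤ := by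
  obtain ⟨L, -, hL⟩ := h.sobNorm_nem_sub_le ‖u‖
  obtain ⟨C, -, hC⟩ := hL 1 one_pos
  have := hC u 0 le_rfl (by simp)
  rw [map_zero, nem_zero hf hf0, sub_zero] at this
  exact this.trans_lt ENNReal.ofReal_lt_top

end NemBound

namespace SobolevH

variable {s : ℝ} {f : ℝ → ℝ}

/-- The superposition operator `u ↦ f(u)` on `H^s`. -/
def superpose (h : NemBound s f) (hf : ContDiff ℝ 1 f) (hf0 : f 0 = 0) (u : SobolevH s) :
    SobolevH s :=
  SobolevH.mk (nem f (toL2 u)) (h.sobNorm_nem_lt_top hf hf0 u)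

variable (h : NemBound s f) (hf : ContDiff ℝ 1 f) (hf0 : f 0 = 0)

theorem toL2_superpose (u : SobolevH s) : toL2 (superpose h hf hf0 u) = nem f (toL2 u) := rfl

theorem superpose_zero : superpose h hf hf0 0 = 0 :=
  toL2_injective (by rw [toL2_superpose, map_zero, nem_zero hf hf0])

theorem norm_superpose_sub_le (M : ℝ) : ∃ L : ℝ, 0 ≤ L ∧ ∀ ε > 0, ∃ C : ℝ, 0 ≤ C ∧
    ∀ u v : SobolevH s, ‖u‖ ≤ M → ‖v‖ ≤ M → ‖superpose h hf hf0 u - superpose h hf hf0 v‖ ≤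
      L * ‖u - v‖ + C * ‖toL2 (u - v)‖ + ε := by
  obtain ⟨L, hL0, hL⟩ := h.sobNorm_nem_sub_le M
  refine ⟨L, hL0, fun ε hε => ?_⟩
  obtain ⟨C, hC0, hC⟩ := hL ε hε
  refine ⟨C, hC0, fun u v hu hv => ?_⟩
  have := hC u v hu hv
  rw [← toL2_superpose h hf hf0, ← toL2_superpose h hf hf0, ← map_sub, ← enorm_eq_sobNorm,
    ← ofReal_norm] at this
  exact (ENNReal.ofReal_le_ofReal_iff (by positivity)).1 this

theorem exists_ae_abs_toL2_le (hs : 1 / 2 < s) (M : ℝ) :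
    ∃ R : ℝ, ∀ u : SobolevH s, ‖u‖ ≤ M → ∀ᵐ x, |u x| ≤ R := by
  obtain ⟨R, hR⟩ := exists_ae_abs_le hs M.toNNReal
  refine ⟨R, fun u hu => hR _ ?_⟩
  rw [← enorm_eq_sobNorm, ← ofReal_norm]
  exact ENNReal.ofReal_le_ofReal hu

theorem totalMass_nonneg (μ : SignedMeasure ℝ) : 0 ≤ totalMass μ :=
  add_nonneg measureReal_nonneg measureReal_nonneg

/-- The right-hand side `-(β ∗ f(u))_x` of the evolution equation is weakly Lipschitz. -/
theorem weaklyLipschitz_negDerivConv_superpose (hs : 1 / 2 < s) (hs0 : 0 ≤ s)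
    (μ : SignedMeasure ℝ) :
    WeaklyLipschitz (toL2L hs0) fun u : SobolevH s => negDerivConv μ (superpose h hf hf0 u) := by
  have hm := totalMass_nonneg μ
  refine ⟨fun M => ?_, fun M => ?_, fun M => ?_⟩
  · obtain ⟨L, hL0, hL⟩ := norm_superpose_sub_le h hf hf0 M
    obtain ⟨C, hC0, hC⟩ := hL 1 one_pos
    rcases le_or_gt 0 M with hM | hM
    · refine ⟨totalMass μ * (L * M + C * M + 1), by positivity, fun u hu => ?_⟩
      refine (norm_negDerivConv_le μ _).trans (mul_le_mul_of_nonneg_left ?_ hm)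
      have := hC u 0 hu (by simpa using hM)
      rw [superpose_zero, sub_zero, sub_zero] at this
      have h2 := (norm_toL2_le hs0 u).trans hu
      exact this.trans (by gcongr)
    · exact ⟨0, le_rfl, fun u hu => absurd (norm_nonneg u) (by linarith)⟩
  · obtain ⟨R, hR⟩ := exists_ae_abs_toL2_le hs M
    obtain ⟨L, hL0, hL⟩ := exists_norm_nem_sub_le hf hf0 R
    refine ⟨totalMass μ * L, by positivity, fun u v hu hv => ?_⟩
    rw [toL2L_apply, toL2L_apply, ← negDerivConv_sub, mul_assoc]
    refine (norm_toL2_negDerivConv_le hs0 μ _).trans (mul_le_mul_of_nonneg_left ?_ hm)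
    rw [map_sub, map_sub]
    exact hL _ _ (hR u hu) (hR v hv)
  · obtain ⟨L, hL0, hL⟩ := norm_superpose_sub_le h hf hf0 M
    refine ⟨totalMass μ * L, by positivity, fun ε hε => ?_⟩
    set m := totalMass μ + 1 with hm1
    have hmpos : 0 < m := by linarith
    -- Half of the error `ε/m` is the additive one; the other half pays for the `L²` term through
    -- the choice of `δ` below. `m` exceeds the total mass by 1 so as not to vanish.
    obtain ⟨C, hC0, hC⟩ := hL (ε / (2 * m)) (by positivity)
    refine ⟨ε / (2 * m * (C + 1)), by positivity, fun u v hu hv huv => ?_⟩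
    rw [toL2L_apply] at huv
    rw [← negDerivConv_sub]
    refine (norm_negDerivConv_le μ _).trans ?_
    have h1 : C * ‖toL2 (u - v)‖ ≤ ε / (2 * m) := by
      calc C * ‖toL2 (u - v)‖ ≤ (C + 1) * (ε / (2 * m * (C + 1))) :=
            mul_le_mul (by linarith) huv (norm_nonneg _) (by positivity)
        _ = ε / (2 * m) := by field_simp
    have h2 := hC u v hu hv
    calc totalMass μ * ‖superpose h hf hf0 u - superpose h hf hf0 v‖
        ≤ totalMass μ * (L * ‖u - v‖ + ε / m) := by
          refine mul_le_mul_of_nonneg_left ?_ hm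
          have : ε / (2 * m) + ε / (2 * m) = ε / m := by field_simp; ring
          linarith
      _ = totalMass μ * L * ‖u - v‖ + totalMass μ * (ε / m) := by ring
      _ ≤ totalMass μ * L * ‖u - v‖ + m * (ε / m) := by gcongr; linarith
      _ = _ := by rw [mul_div_cancel₀ _ hmpos.ne']

theorem hasWeakDeriv_convolution_comp (hs : 1 / 2 < s) {β : ℝ → ℝ} (hβ : Integrable β)
    {μ : SignedMeasure ℝ} (hμ : HasMeasureDeriv β μ) (u : SobolevH s) :
    HasWeakDeriv (β ⋆[ContinuousLinearMap.mul ℝ ℝ, volume] fun y => f (u y))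
      (fun x => -(negDerivConv μ (superpose h hf hf0 u)) x) := by
  obtain ⟨R, hR⟩ := exists_ae_abs_toL2_le hs ‖u‖
  have hu := hR u le_rfl
  obtain ⟨B, -, hB⟩ := exists_abs_le_of_continuous hf.continuous R
  refine hasWeakDeriv_convolution (by linarith) hβ hμ
    (hf.continuous.measurable.comp (Lp.stronglyMeasurable _).measurable) (R := B) ?_ _
    (coeFn_nem hf hf0 hu)
  filter_upwards [hu] with x hx using hB _ hx

end SobolevH

theorem theorem2p1 (β : ℝ → ℝ) (hβ : Integrable β)
    (hβ' : ∃ μ : SignedMeasure ℝ, HasMeasureDeriv β μ)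
    (s : ℝ) (hs : 1 / 2 < s)
    (f : ℝ → ℝ) (hf : ContDiff ℝ ((⌊s⌋₊ + 1 : ℕ) : WithTop ℕ∞) f) (hf0 : f 0 = 0)
    (φ : SobolevH s) :
    ∃ T > 0, WellPosedOn β f T φ := by
  obtain ⟨μ, hμ⟩ := hβ'
  have hs0 : 0 ≤ s := by linarith
  have := SobolevH.completeSpace hs0
  have hb : NemBound s f := nemBound _ hs (Nat.lt_floor_add_one s) hf hf0
  have hf1 : ContDiff ℝ 1 f := hf.of_le (by norm_cast; omega)
  have hF := SobolevH.weaklyLipschitz_negDerivConv_superpose hb hf1 hf0 hs hs0 μ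
  set F : SobolevH s → SobolevH s := fun u =>
    SobolevH.negDerivConv μ (SobolevH.superpose hb hf1 hf0 u)
  have heq : ∀ u : SobolevH s, HasWeakDeriv
      (β ⋆[ContinuousLinearMap.mul ℝ ℝ, volume] fun y => f (u y)) (fun x => -(F u) x) :=
    fun u => SobolevH.hasWeakDeriv_convolution_comp hb hf1 hf0 hs hβ hμ u
  obtain ⟨T, hT, S, h1, h2, h3⟩ := hF.wellPosed SobolevH.toL2_injective φ
  have hd : ∀ ψ ∈ Metric.ball φ 1, ∀ t ∈ Icc 0 T,
      derivWithin (S ψ) (Icc 0 T) t = F (S ψ t) := fun ψ hψ t ht =>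
    ((h1 ψ hψ).2.2 t ht).derivWithin (uniqueDiffOn_Icc hT t ht)
  refine ⟨T, hT, 1, one_pos, S, fun ψ hψ => ⟨?_, (h1 ψ hψ).1, fun t ht => ?_⟩,
    fun ψ hψ T' hT' hTT v hv => ?_, fun ψ hψ ε hε => ?_⟩
  · refine (contDiffOn_one_iff_derivWithin (uniqueDiffOn_Icc hT)).2 ⟨fun t ht =>
      ((h1 ψ hψ).2.2 t ht).differentiableWithinAt, ?_⟩
    exact ((hF.continuous.comp (h1 ψ hψ).2.1).continuousOn).congr (hd ψ hψ)
  · rw [hd ψ hψ t ht]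
    exact heq _
  · refine h2 ψ hψ T' hTT v hv.initial fun t ht => ?_
    -- Weak derivatives are unique almost everywhere, so the equation forces the time derivative of
    -- `v` to be `F (v t)` in `H^s`; uniqueness for the ordinary differential equation then applies.
    have hv' := (hv.contDiffOn.differentiableOn one_ne_zero t ht).hasDerivWithinAt
    convert hv' using 1
    refine SobolevH.toL2_injective (Lp.ext ?_)
    filter_upwards [(heq (v t)).ae_eq (hv.equation t ht)] with x hx
    exact neg_injective hx
  · obtain ⟨δ, hδ, h⟩ := h3 ψ hψ ε hε
    refine ⟨δ, hδ, fun χ hχ hχψ t ht => ?_⟩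
    rw [hd χ hχ t ht, hd ψ hψ t ht]
    exact h χ hχ hχψ t

end
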